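/- **Setting.** Let $d_A,d_B\ge 1$ be integers with $d_A\le d_B$ and $d_B\ge 2$, let $\gamma>0$, $0<\delta<1/16$, and put $$\beta_0=1-8\delta,\quad \beta_1=1-16\delta,\quad 0<\beta<\beta_1,\quad c_1=\frac{\beta_1-\beta}{\beta_0(1-\beta)},\quad c_2=\frac{2\beta_0}{\beta_1-\beta},\quad c>c_2+1,\quad c_3=\frac{2(1+c)}{\beta d_A},$$ $$\chi=(d_B(d_A-1)+1)(d_A(d_B-1)+1),\qquad \eta=1-\frac{\beta c_1(c-1-c_2)}{d_Ad_B\chi c},\qquad f_0(s)=\lceil\chi\log_{1/\eta}s\rceil\ (s\ge1),\quad f_0(0)=0.$$ Let $G$ be a finite bipartite graph on $A\sqcup B$ that is $(d_A,d_B)$-biregular (vertices of $A$ have degree $d_A$, vertices of $B$ degree $d_B$) and $(\gamma,\delta)$-expanding: $|\Gamma(S)|\ge(1-\delta)d_A|S|$ for all $S\subseteq A$ with $|S|\le\gamma|A|$, and $|\Gamma(S)|\ge(1-\delta)d_B|S|$ for all $S\subseteq B$ with $|S|\le\gamma|B|$. Its quantum expander code has qubits $V=A^2\sqcup B^2$,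 $n=|V|$, $Z$-type generators $C_X=A\times B$ and $X$-type generators $C_Z=B\times A$. The neighbourhood $\Gamma_X(v)\subseteq C_X$ is $\{(\alpha,\beta'):\beta'\sim a\}$ for $v=(\alpha,a)\in A^2$ and $\{(\alpha,\beta'):\alpha\sim b\}$ for $v=(b,\beta')\in B^2$. The support of $g=(b,a)\in C_Z$ is $\Gamma_Z(g)=\{(\alpha,a):\alpha\sim b\}\cup\{(b,\beta'):\beta'\sim a\}\subseteq V$. With $\oplus$ the symmetric difference, the syndrome of $E\subseteq V$ is $\sigma_X(E)=\bigoplus_{v\in E}\Gamma_X(v)$, and $E,E'\subseteq V$ are *equivalent* if $E\oplus E'$ is a sum ($\oplus$) of sets $\Gamma_Z(g)$. **Decoder.** Colour $C_Z$ with $\chi$ colours $0,\dots,\chi-1$ so that, whenever two distinct generators have the same colour, no $Z$-type generator is adjacent both to a qubit of the support of one and to a qubit of the support of the other. Let $\mathcal F$ be the set of nonempty $F$ that lie in some $\Gamma_Z(g)$ and satisfy $|\sigma_X(F)|\ge\frac{d_A}{2}|F|$, and let $\Delta(\sigma,F)=|\sigma|-|\sigma\oplus\sigma_X(F)|$. The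 parallel small-set-flip decoder with $f$ rounds on input $\sigma\subseteq C_X$ starts from $\hat E_0=\varnothing$, $\sigma_0=\sigma$. In round $i=0,\dots,f-1$, every generator $g$ of colour $i\bmod\chi$, in parallel, picks an arbitrary $F_g\in\mathcal F$ with $F_g\subseteq\Gamma_Z(g)$ and $\Delta(\sigma_i,F_g)\ge\beta|\sigma_X(F_g)|$ if there is one, and $F_g=\varnothing$ otherwise; with $F_i=\bigoplus_gF_g$ one sets $\hat E_{i+1}=\hat E_i\oplus F_i$ and $\sigma_{i+1}=\sigma_i\oplus\sigma_X(F_i)$. The output is $\hat E=\hat E_f$. **Theorem.** (1) There are constants $p_0,p_1,K,\kappa>0$, depending only on $d_A,d_B,\gamma,\delta,\beta,c$, such that the following holds for every such graph and colouring. Let $(E,D)$, $E\subseteq V$, $D\subseteq C_X$, be a random pair with $\mathbb P[S\subseteq E,\,T\subseteq D]\le p_{\mathrm{phys}}^{|S|}p_{\mathrm{synd}}^{|T|}$ for all $S\subseteq V$, $T\subseteq C_X$, where $0\le p_{\mathrm{phys}}<p_0$ and $0\le p_{\mathrm{synd}}<p_1$. Let the random set $\hat E$ be an output of the decoder, with arbitrary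 choices of the sets $F_g$, run for $f_0(|\sigma|)$ rounds on $\sigma=\sigma_X(E)\oplus D$. Then there are an event $\mathsf{succ}$ with $\mathbb P[\mathsf{succ}]\ge1-e^{-\kappa\sqrt n}$ and a random set $E_{\mathrm{ls}}\subseteq V$, always equivalent to $E\oplus\hat E$, such that for all $S\subseteq V$ $$\mathbb P[S\subseteq E_{\mathrm{ls}}\mid\mathsf{succ}]\le\bigl(Kp_{\mathrm{synd}}^{1/c_3}\bigr)^{|S|}.$$ (2) The decoder works in logarithmic depth: there is $C>0$, depending only on $d_A,d_B,\delta,\beta,c$, such that $f_0(s)\le C\log s$ for all integers $s\ge1$, and for every such graph and colouring and every integer $s\ge1$ there is a Boolean circuit of fan-in at most $2$ and depth at most $C\log s$ that computes, from every $\sigma\subseteq C_X$ (in particular from every $\sigma$ with $|\sigma|=s$), a valid output of the decoder with $f_0(s)$ rounds. -/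

import Mathlib

namespace QExpander

section Sets

/-- `⨁_{i ∈ s} f i`: the symmetric difference of the finite family of sets `f i`, `i ∈ s`,
i.e. the set of the points that lie in an odd number of its members. -/
def xorSum {ι α : Type*} [Fintype α] [DecidableEq α] (s : Finset ι) (f : ι → Finset α) :
    Finset α :=
  Finset.univ.filter fun x => Odd (s.filter fun i => x ∈ f i).card

end Sets

/-! ### Bipartite graphs -/

section Graph

variable {A B : Type*} [Fintype A] [DecidableEq A] [Fintype B] [DecidableEq B]
  (G : A → B → Prop) [DecidableRel G]

/-- The neighbours in `B` of a vertex of `A`. -/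
def nbrA (a : A) : Finset B := Finset.univ.filter fun b => G a b

/-- The neighbours in `A` of a vertex of `B`. -/
def nbrB (b : B) : Finset A := Finset.univ.filter fun a => G a b

/-- `(d_A, d_B)`-biregular bipartite graph. -/
def IsBiregular (dA dB : ℕ) : Prop :=
  (∀ a, (nbrA G a).card = dA) ∧ (∀ b, (nbrB G b).card = dB)

/-- `(γ, δ)`-expanding: left-expanding and right-expanding. -/
def IsExpanding (dA dB : ℕ) (γ δ : ℝ) : Prop :=
  (∀ S : Finset A, (S.card : ℝ) ≤ γ * Fintype.card A →
      (1 - δ) * dA * S.card ≤ ((S.biUnion (nbrA G)).card : ℝ)) ∧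
  (∀ S : Finset B, (S.card : ℝ) ≤ γ * Fintype.card B →
      (1 - δ) * dB * S.card ≤ ((S.biUnion (nbrB G)).card : ℝ))

end Graph

/-! ### The hypergraph product (quantum expander) code -/

/-- The qubits `V = A² ⊎ B²`. -/
abbrev Qubit (A B : Type*) := (A × A) ⊕ (B × B)

/-- The `Z`-type generators `C_X = A × B` (the checks that see `X`-type errors). -/
abbrev CheckX (A B : Type*) := A × B

/-- The `X`-type generators `C_Z = B × A`. -/
abbrev CheckZ (A B : Type*) := B × A

section Code

variable {A B : Type*} [Fintype A] [DecidableEq A] [Fintype B] [DecidableEq B]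
  (G : A → B → Prop) [DecidableRel G]

/-- Adjacency in the factor graph `G_X`: `(α, a)` is joined to `(α, β)` when `a ~ β`,
and `(b, β)` is joined to `(α, β)` when `α ~ b`. -/
def gammaX : Qubit A B → Finset (CheckX A B)
  | Sum.inl (α, a) => Finset.univ.filter fun x => x.1 = α ∧ G a x.2
  | Sum.inr (b, β) => Finset.univ.filter fun x => x.2 = β ∧ G x.1 b

/-- The support of the `X`-type generator `(b, a)`: the qubits `(α, a)` with `α ~ b` and the
qubits `(b, β)` with `a ~ β`. -/
def gammaZ (g : CheckZ A B) : Finset (Qubit A B) :=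
  (Finset.univ.filter fun p : A × A => p.2 = g.2 ∧ G p.1 g.1).disjSum
    (Finset.univ.filter fun p : B × B => p.1 = g.1 ∧ G g.2 p.2)

/-- The syndrome `σ_X(E) = ⨁_{v ∈ E} Γ_X(v)`. -/
def syndrome (E : Finset (Qubit A B)) : Finset (CheckX A B) := xorSum E (gammaX G)

/-- Two `X`-type errors are equivalent if they differ by a sum of `X`-type generators. -/
def Equivalent (E E' : Finset (Qubit A B)) : Prop :=
  ∃ X : Finset (CheckZ A B), symmDiff E E' = xorSum X (gammaZ G)

/-! ### The parallel small-set-flip decoder -/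

/-- `Δ(σ, F) = |σ| - |σ ⊕ σ_X(F)|`. -/
def decrease (σ : Finset (CheckX A B)) (F : Finset (Qubit A B)) : ℤ :=
  (σ.card : ℤ) - ((symmDiff σ (syndrome G F)).card : ℤ)

/-- The candidate flips `𝓕`: the nonempty `F` inside the support of an `X`-type generator with
`|σ_X(F)| ≥ (d_A / 2) |F|`. -/
def candidates (dA : ℕ) : Set (Finset (Qubit A B)) :=
  {F | F.Nonempty ∧ (∃ g : CheckZ A B, F ⊆ gammaZ G g) ∧
    (dA : ℝ) / 2 * F.card ≤ ((syndrome G F).card : ℝ)}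

/-- `𝓕_g`: the flips available to the generator `g` when the current syndrome is `σ`. -/
def available (dA : ℕ) (β : ℝ) (σ : Finset (CheckX A B)) (g : CheckZ A B) :
    Set (Finset (Qubit A B)) :=
  {F | F ∈ candidates G dA ∧ F ⊆ gammaZ G g ∧
    β * ((syndrome G F).card : ℝ) ≤ (decrease G σ F : ℝ)}

/-- A colouring of the `X`-type generators such that no `Z`-type generator meets the supports of
two distinct `X`-type generators of the same colour. -/
def IsGoodColoring {χ : ℕ} (color : CheckZ A B → Fin χ) : Prop :=
  ∀ g₁ g₂ : CheckZ A B, g₁ ≠ g₂ →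
    (∃ v₁ ∈ gammaZ G g₁, ∃ v₂ ∈ gammaZ G g₂, ∃ x : CheckX A B,
      x ∈ gammaX G v₁ ∧ x ∈ gammaX G v₂) →
    color g₁ ≠ color g₂

/-- `F` is a possible total flip of one round in which all the generators of colour `k` are
processed in parallel, each on the current syndrome `σ`: every such `g` flips an arbitrary
element of `𝓕_g` if there is one, and nothing otherwise. -/
def IsRound (dA : ℕ) (β : ℝ) {χ : ℕ} (color : CheckZ A B → Fin χ) (k : ℕ)
    (σ : Finset (CheckX A B)) (F : Finset (Qubit A B)) : Prop :=
  ∃ Fg : CheckZ A B → Finset (Qubit A B),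
    (∀ g, (color g : ℕ) = k →
      (Fg g ∈ available G dA β σ g ∨ (available G dA β σ g = ∅ ∧ Fg g = ∅))) ∧
    F = xorSum (Finset.univ.filter fun g : CheckZ A B => (color g : ℕ) = k) Fg

/-- `Ehat` is a possible output of the parallel small-set-flip decoder of parameter `β`, run for
`f` rounds on the input syndrome `σ`. Round `i` processes the colour `i mod χ`. -/
def IsParallelOutput (dA : ℕ) (β : ℝ) {χ : ℕ} (color : CheckZ A B → Fin χ) (f : ℕ)
    (σ : Finset (CheckX A B)) (Ehat : Finset (Qubit A B)) : Prop :=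
  ∃ (Es : ℕ → Finset (Qubit A B)) (σs : ℕ → Finset (CheckX A B)) (F : ℕ → Finset (Qubit A B)),
    Es 0 = ∅ ∧ σs 0 = σ ∧
    (∀ i < f, IsRound G dA β color (i % χ) (σs i) (F i) ∧
      Es (i + 1) = symmDiff (Es i) (F i) ∧
      σs (i + 1) = symmDiff (σs i) (syndrome G (F i))) ∧
    Ehat = Es f

end Code

/-! ### The constants -/

/-- `χ = (d_B (d_A - 1) + 1) (d_A (d_B - 1) + 1)`; used for `d_A, d_B ≥ 1` only. -/
def chi (dA dB : ℕ) : ℕ := (dB * (dA - 1) + 1) * (dA * (dB - 1) + 1)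

noncomputable section Constants

def beta0 (δ : ℝ) : ℝ := 1 - 8 * δ

def beta1 (δ : ℝ) : ℝ := 1 - 16 * δ

def c1 (δ β : ℝ) : ℝ := (beta1 δ - β) / (beta0 δ * (1 - β))

def c2 (δ β : ℝ) : ℝ := 2 * beta0 δ / (beta1 δ - β)

def c3 (dA : ℕ) (β c : ℝ) : ℝ := 2 * (1 + c) / (β * dA)

def eta (dA dB : ℕ) (δ β c : ℝ) : ℝ :=
  1 - β * c1 δ β * (c - 1 - c2 δ β) / (dA * dB * chi dA dB * c)

/-- The number of rounds `f₀(s) = ⌈χ log_{1/η} s⌉`, with `f₀(0) = 0`. -/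
def f0 (dA dB : ℕ) (δ β c : ℝ) (s : ℕ) : ℕ :=
  ⌈(chi dA dB : ℝ) * Real.logb (1 / eta dA dB δ β c) (s : ℝ)⌉₊

end Constants

/-! ### Random sets and noise -/

section Noise

open MeasureTheory

variable {Ω : Type*} [MeasurableSpace Ω]

/-- A random subset of a finite set: a map all of whose level sets are events. -/
def IsRandomSet {α : Type*} (X : Ω → Finset α) : Prop :=
  ∀ S : Finset α, MeasurableSet {ω | X ω = S}

/-- The pair of random sets `(E, D)` is local stochastic with parameters `(p, q)`. -/
def IsLocalStochasticPair {α α' : Type*} (μ : Measure Ω) (E : Ω → Finset α)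
    (D : Ω → Finset α') (p q : ℝ) : Prop :=
  ∀ (S : Finset α) (T : Finset α'),
    μ.real {ω | S ⊆ E ω ∧ T ⊆ D ω} ≤ p ^ S.card * q ^ T.card

/-- The random set `E` is local stochastic with parameter `p`. -/
def IsLocalStochastic {α : Type*} (μ : Measure Ω) (E : Ω → Finset α) (p : ℝ) : Prop :=
  ∀ S : Finset α, μ.real {ω | S ⊆ E ω} ≤ p ^ S.card

end Noise

/-! ### Circuits of bounded fan-in -/

/-- A one-output Boolean circuit with gates of fan-in at most two, unfolded into a tree
(which changes neither the function computed nor the depth). -/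
inductive Circuit (ι : Type*) where
  | const : Bool → Circuit ι
  | input : ι → Circuit ι
  | not : Circuit ι → Circuit ι
  | and : Circuit ι → Circuit ι → Circuit ι
  | or : Circuit ι → Circuit ι → Circuit ι

namespace Circuit

/-- The value of a circuit on an input. -/
def eval {ι : Type*} (x : ι → Bool) : Circuit ι → Bool
  | const b => b
  | input i => x i
  | not s => !(s.eval x)
  | and s t => s.eval x && t.eval x
  | or s t => s.eval x || t.eval x

/-- The depth: the largest number of gates on a path from an input to the output. -/
def depth {ι : Type*} : Circuit ι → ℕ
  | const _ => 0
  | input _ => 0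
  | not s => s.depth + 1
  | and s t => max s.depth t.depth + 1
  | or s t => max s.depth t.depth + 1

end Circuit

/-- The set computed by a family of circuits, one for each possible element, from an input set. -/
def circuitOutput {ι κ : Type*} [DecidableEq ι] [Fintype κ] (circ : κ → Circuit ι)
    (σ : Finset ι) : Finset κ :=
  Finset.univ.filter fun v => (circ v).eval (fun x => decide (x ∈ σ)) = true

end QExpander

open MeasureTheory ProbabilityTheory QExpander

set_option linter.unusedSectionVars false

/-! The checks adjacent to the support of a generator g = (b, a) form the grid Γ(b) × Γ(a). A subset
F of the support with x row qubits and y column qubits has a syndrome of x(d_A - y) + (d_B - x)y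
grid cells. If F is at most half of the support, this is at least d_A|F|/2 and at least a third of
the edges at F.

Expansion extends this to small errors e that fill no generator by more than half. Such an e splits
into pieces F_g ⊆ Γ_Z(g) so that, up to a fraction δ of the edges, each check sees a single piece
(`sum_weight_unselected_le`, `exists_partition`). Hence the pieces' syndromes have total size at
most |σ_X(e)|/β₀ (`exists_flips`). It follows that |σ_X(e)| is linear in |e|, and by averaging that
many F_g remain legal flips for a noisy syndrome (`card_flippable`).

Join two qubits if they share a check or a generator. The components of the set U of all qubits ever
in error or flipped evolve independently. In a sweep over the χ colours, a generator that could flip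
at the start either flips or is disturbed by a conflicting flip, and one flip disturbs at most χ
generators. So the syndrome of a small component shrinks by the factor η per sweep while it exceeds
c times the number of syndrome errors there (`IsRun.block_decay`, `IsRun.card_final_le`). A locally
reduced representative of the residual error then has at most c₃ qubits per syndrome error of its
component.

For that representative to stay inside U, the set U must contain every generator of which it has
more than half. Each flip is paid for by a loss of syndrome, so the components of the run have a
constant density of errors (`IsRun.card_le_of_saturated`). Adding majority generators creates few
new checks, so expansion preserves the density while components are small. One addition enlarges a
component only by a constant factor, so if no connected set larger than m is dense in errors,
components never grow beyond m (`exists_majorityClosed`).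

The probabilistic part is percolation counting: the sets whose components all meet S grow in number
only exponentially with their size (`sum_rooted_le`), while a dense error pattern is exponentially
unlikely. One union bound (`measureReal_exists_rooted_le`) serves twice. It excludes dense connected
sets larger than m, which is proportional to |B| and so of order √n. It also bounds the probability
of S ⊆ E_ls on success, since that event forces a dense set rooted at S with at least |S|/c₃
syndrome errors (`exists_residual`).

For the depth, each bit produced by a round depends on boundedly many syndrome bits. A round
therefore has constant depth, and there are logarithmically many. -/

namespace QExpander

/-! ### Symmetric differences as sums over `ZMod 2` -/

section Bits

variable {ι α : Type*} [DecidableEq α]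

/-- The indicator of a finite set with values in `ZMod 2`. -/
def bit (S : Finset α) (x : α) : ZMod 2 := if x ∈ S then 1 else 0

lemma bit_eq_one {S : Finset α} {x : α} : bit S x = 1 ↔ x ∈ S := by
  unfold bit; split_ifs with h <;> simp [h]

lemma bit_eq_zero {S : Finset α} {x : α} : bit S x = 0 ↔ x ∉ S := by
  unfold bit; split_ifs with h <;> simp [h]

lemma ext_bit {S T : Finset α} (h : ∀ x, bit S x = bit T x) : S = T := by
  ext x; rw [← bit_eq_one, ← bit_eq_one, h]

lemma bit_symmDiff (S T : Finset α) (x : α) : bit (symmDiff S T) x = bit S x + bit T x := by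
  have h2 : (1 : ZMod 2) + 1 = 0 := by decide
  unfold bit
  by_cases h : x ∈ S <;> by_cases h' : x ∈ T <;> simp [Finset.mem_symmDiff, h, h', h2]

lemma bit_empty (x : α) : bit (∅ : Finset α) x = 0 := by simp [bit]

lemma sum_bit_eq_card (s : Finset ι) (f : ι → Finset α) (x : α) :
    ∑ i ∈ s, bit (f i) x = ((s.filter fun i => x ∈ f i).card : ZMod 2) := by
  simp [bit]

lemma bit_xorSum [Fintype α] (s : Finset ι) (f : ι → Finset α) (x : α) :
    bit (xorSum s f) x = ∑ i ∈ s, bit (f i) x := by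
  rw [sum_bit_eq_card]
  by_cases h : Odd (s.filter fun i => x ∈ f i).card
  · rw [(ZMod.natCast_eq_one_iff_odd).2 h, bit_eq_one]
    simp [xorSum, h]
  · rw [(ZMod.natCast_eq_zero_iff_even).2 (Nat.not_odd_iff_even.1 h), bit_eq_zero]
    simp only [xorSum, Finset.mem_filter, Finset.mem_univ, true_and]; exact h

lemma sum_bit_mul [Fintype α] (S : Finset α) (h : α → ZMod 2) :
    ∑ v ∈ S, h v = ∑ v, bit S v * h v := by
  simp [bit, Finset.sum_ite_mem]

lemma card_symmDiff_int (S T : Finset α) :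
    ((symmDiff S T).card : ℤ) = S.card + T.card - 2 * (S ∩ T).card := by
  have h1 : (symmDiff S T).card = (S \ T).card + (T \ S).card := by
    rw [symmDiff, Finset.sup_eq_union, Finset.card_union_of_disjoint]
    exact disjoint_sdiff_sdiff
  have h2 := Finset.card_sdiff_add_card_inter S T
  have h3 := Finset.card_sdiff_add_card_inter T S
  rw [Finset.inter_comm] at h3
  omega

end Bits

/-! ### Syndromes of subsets of one generator -/

section Basics

variable {A B : Type*} [Fintype A] [DecidableEq A] [Fintype B] [DecidableEq B]
  (G : A → B → Prop) [DecidableRel G]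

lemma bit_syndrome (E : Finset (Qubit A B)) (x : CheckX A B) :
    bit (syndrome G E) x = ∑ v, bit E v * bit (gammaX G v) x := by
  rw [syndrome, bit_xorSum, sum_bit_mul]

lemma syndrome_symmDiff (E F : Finset (Qubit A B)) :
    syndrome G (symmDiff E F) = symmDiff (syndrome G E) (syndrome G F) := by
  apply ext_bit; intro x
  simp only [bit_symmDiff, bit_syndrome, add_mul, Finset.sum_add_distrib]

lemma syndrome_empty : syndrome G (∅ : Finset (Qubit A B)) = ∅ := by
  apply ext_bit; intro x; simp [bit_syndrome, bit_empty]

lemma syndrome_xorSum {ι : Type*} (s : Finset ι) (f : ι → Finset (Qubit A B)) :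
    syndrome G (xorSum s f) = xorSum s fun i => syndrome G (f i) := by
  apply ext_bit; intro x
  simp only [bit_xorSum, bit_syndrome, Finset.sum_mul]
  rw [Finset.sum_comm]

lemma mem_gammaX_inl {α a : A} {x : CheckX A B} :
    x ∈ gammaX G (Sum.inl (α, a)) ↔ x.1 = α ∧ G a x.2 := by simp [gammaX]

lemma mem_gammaX_inr {b β : B} {x : CheckX A B} :
    x ∈ gammaX G (Sum.inr (b, β)) ↔ x.2 = β ∧ G x.1 b := by simp [gammaX]

lemma inl_mem_gammaZ {α a : A} {g : CheckZ A B} :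
    Sum.inl (α, a) ∈ gammaZ G g ↔ a = g.2 ∧ G α g.1 := by simp [gammaZ]

lemma inr_mem_gammaZ {b β : B} {g : CheckZ A B} :
    Sum.inr (b, β) ∈ gammaZ G g ↔ b = g.1 ∧ G g.2 β := by simp [gammaZ]

/-- The checks adjacent to the support of a generator. -/
def grid (g : CheckZ A B) : Finset (CheckX A B) := nbrB G g.1 ×ˢ nbrA G g.2

lemma mem_nbrA {a : A} {b : B} : b ∈ nbrA G a ↔ G a b := by simp [nbrA]

lemma mem_nbrB {a : A} {b : B} : a ∈ nbrB G b ↔ G a b := by simp [nbrB]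

lemma mem_grid {g : CheckZ A B} {x : CheckX A B} : x ∈ grid G g ↔ G x.1 g.1 ∧ G g.2 x.2 := by
  simp [grid, mem_nbrA, mem_nbrB]

lemma gammaX_subset_grid {v : Qubit A B} {g : CheckZ A B} (h : v ∈ gammaZ G g) :
    gammaX G v ⊆ grid G g := by
  intro x hx
  rcases v with ⟨α, a⟩ | ⟨b, β⟩
  · rw [mem_gammaX_inl] at hx; rw [inl_mem_gammaZ] at h; rw [mem_grid]
    rcases hx with ⟨h1, h2⟩; rcases h with ⟨h3, h4⟩; subst h1 h3; exact ⟨h4, h2⟩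
  · rw [mem_gammaX_inr] at hx; rw [inr_mem_gammaZ] at h; rw [mem_grid]
    rcases hx with ⟨h1, h2⟩; rcases h with ⟨h3, h4⟩; subst h1 h3; exact ⟨h2, h4⟩

/-- The checks adjacent to a set of qubits. -/
def nbrX (E : Finset (Qubit A B)) : Finset (CheckX A B) := E.biUnion (gammaX G)

lemma mem_nbrX {E : Finset (Qubit A B)} {x : CheckX A B} :
    x ∈ nbrX G E ↔ ∃ v ∈ E, x ∈ gammaX G v := by simp [nbrX]

lemma nbrX_mono {E F : Finset (Qubit A B)} (h : E ⊆ F) : nbrX G E ⊆ nbrX G F :=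
  Finset.biUnion_subset_biUnion_of_subset_left _ h

lemma syndrome_subset_nbrX (E : Finset (Qubit A B)) : syndrome G E ⊆ nbrX G E := by
  intro x hx
  rw [mem_nbrX]
  by_contra! h
  rw [← bit_eq_one, syndrome, bit_xorSum,
    Finset.sum_eq_zero fun v hv => bit_eq_zero.2 (h v hv)] at hx
  exact zero_ne_one hx

lemma nbrX_subset_grid {E : Finset (Qubit A B)} {g : CheckZ A B} (h : E ⊆ gammaZ G g) :
    nbrX G E ⊆ grid G g :=
  Finset.biUnion_subset.2 fun _ hv => gammaX_subset_grid G (h hv)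

lemma syndrome_subset_grid {E : Finset (Qubit A B)} {g : CheckZ A B} (h : E ⊆ gammaZ G g) :
    syndrome G E ⊆ grid G g :=
  (syndrome_subset_nbrX G E).trans (nbrX_subset_grid G h)

lemma decrease_eq (σ : Finset (CheckX A B)) (F : Finset (Qubit A B)) :
    decrease G σ F = 2 * ((σ ∩ syndrome G F).card : ℤ) - (syndrome G F).card := by
  rw [decrease, card_symmDiff_int]; ring

variable {G} {dA dB : ℕ}

lemma card_grid (hG : IsBiregular G dA dB) (g : CheckZ A B) : (grid G g).card = dB * dA := by
  rw [grid, Finset.card_product, hG.1, hG.2]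

lemma card_gammaX_inl (hG : IsBiregular G dA dB) (α a : A) :
    (gammaX G (Sum.inl (α, a))).card = dA := by
  have : gammaX G (Sum.inl (α, a)) = {α} ×ˢ nbrA G a := by
    ext x; simp only [mem_gammaX_inl, Finset.mem_product, Finset.mem_singleton, mem_nbrA]
  rw [this, Finset.card_product, hG.1]; simp

lemma card_gammaX_inr (hG : IsBiregular G dA dB) (b β : B) :
    (gammaX G (Sum.inr (b, β))).card = dB := by
  have : gammaX G (Sum.inr (b, β)) = nbrB G b ×ˢ {β} := by
    ext x; simp only [mem_gammaX_inr, Finset.mem_product, Finset.mem_singleton, mem_nbrB, and_comm]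
  rw [this, Finset.card_product, hG.2]; simp

/-- The rows (elements of `A`) of a set of qubits contained in column `a` of `A²`. -/
def rows (F : Finset (Qubit A B)) (a : A) : Finset A :=
  Finset.univ.filter fun α => Sum.inl (α, a) ∈ F

/-- The columns (elements of `B`) of a set of qubits contained in row `b` of `B²`. -/
def cols (F : Finset (Qubit A B)) (b : B) : Finset B :=
  Finset.univ.filter fun β => Sum.inr (b, β) ∈ F

lemma mem_rows {F : Finset (Qubit A B)} {a α : A} : α ∈ rows F a ↔ Sum.inl (α, a) ∈ F := by
  simp [rows]

lemma mem_cols {F : Finset (Qubit A B)} {b β : B} : β ∈ cols F b ↔ Sum.inr (b, β) ∈ F := by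
  simp [cols]

lemma eq_disjSum_of_subset_gammaZ {F : Finset (Qubit A B)} {g : CheckZ A B}
    (h : F ⊆ gammaZ G g) :
    F = ((rows F g.2).map (Function.Embedding.sectL A g.2)).disjSum
      ((cols F g.1).map (Function.Embedding.sectR g.1 B)) := by
  ext v
  rcases v with ⟨α, a⟩ | ⟨b, β⟩
  · simp only [Finset.inl_mem_disjSum, Finset.mem_map, mem_rows, Function.Embedding.sectL_apply]
    constructor
    · intro hv
      have := (inl_mem_gammaZ G).1 (h hv)
      exact ⟨α, by rw [← this.1]; exact hv, by rw [← this.1]⟩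
    · rintro ⟨α', h1, h2⟩
      rw [← h2]; exact h1
  · simp only [Finset.inr_mem_disjSum, Finset.mem_map, mem_cols, Function.Embedding.sectR_apply]
    constructor
    · intro hv
      have := (inr_mem_gammaZ G).1 (h hv)
      exact ⟨β, by rw [← this.1]; exact hv, by rw [← this.1]⟩
    · rintro ⟨α', h1, h2⟩
      rw [← h2]; exact h1

lemma card_of_subset_gammaZ {F : Finset (Qubit A B)} {g : CheckZ A B}
    (h : F ⊆ gammaZ G g) : F.card = (rows F g.2).card + (cols F g.1).card := by
  conv_lhs => rw [eq_disjSum_of_subset_gammaZ h]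
  rw [Finset.card_disjSum, Finset.card_map, Finset.card_map]

lemma rows_subset {F : Finset (Qubit A B)} {g : CheckZ A B} (h : F ⊆ gammaZ G g) :
    rows F g.2 ⊆ nbrB G g.1 := fun _ hα =>
  (mem_nbrB G).2 ((inl_mem_gammaZ G).1 (h (mem_rows.1 hα))).2

lemma cols_subset {F : Finset (Qubit A B)} {g : CheckZ A B} (h : F ⊆ gammaZ G g) :
    cols F g.1 ⊆ nbrA G g.2 := fun _ hα =>
  (mem_nbrA G).2 ((inr_mem_gammaZ G).1 (h (mem_cols.1 hα))).2

/-- Each check of the grid is adjacent to exactly two qubits of the support: one in its row and one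
in its column. -/
lemma bit_syndrome_of_subset_gammaZ {F : Finset (Qubit A B)} {g : CheckZ A B}
    (h : F ⊆ gammaZ G g) {x : CheckX A B} (hx : x ∈ grid G g) :
    bit (syndrome G F) x = bit (rows F g.2) x.1 + bit (cols F g.1) x.2 := by
  rw [mem_grid] at hx
  have e := eq_disjSum_of_subset_gammaZ h
  have h1 : ∀ S : Finset (A × A), ∀ T : Finset (B × B), ∀ f : Qubit A B → ZMod 2,
      ∑ v ∈ S.disjSum T, f v = ∑ p ∈ S, f (Sum.inl p) + ∑ p ∈ T, f (Sum.inr p) := by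
    intro S T f; exact Finset.sum_disjSum S T f
  rw [syndrome, bit_xorSum]
  conv_lhs => rw [e]
  rw [h1, Finset.sum_map, Finset.sum_map]
  congr 1
  · have : ∀ α : A, bit (gammaX G (Sum.inl (α, g.2))) x = if α = x.1 then 1 else 0 := by
      intro α; unfold bit; congr 1; simp [mem_gammaX_inl, hx.2, eq_comm]
    simp only [Function.Embedding.sectL_apply, this]
    simp [bit]
  · have : ∀ β : B, bit (gammaX G (Sum.inr (g.1, β))) x = if β = x.2 then 1 else 0 := by
      intro β; unfold bit; congr 1; simp [mem_gammaX_inr, hx.1, eq_comm]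
    simp only [Function.Embedding.sectR_apply, this]
    simp [bit]

lemma syndrome_gammaZ (g : CheckZ A B) : syndrome G (gammaZ G g) = ∅ := by
  apply ext_bit; intro x
  rw [bit_empty]
  by_cases hx : x ∈ grid G g
  · rw [bit_syndrome_of_subset_gammaZ (Finset.Subset.refl _) hx]
    rw [mem_grid] at hx
    have h2 : (1 : ZMod 2) + 1 = 0 := by decide
    rw [bit_eq_one.2, bit_eq_one.2, h2]
    · rw [mem_cols, inr_mem_gammaZ]; exact ⟨rfl, hx.2⟩
    · rw [mem_rows, inl_mem_gammaZ]; exact ⟨rfl, hx.1⟩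
  · exact bit_eq_zero.2 fun h => hx (syndrome_subset_grid G (Finset.Subset.refl _) h)

lemma Equivalent.syndrome_eq {E E' : Finset (Qubit A B)} (h : Equivalent G E E') :
    syndrome G E = syndrome G E' := by
  obtain ⟨X, hX⟩ := h
  have := syndrome_symmDiff G E E'
  rw [hX, syndrome_xorSum] at this
  have h0 : xorSum X (fun g => syndrome G (gammaZ G g)) = ∅ := by
    apply ext_bit; intro x; rw [bit_xorSum]; simp [syndrome_gammaZ, bit_empty]
  rw [h0] at this
  exact symmDiff_eq_bot.1 this.symm

lemma Equivalent.refl (E : Finset (Qubit A B)) : Equivalent G E E :=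
  ⟨∅, by apply ext_bit; intro x; rw [bit_xorSum, symmDiff_self]; simp [bit]⟩

lemma Equivalent.flip {E E' : Finset (Qubit A B)} (h : Equivalent G E E') (g : CheckZ A B) :
    Equivalent G (symmDiff E (gammaZ G g)) E' := by
  obtain ⟨X, hX⟩ := h
  refine ⟨symmDiff X {g}, ext_bit fun v => ?_⟩
  have := congrArg (fun S => bit S v) hX
  simp only [bit_symmDiff, bit_xorSum, sum_bit_mul X] at this
  rw [bit_symmDiff, bit_symmDiff, bit_xorSum, sum_bit_mul]
  simp only [bit_symmDiff, add_mul, Finset.sum_add_distrib]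
  rw [← this, ← sum_bit_mul {g}, Finset.sum_singleton]
  ring

/-- The violated checks are the grid cells for which exactly one of the row and the column is
marked. -/
lemma card_syndrome_of_subset_gammaZ (hG : IsBiregular G dA dB) {F : Finset (Qubit A B)}
    {g : CheckZ A B} (h : F ⊆ gammaZ G g) :
    ((syndrome G F).card : ℤ) = (rows F g.2).card * (dA - (cols F g.1).card) +
      (dB - (rows F g.2).card) * (cols F g.1).card := by
  have e : syndrome G F = rows F g.2 ×ˢ (nbrA G g.2 \ cols F g.1) ∪
      (nbrB G g.1 \ rows F g.2) ×ˢ cols F g.1 := by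
    ext x
    have hr := rows_subset h
    have hc := cols_subset h
    by_cases hx : x ∈ grid G g
    · rw [← bit_eq_one, bit_syndrome_of_subset_gammaZ h hx]
      rw [grid, Finset.mem_product] at hx
      have h2 : (1 : ZMod 2) + 1 = 0 := by decide
      simp only [bit, Finset.mem_union, Finset.mem_product, Finset.mem_sdiff, hx]
      by_cases h3 : x.1 ∈ rows F g.2 <;> by_cases h4 : x.2 ∈ cols F g.1 <;> simp [h3, h4, h2]
    · constructor
      · intro h'; exact absurd (syndrome_subset_grid G h h') hx
      · intro h'
        exfalso; apply hx
        simp only [Finset.mem_union, Finset.mem_product, Finset.mem_sdiff] at h'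
        rw [grid, Finset.mem_product]
        rcases h' with h' | h'
        · exact ⟨hr h'.1, h'.2.1⟩
        · exact ⟨h'.1.1, hc h'.2⟩
  have hd : Disjoint (rows F g.2 ×ˢ (nbrA G g.2 \ cols F g.1))
      ((nbrB G g.1 \ rows F g.2) ×ˢ cols F g.1) := by
    rw [Finset.disjoint_left]; intro x hx hx'
    simp only [Finset.mem_product, Finset.mem_sdiff] at hx hx'
    exact hx'.1.2 hx.1
  rw [e, Finset.card_union_of_disjoint hd, Finset.card_product, Finset.card_product]
  have h1 := Finset.card_sdiff_add_card_eq_card (cols_subset h)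
  have h2 := Finset.card_sdiff_add_card_eq_card (rows_subset h)
  rw [hG.1] at h1; rw [hG.2] at h2
  rw [← h1, ← h2]
  push_cast; ring

lemma card_gammaZ (hG : IsBiregular G dA dB) (g : CheckZ A B) : (gammaZ G g).card = dA + dB := by
  rw [card_of_subset_gammaZ (Finset.Subset.refl _)]
  have e1 : rows (gammaZ G g) g.2 = nbrB G g.1 := by
    ext α; rw [mem_rows, inl_mem_gammaZ, mem_nbrB]; simp
  have e2 : cols (gammaZ G g) g.1 = nbrA G g.2 := by
    ext α; rw [mem_cols, inr_mem_gammaZ, mem_nbrA]; simp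
  rw [e1, e2, hG.1, hG.2, add_comm]

lemma card_rows_le (hG : IsBiregular G dA dB) {F : Finset (Qubit A B)}
    {g : CheckZ A B} (h : F ⊆ gammaZ G g) : (rows F g.2).card ≤ dB := by
  rw [← hG.2 g.1]; exact Finset.card_le_card (rows_subset h)

lemma card_cols_le (hG : IsBiregular G dA dB) {F : Finset (Qubit A B)}
    {g : CheckZ A B} (h : F ⊆ gammaZ G g) : (cols F g.1).card ≤ dA := by
  rw [← hG.1 g.2]; exact Finset.card_le_card (cols_subset h)

/-- With X rows and Y columns the difference of the two sides is X(d_A - 4Y) + Y(2d_B - d_A), affine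
in X. If 4Y ≤ d_A both terms are nonnegative; otherwise the minimum is at X + Y = (d_A + d_B)/2,
where it equals (2Y - d_A)² + d_A(d_B - d_A)/2. -/
lemma le_two_mul_card_syndrome (hG : IsBiregular G dA dB) (hd : dA ≤ dB)
    {F : Finset (Qubit A B)} {g : CheckZ A B} (h : F ⊆ gammaZ G g)
    (hF : 2 * F.card ≤ dA + dB) : dA * F.card ≤ 2 * (syndrome G F).card := by
  have h1 := card_rows_le hG h
  have h2 := card_cols_le hG h
  have h3 := card_syndrome_of_subset_gammaZ hG h
  rw [card_of_subset_gammaZ h] at hF ⊢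
  zify at *
  rw [h3]
  generalize ((rows F g.2).card : ℤ) = X at *
  generalize hY : ((cols F g.1).card : ℤ) = Y at *
  have hY0 : 0 ≤ Y := by rw [← hY]; positivity
  generalize (dA : ℤ) = a at *
  generalize (dB : ℤ) = b at *
  by_cases hc : 4 * Y ≤ a
  · by_cases hX : 0 ≤ X
    · nlinarith [mul_nonneg hX (sub_nonneg.2 hc), mul_nonneg hY0 (by linarith : 0 ≤ 2 * b - a)]
    · nlinarith [sq_nonneg (2 * Y - a)]
  · push Not at hc
    nlinarith [mul_nonneg (by linarith : 0 ≤ 4 * Y - a) (by linarith : 0 ≤ a + b - 2 * (X + Y)),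
      sq_nonneg (2 * Y - a), mul_nonneg (by linarith : 0 ≤ a) (by linarith : 0 ≤ b - a)]

/-- This amounts to 3XY ≤ d_A X + d_B Y. At most half of the rows or at most half of the columns are
marked; one term on the right is then at least 2XY, and the other is always at least XY. -/
lemma le_three_mul_card_syndrome (hG : IsBiregular G dA dB)
    {F : Finset (Qubit A B)} {g : CheckZ A B} (h : F ⊆ gammaZ G g)
    (hF : 2 * F.card ≤ dA + dB) :
    dA * (rows F g.2).card + dB * (cols F g.1).card ≤ 3 * (syndrome G F).card := by
  have h1 := card_rows_le hG h
  have h2 := card_cols_le hG h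
  have h3 := card_syndrome_of_subset_gammaZ hG h
  rw [card_of_subset_gammaZ h] at hF
  have h4 : 2 * (rows F g.2).card ≤ dB ∨ 2 * (cols F g.1).card ≤ dA := by omega
  zify at *
  rw [h3]
  have hX0 : (0 : ℤ) ≤ (rows F g.2).card := by positivity
  have hY0 : (0 : ℤ) ≤ (cols F g.1).card := by positivity
  generalize ((rows F g.2).card : ℤ) = X at *
  generalize ((cols F g.1).card : ℤ) = Y at *
  rcases h4 with h4 | h4
  · nlinarith [mul_nonneg hY0 (sub_nonneg.2 h4), mul_nonneg hX0 (sub_nonneg.2 h2)]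
  · nlinarith [mul_nonneg hX0 (sub_nonneg.2 h4), mul_nonneg hY0 (sub_nonneg.2 h1)]

/-- Needed at the end of the decoding: a flip that lowers a one-check syndrome would have a
one-check syndrome itself. -/
lemma card_syndrome_ne_one (hG : IsBiregular G dA dB) (hdA : 2 ≤ dA) (hdB : 2 ≤ dB)
    {F : Finset (Qubit A B)} {g : CheckZ A B} (h : F ⊆ gammaZ G g) :
    (syndrome G F).card ≠ 1 := by
  intro h1
  have h3 := card_syndrome_of_subset_gammaZ hG h
  obtain ⟨X', hX'⟩ := Nat.exists_eq_add_of_le (card_rows_le hG h)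
  obtain ⟨Y', hY'⟩ := Nat.exists_eq_add_of_le (card_cols_le hG h)
  generalize (rows F g.2).card = X at *
  generalize (cols F g.1).card = Y at *
  have h4 : X * Y' + X' * Y = 1 := by
    rw [h1, hX', hY'] at h3; push_cast at h3; zify; linarith
  rcases Nat.eq_zero_or_pos X with rfl | hX
  · have : X' * Y = 1 := by simpa using h4
    have := Nat.eq_one_of_mul_eq_one_right this; omega
  rcases Nat.eq_zero_or_pos X' with rfl | hXp
  · have : X * Y' = 1 := by simpa using h4
    have := Nat.eq_one_of_mul_eq_one_right this; omega
  have : Y' + Y ≤ 1 := by nlinarith [Nat.zero_le Y', Nat.zero_le Y]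
  omega

end Basics

end QExpander

namespace QExpander

/-! ### Expansion with weights -/

section LayerCake

variable {P Q : Type*} [Fintype P] [DecidableEq P] [Fintype Q] [DecidableEq Q]

/-- In an expanding bipartite graph with weighted left vertices, if every right vertex selects a
neighbour of largest weight, then the weighted number of edges that are not selected is small. -/
lemma sum_weight_unselected_le (N : P → Finset Q) (d : ℕ) (hN : ∀ p, (N p).card = d) (δ r : ℝ)
    (hexp : ∀ S : Finset P, (S.card : ℝ) ≤ r → (1 - δ) * d * S.card ≤ ((S.biUnion N).card : ℝ))
    (w : P → ℕ) (hw : ((Finset.univ.filter fun p => 0 < w p).card : ℝ) ≤ r)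
    (t : Q → P) (ht : ∀ q, q ∈ N (t q)) (hmax : ∀ p q, q ∈ N p → w p ≤ w (t q)) :
    ((∑ p, w p * ((N p).filter fun q => t q ≠ p).card : ℕ) : ℝ) ≤ δ * d * (∑ p, w p : ℕ) := by
  set M := ∑ p, w p with hM
  have hwM : ∀ p, w p ≤ M := fun p => Finset.single_le_sum (fun _ _ => Nat.zero_le _)
    (Finset.mem_univ p)
  have layer : ∀ p, w p = ∑ k ∈ Finset.range M, if k < w p then 1 else 0 := by
    intro p
    rw [← Finset.sum_filter, Finset.sum_const, smul_eq_mul, mul_one]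
    have : (Finset.range M).filter (fun k => k < w p) = Finset.range (w p) := by
      ext k; simp only [Finset.mem_filter, Finset.mem_range]
      have := hwM p; omega
    rw [this, Finset.card_range]
  -- The weight function is sliced into its level sets, to each of which the expansion applies.
  set Lv : ℕ → Finset P := fun k => Finset.univ.filter fun p => k < w p with hLv
  have h1 : M = ∑ k ∈ Finset.range M, (Lv k).card := by
    conv_lhs => rw [hM]
    rw [Finset.sum_congr rfl fun p _ => layer p, Finset.sum_comm]
    refine Finset.sum_congr rfl fun k _ => ?_
    rw [← Finset.sum_filter, Finset.sum_const, smul_eq_mul, mul_one]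
  -- As `t q` is a heaviest neighbour, its weight exceeds `k` exactly when `q` is adjacent to the
  -- level set `Lv k`.
  have h2 : ∑ q, w (t q) = ∑ k ∈ Finset.range M, ((Lv k).biUnion N).card := by
    rw [Finset.sum_congr rfl fun q _ => layer (t q), Finset.sum_comm]
    refine Finset.sum_congr rfl fun k _ => ?_
    rw [← Finset.sum_filter, Finset.sum_const, smul_eq_mul, mul_one]
    congr 1
    ext q
    simp only [hLv, Finset.mem_filter, Finset.mem_univ, true_and, Finset.mem_biUnion]
    exact ⟨fun h => ⟨t q, h, ht q⟩, fun ⟨p, h, hp⟩ => h.trans_le (hmax p q hp)⟩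
  have h3 : ∑ p, w p * ((N p).filter fun q => t q = p).card = ∑ q, w (t q) := by
    rw [← Finset.sum_fiberwise Finset.univ t]
    refine Finset.sum_congr rfl fun p _ => ?_
    rw [Finset.sum_congr rfl fun q hq => by rw [(Finset.mem_filter.1 hq).2], Finset.sum_const,
      smul_eq_mul, mul_comm]
    congr 2
    ext q
    simp only [Finset.mem_filter, Finset.mem_univ, true_and, and_iff_right_iff_imp]
    rintro rfl; exact ht q
  have h4 : ∑ p, w p * ((N p).filter fun q => t q = p).card +
      ∑ p, w p * ((N p).filter fun q => t q ≠ p).card = d * M := by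
    rw [← Finset.sum_add_distrib, hM, Finset.mul_sum]
    refine Finset.sum_congr rfl fun p _ => ?_
    rw [← mul_add, Finset.card_filter_add_card_filter_not, hN, mul_comm]
  have h5 : (1 - δ) * d * M ≤ ((∑ q, w (t q) : ℕ) : ℝ) := by
    rw [h2]
    conv_lhs => rw [h1]
    push_cast
    rw [Finset.mul_sum]
    refine Finset.sum_le_sum fun k _ => hexp _ (le_trans ?_ hw)
    exact_mod_cast Finset.card_le_card fun p hp => by
      simp only [hLv, Finset.mem_filter, Finset.mem_univ, true_and] at hp ⊢; omega
  rw [h3] at h4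
  have h6 : ((∑ q, w (t q) : ℕ) : ℝ) +
      ((∑ p, w p * ((N p).filter fun q => t q ≠ p).card : ℕ) : ℝ) = d * M := by exact_mod_cast h4
  linarith

end LayerCake

/-! ### Splitting a small error into pieces inside generators -/

section Partition

variable {A B : Type*} [Fintype A] [DecidableEq A] [Fintype B] [DecidableEq B]
  {G : A → B → Prop} [DecidableRel G] {dA dB : ℕ} {γ δ : ℝ}

lemma sum_qubits {M : Type*} [AddCommMonoid M] (e : Finset (Qubit A B)) (f : Qubit A B → M) :
    ∑ v ∈ e, f v = ∑ a, ∑ α ∈ rows e a, f (Sum.inl (α, a)) +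
      ∑ b, ∑ β ∈ cols e b, f (Sum.inr (b, β)) := by
  have h : ∑ v ∈ e, f v = ∑ v, if v ∈ e then f v else 0 := by simp
  rw [h, Fintype.sum_sum_type, Fintype.sum_prod_type_right, Fintype.sum_prod_type]
  congr 1
  · refine Finset.sum_congr rfl fun a _ => ?_
    rw [rows, Finset.sum_filter]
  · refine Finset.sum_congr rfl fun b _ => ?_
    rw [cols, Finset.sum_filter]

lemma card_qubits (e : Finset (Qubit A B)) :
    e.card = ∑ a, (rows e a).card + ∑ b, (cols e b).card := by
  simp only [Finset.card_eq_sum_ones]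
  exact sum_qubits e _

/-- The number of incidences between a set of qubits and the checks. -/
def incidences (G : A → B → Prop) [DecidableRel G] (e : Finset (Qubit A B)) : ℕ :=
  ∑ v ∈ e, (gammaX G v).card

lemma incidences_eq (hG : IsBiregular G dA dB) (e : Finset (Qubit A B)) :
    incidences G e = dA * ∑ a, (rows e a).card + dB * ∑ b, (cols e b).card := by
  rw [incidences, sum_qubits]
  simp [card_gammaX_inl hG, card_gammaX_inr hG, Finset.mul_sum, mul_comm]

lemma incidences_of_subset_gammaZ (hG : IsBiregular G dA dB) {F : Finset (Qubit A B)}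
    {g : CheckZ A B} (h : F ⊆ gammaZ G g) :
    incidences G F = dA * (rows F g.2).card + dB * (cols F g.1).card := by
  have h1 : ∀ a ≠ g.2, (rows F a).card = 0 := by
    intro a ha
    rw [Finset.card_eq_zero, Finset.eq_empty_iff_forall_notMem]
    intro α hα
    exact ha ((inl_mem_gammaZ G).1 (h (mem_rows.1 hα))).1
  have h2 : ∀ b ≠ g.1, (cols F b).card = 0 := by
    intro a ha
    rw [Finset.card_eq_zero, Finset.eq_empty_iff_forall_notMem]
    intro α hα
    exact ha ((inr_mem_gammaZ G).1 (h (mem_cols.1 hα))).1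
  rw [incidences_eq hG, Fintype.sum_eq_single g.2 h1, Fintype.sum_eq_single g.1 h2]

/-- A small error splits over the generators in such a way that almost all the incidences at a
check belong to one generator. -/
lemma exists_partition (hG : IsBiregular G dA dB) (hX : IsExpanding G dA dB γ δ)
    (hdA : 1 ≤ dA) (hdB : 1 ≤ dB) (e : Finset (Qubit A B))
    (heA : (e.card : ℝ) ≤ γ * Fintype.card A) (heB : (e.card : ℝ) ≤ γ * Fintype.card B) :
    ∃ (own : Qubit A B → CheckZ A B) (prim : CheckX A B → CheckZ A B),
      (∀ v, v ∈ gammaZ G (own v)) ∧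
      ((∑ v ∈ e, ((gammaX G v).filter fun x => own v ≠ prim x).card : ℕ) : ℝ) ≤
        δ * incidences G e := by
  have ext : ∀ β : B, ∃ a, G a β ∧ ∀ a', G a' β → (rows e a').card ≤ (rows e a).card := by
    intro β
    have hne : (nbrB G β).Nonempty := by rw [← Finset.card_pos, hG.2]; omega
    obtain ⟨a, ha, hm⟩ := Finset.exists_max_image _ (fun a => (rows e a).card) hne
    exact ⟨a, (mem_nbrB G).1 ha, fun a' h' => hm a' ((mem_nbrB G).2 h')⟩
  choose t ht htmax using ext
  -- Each `β` chooses the adjacent column `t β` of A² with most errors, so the error `(b, β)` goes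
  -- to the generator `(b, t β)`. The weight `v a b` counts the errors that `(b, a)` receives in
  -- this way, and each `(α, a)` then chooses a heaviest adjacent `b`.
  set v : A → B → ℕ := fun a b => ((cols e b).filter fun β => t β = a).card with hv
  have exs : ∀ (a α : A), ∃ b, G α b ∧ ∀ b', G α b' → v a b' ≤ v a b := by
    intro a α
    have hne : (nbrA G α).Nonempty := by rw [← Finset.card_pos, hG.1]; omega
    obtain ⟨b, hb, hm⟩ := Finset.exists_max_image _ (fun b => v a b) hne
    exact ⟨b, (mem_nbrA G).1 hb, fun a' h' => hm a' ((mem_nbrA G).2 h')⟩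
  choose s hs hsmax using exs
  have hcard := card_qubits e
  have hA := sum_weight_unselected_le (nbrA G) dA hG.1 δ (γ * Fintype.card A) hX.1
    (fun a => (rows e a).card) (le_trans (by
      norm_cast
      rw [hcard, Finset.card_filter]
      refine le_trans (Finset.sum_le_sum fun a _ => ?_) (Nat.le_add_right _ _)
      split_ifs <;> omega) heA) t (fun q => (mem_nbrA G).2 (ht q))
    (fun p q h => htmax q p ((mem_nbrA G).1 h))
  have hB : ∀ a, ((∑ b, v a b * ((nbrB G b).filter fun α => s a α ≠ b).card : ℕ) : ℝ) ≤
      δ * dB * (∑ b, v a b : ℕ) := by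
    intro a
    refine sum_weight_unselected_le (nbrB G) dB hG.2 δ (γ * Fintype.card B) hX.2
      (v a) (le_trans ?_ heB) (s a) (fun q => (mem_nbrB G).2 (hs a q))
      (fun p q h => hsmax a q p ((mem_nbrB G).1 h))
    norm_cast
    rw [hcard, Finset.card_filter]
    refine le_trans (Finset.sum_le_sum fun b _ => ?_) (Nat.le_add_left _ _)
    have : v a b ≤ (cols e b).card := Finset.card_filter_le _ _
    split_ifs <;> omega
  have hvs : ∑ a, ∑ b, v a b = ∑ b, (cols e b).card := by
    rw [Finset.sum_comm]
    refine Finset.sum_congr rfl fun b _ => ?_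
    exact (Finset.card_eq_sum_card_fiberwise fun _ _ => Finset.mem_univ _).symm
  refine ⟨Sum.elim (fun p => (s p.2 p.1, p.2)) (fun p => (p.1, t p.2)),
    fun x => (s (t x.2) x.1, t x.2), ?_, ?_⟩
  · rintro (⟨α, a⟩ | ⟨b, β⟩)
    · exact (inl_mem_gammaZ G).2 ⟨rfl, hs a α⟩
    · exact (inr_mem_gammaZ G).2 ⟨rfl, ht β⟩
  · rw [sum_qubits, incidences_eq hG]
    -- At the check `(α, β)` the error `(α, a)` belongs to the primary generator as soon as `t β =
    -- a`, so only unselected edges of the first choice are lost.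
    have e1 : ∑ a, ∑ α ∈ rows e a, ((gammaX G (Sum.inl (α, a))).filter fun x =>
        (s a α, a) ≠ (s (t x.2) x.1, t x.2)).card ≤
        ∑ a, (rows e a).card * ((nbrA G a).filter fun β => t β ≠ a).card := by
      refine Finset.sum_le_sum fun a _ => ?_
      rw [← smul_eq_mul]
      refine Finset.sum_le_card_nsmul _ _ _ fun α _ => ?_
      refine Finset.card_le_card_of_injOn Prod.snd ?_ ?_
      · intro x hx
        simp only [Finset.coe_filter, Set.mem_ofPred_eq, mem_gammaX_inl, mem_nbrA] at hx ⊢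
        refine ⟨hx.1.2, fun h => hx.2 ?_⟩
        rw [h, hx.1.1]
      · intro x hx y hy hxy
        simp only [Finset.coe_filter, Set.mem_ofPred_eq, mem_gammaX_inl] at hx hy
        exact Prod.ext (hx.1.1.trans hy.1.1.symm) hxy
    -- The column of the primary generator agrees automatically here, so only edges unselected in
    -- the second choice are lost, separately for each `a`.
    have e2 : ∑ b, ∑ β ∈ cols e b, ((gammaX G (Sum.inr (b, β))).filter fun x =>
        (b, t β) ≠ (s (t x.2) x.1, t x.2)).card ≤
        ∑ a, ∑ b, v a b * ((nbrB G b).filter fun α => s a α ≠ b).card := by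
      rw [Finset.sum_comm]
      refine Finset.sum_le_sum fun b _ => ?_
      rw [← Finset.sum_fiberwise (cols e b) t]
      refine Finset.sum_le_sum fun a _ => ?_
      rw [← smul_eq_mul]
      refine Finset.sum_le_card_nsmul _ _ _ fun β hβ => ?_
      have hβa := (Finset.mem_filter.1 hβ).2
      refine Finset.card_le_card_of_injOn Prod.fst ?_ ?_
      · intro x hx
        simp only [Finset.coe_filter, Set.mem_ofPred_eq, mem_gammaX_inr, mem_nbrB] at hx ⊢
        refine ⟨hx.1.2, fun h => hx.2 ?_⟩
        rw [hx.1.1, hβa, h]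
      · intro x hx y hy hxy
        simp only [Finset.coe_filter, Set.mem_ofPred_eq, mem_gammaX_inr] at hx hy
        exact Prod.ext hxy (hx.1.1.trans hy.1.1.symm)
    have e3 : ((∑ a, ∑ b, v a b * ((nbrB G b).filter fun α => s a α ≠ b).card : ℕ) : ℝ) ≤
        δ * dB * (∑ b, (cols e b).card : ℕ) := by
      rw [← hvs]
      have := Finset.sum_le_sum fun a (_ : a ∈ Finset.univ) => hB a
      rw [← Finset.mul_sum] at this
      exact_mod_cast this
    have e4 := (Nat.cast_le (α := ℝ)).2 (add_le_add e1 e2)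
    simp only [Sum.elim_inl, Sum.elim_inr]
    refine e4.trans ?_
    push_cast at hA e3 ⊢
    linarith

/-- No generator has more than half of its support in `e`. -/
def LocallyReduced (G : A → B → Prop) [DecidableRel G] (dA dB : ℕ) (e : Finset (Qubit A B)) :
    Prop :=
  ∀ g : CheckZ A B, 2 * (e ∩ gammaZ G g).card ≤ dA + dB

lemma LocallyReduced.mono {e e' : Finset (Qubit A B)} (h : LocallyReduced G dA dB e)
    (he : e' ⊆ e) : LocallyReduced G dA dB e' := fun g =>
  le_trans (Nat.mul_le_mul_left _ (Finset.card_le_card (Finset.inter_subset_inter_right he))) (h g)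

/-- A small locally reduced error splits into parts inside generators whose syndromes overlap
little. -/
lemma exists_flips (hG : IsBiregular G dA dB) (hX : IsExpanding G dA dB γ δ)
    (hdA : 1 ≤ dA) (hdAB : dA ≤ dB) (hδ0 : 0 < δ) {e : Finset (Qubit A B)}
    (heA : (e.card : ℝ) ≤ γ * Fintype.card A) (heB : (e.card : ℝ) ≤ γ * Fintype.card B)
    (hred : LocallyReduced G dA dB e) :
    ∃ F : CheckZ A B → Finset (Qubit A B),
      (∀ g, F g ⊆ e ∧ F g ⊆ gammaZ G g) ∧
      (∀ g, dA * (F g).card ≤ 2 * (syndrome G (F g)).card) ∧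
      ∑ g, (F g).card = e.card ∧
      beta0 δ * (∑ g, (syndrome G (F g)).card : ℕ) ≤ (syndrome G e).card ∧
      ∀ x ∈ syndrome G e, ∃ g, x ∈ syndrome G (F g) := by
  obtain ⟨own, prim, hown, hloss⟩ := exists_partition hG hX hdA (hdA.trans hdAB) e heA heB
  set F : CheckZ A B → Finset (Qubit A B) := fun g => e.filter fun v => own v = g with hF
  have hFe : ∀ g, F g ⊆ e := fun g => Finset.filter_subset _ _
  have hFg : ∀ g, F g ⊆ gammaZ G g := by
    intro g v hv
    have := (Finset.mem_filter.1 hv).2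
    rw [← this]; exact hown v
  have hhalf : ∀ g, 2 * (F g).card ≤ dA + dB := fun g =>
    le_trans (Nat.mul_le_mul_left _ (Finset.card_le_card
      (Finset.subset_inter (hFe g) (hFg g)))) (hred g)
  have hbit : ∀ x, bit (syndrome G e) x = ∑ g, bit (syndrome G (F g)) x := by
    intro x
    simp only [syndrome, bit_xorSum]
    exact (Finset.sum_fiberwise e own _).symm
  set loss : CheckX A B → ℕ := fun x =>
    (e.filter fun v => x ∈ gammaX G v ∧ own v ≠ prim x).card with hlossx
  set m : CheckX A B → ℕ := fun x =>
    (Finset.univ.filter fun g => x ∈ syndrome G (F g)).card with hm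
  -- Apart from the primary generator, every piece seen by `x` contributes at least one lost edge.
  have hm1 : ∀ x, m x ≤ 1 + loss x := by
    intro x
    have hsub : (Finset.univ.filter fun g => x ∈ syndrome G (F g)) ⊆ insert (prim x)
        ((e.filter fun v => x ∈ gammaX G v ∧ own v ≠ prim x).image own) := by
      intro g hg
      rw [Finset.mem_insert]
      by_cases hgp : g = prim x
      · exact Or.inl hgp
      · right
        obtain ⟨v, hv, hxv⟩ := (mem_nbrX G).1 (syndrome_subset_nbrX G _ (Finset.mem_filter.1 hg).2)
        obtain ⟨hve, hvg⟩ := Finset.mem_filter.1 hv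
        exact Finset.mem_image.2 ⟨v, Finset.mem_filter.2 ⟨hve, hxv, by rw [hvg]; exact hgp⟩, hvg⟩
    calc m x ≤ _ := Finset.card_le_card hsub
      _ ≤ _ := Finset.card_insert_le _ _
      _ ≤ 1 + loss x := by
        rw [add_comm]; exact Nat.add_le_add_left Finset.card_image_le _
  -- Outside the syndrome of `e` the multiplicity is even, so it vanishes if no edge is lost, and
  -- otherwise 1 + loss is at most 2 loss.
  have hm2 : ∀ x, m x ≤ (if x ∈ syndrome G e then 1 else 0) + 2 * loss x := by
    intro x
    have h1 := hm1 x
    split_ifs with hx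
    · omega
    · have h0 := hbit x
      rw [bit_eq_zero.2 hx, sum_bit_eq_card] at h0
      have hev : Even (m x) := (ZMod.natCast_eq_zero_iff_even).1 h0.symm
      obtain ⟨k, hk⟩ := hev
      omega
  have hT : ∑ g, (syndrome G (F g)).card = ∑ x, m x := by
    simp only [hm, Finset.card_filter]
    rw [Finset.sum_comm]
    simp
  have hL : ∑ x, loss x = ∑ v ∈ e, ((gammaX G v).filter fun x => own v ≠ prim x).card := by
    simp only [hlossx, Finset.card_filter]
    rw [Finset.sum_comm]
    refine Finset.sum_congr rfl fun v _ => ?_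
    rw [← Finset.sum_filter, ← Finset.sum_filter, Finset.sum_const, Finset.sum_const]
    congr 2
    ext x; simp
  have hTle : ∑ g, (syndrome G (F g)).card ≤ (syndrome G e).card + 2 * ∑ x, loss x := by
    rw [hT]
    refine (Finset.sum_le_sum fun x _ => hm2 x).trans ?_
    rw [Finset.sum_add_distrib, Finset.mul_sum]
    simp
  have hinc : incidences G e ≤ 3 * ∑ g, (syndrome G (F g)).card := by
    have : incidences G e = ∑ g, incidences G (F g) :=
      (Finset.sum_fiberwise e own _).symm
    rw [this, Finset.mul_sum]
    refine Finset.sum_le_sum fun g _ => ?_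
    rw [incidences_of_subset_gammaZ hG (hFg g)]
    exact le_three_mul_card_syndrome hG (hFg g) (hhalf g)
  refine ⟨F, fun g => ⟨hFe g, hFg g⟩, fun g => le_two_mul_card_syndrome hG hdAB (hFg g) (hhalf g),
    (Finset.card_eq_sum_card_fiberwise fun _ _ => Finset.mem_univ _).symm, ?_, ?_⟩
  · rw [← hL] at hloss
    have h1 := (Nat.cast_le (α := ℝ)).2 hTle
    have h2 := (Nat.cast_le (α := ℝ)).2 hinc
    push_cast at h1 h2 hloss ⊢
    rw [beta0]
    have hT0 : (0 : ℝ) ≤ ∑ g, ((syndrome G (F g)).card : ℝ) :=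
      Finset.sum_nonneg fun _ _ => Nat.cast_nonneg _
    -- With T the total size of the pieces' syndromes, T ≤ |σ_X(e)| + 2δ · 3T. Thus even 1 - 6δ
    -- would do in place of `beta0 δ` = 1 - 8δ.
    nlinarith [mul_le_mul_of_nonneg_left h2 hδ0.le, mul_nonneg hδ0.le hT0]
  · intro x hx
    by_contra! h
    have h0 := hbit x
    rw [Finset.sum_eq_zero fun g _ => bit_eq_zero.2 (h g), bit_eq_zero] at h0
    exact h0 hx

lemma card_le_card_syndrome (hG : IsBiregular G dA dB) (hX : IsExpanding G dA dB γ δ)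
    (hdA : 1 ≤ dA) (hdAB : dA ≤ dB) (hδ0 : 0 < δ) (hδ : δ < 1 / 16) {e : Finset (Qubit A B)}
    (heA : (e.card : ℝ) ≤ γ * Fintype.card A) (heB : (e.card : ℝ) ≤ γ * Fintype.card B)
    (hred : LocallyReduced G dA dB e) :
    beta0 δ * dA * e.card ≤ 2 * (syndrome G e).card := by
  obtain ⟨F, -, hF, hsum, hT, -⟩ := exists_flips hG hX hdA hdAB hδ0 heA heB hred
  have h1 : dA * e.card ≤ 2 * ∑ g, (syndrome G (F g)).card := by
    rw [← hsum, Finset.mul_sum, Finset.mul_sum]; exact Finset.sum_le_sum fun g _ => hF g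
  have h2 := (Nat.cast_le (α := ℝ)).2 h1
  have hb : 0 < beta0 δ := by rw [beta0]; linarith
  push_cast at h2 hT ⊢
  nlinarith [mul_le_mul_of_nonneg_left h2 hb.le]

/-- The generators that have an available flip inside `e`. -/
def flippable (G : A → B → Prop) [DecidableRel G] (dA : ℕ) (β : ℝ) (σ : Finset (CheckX A B))
    (e : Finset (Qubit A B)) : Set (CheckZ A B) :=
  {g | ∃ F, F ⊆ e ∧ F ∈ available G dA β σ g}

/-- Averaging: the decreases of all the pieces add up to at least 2(s - d) - T, where s is the true
syndrome size, d its part missing from `σ` and T ≤ s/β₀. A piece that may not be flipped contributes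
at most a fraction β of its syndrome size, so the remaining pieces carry a definite share; each of
them has at most d_A d_B checks. -/
lemma card_flippable (hG : IsBiregular G dA dB) (hX : IsExpanding G dA dB γ δ)
    (hdA : 1 ≤ dA) (hdAB : dA ≤ dB) (hδ0 : 0 < δ) (hδ : δ < 1 / 16) {β : ℝ} (hβ0 : 0 < β)
    (hβ : β < beta1 δ) {e : Finset (Qubit A B)}
    (heA : (e.card : ℝ) ≤ γ * Fintype.card A) (heB : (e.card : ℝ) ≤ γ * Fintype.card B)
    (hred : LocallyReduced G dA dB e) (σ : Finset (CheckX A B)) :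
    c1 δ β * ((syndrome G e).card - c2 δ β * (syndrome G e \ σ).card) ≤
      dA * dB * ((flippable G dA β σ e).ncard : ℝ) := by
  classical
  obtain ⟨F, hFsub, hF, hsum, hT, hcov⟩ := exists_flips hG hX hdA hdAB hδ0 heA heB hred
  set good : Finset (CheckZ A B) := Finset.univ.filter fun g => (F g).Nonempty ∧
    β * ((syndrome G (F g)).card : ℝ) ≤ (decrease G σ (F g) : ℝ) with hgood
  have hgs : (good : Set (CheckZ A B)) ⊆ flippable G dA β σ e := by
    intro g hg
    obtain ⟨h1, h2⟩ := (Finset.mem_filter.1 hg).2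
    refine ⟨F g, (hFsub g).1, ⟨h1, ⟨g, (hFsub g).2⟩, ?_⟩, (hFsub g).2, h2⟩
    have := (Nat.cast_le (α := ℝ)).2 (hF g)
    push_cast at this
    linarith
  have hN : good.card ≤ (flippable G dA β σ e).ncard := by
    rw [← Set.ncard_coe_finset]; exact Set.ncard_le_ncard hgs (Set.toFinite _)
  have hb0 : 0 < beta0 δ := by rw [beta0]; linarith
  have hb1 : beta1 δ < 1 := by rw [beta1]; linarith
  have hS : ∑ g ∈ good, ((syndrome G (F g)).card : ℝ) ≤ dA * dB * (good.card : ℝ) := by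
    have : ∑ g ∈ good, (syndrome G (F g)).card ≤ good.card • (dB * dA) :=
      Finset.sum_le_card_nsmul _ _ _ fun g _ => by
        rw [← card_grid hG g]; exact Finset.card_le_card (syndrome_subset_grid G (hFsub g).2)
    have := (Nat.cast_le (α := ℝ)).2 this
    push_cast [smul_eq_mul] at this
    linarith
  have hinter : (syndrome G e).card ≤ (syndrome G e \ σ).card +
      ∑ g, (σ ∩ syndrome G (F g)).card := by
    rw [← Finset.card_sdiff_add_card_inter (syndrome G e) σ]
    refine Nat.add_le_add_left (le_trans (Finset.card_le_card fun x hx => ?_)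
      (Finset.card_biUnion_le (s := Finset.univ))) _
    rw [Finset.mem_inter] at hx
    obtain ⟨g, hg⟩ := hcov x hx.1
    exact Finset.mem_biUnion.2 ⟨g, Finset.mem_univ _, Finset.mem_inter.2 ⟨hx.2, hg⟩⟩
  have hbound : ∀ g, 2 * ((σ ∩ syndrome G (F g)).card : ℝ) - (syndrome G (F g)).card ≤
      β * (syndrome G (F g)).card +
        if g ∈ good then (1 - β) * ((syndrome G (F g)).card : ℝ) else 0 := by
    intro g
    have hdec : (decrease G σ (F g) : ℝ) =
        2 * ((σ ∩ syndrome G (F g)).card : ℝ) - (syndrome G (F g)).card := by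
      rw [decrease_eq]; push_cast; ring
    split_ifs with hg
    · have : ((σ ∩ syndrome G (F g)).card : ℝ) ≤ (syndrome G (F g)).card := by
        exact_mod_cast Finset.card_le_card Finset.inter_subset_right
      linarith
    · rw [add_zero, ← hdec]
      by_cases hne : (F g).Nonempty
      · by_contra! hlt
        exact hg (Finset.mem_filter.2 ⟨Finset.mem_univ _, hne, hlt.le⟩)
      · rw [Finset.not_nonempty_iff_eq_empty] at hne
        rw [hdec, hne, syndrome_empty]; simp
  have hsumb := Finset.sum_le_sum fun g (_ : g ∈ Finset.univ) => hbound g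
  rw [Finset.sum_sub_distrib, ← Finset.mul_sum, Finset.sum_add_distrib, ← Finset.mul_sum,
    Finset.sum_ite_mem, Finset.univ_inter, ← Finset.mul_sum] at hsumb
  have hinter' := (Nat.cast_le (α := ℝ)).2 hinter
  push_cast at hinter' hT
  set T := ∑ g, ((syndrome G (F g)).card : ℝ)
  set s := ((syndrome G e).card : ℝ)
  set d := ((syndrome G e \ σ).card : ℝ)
  have hNr : (good.card : ℝ) ≤ ((flippable G dA β σ e).ncard : ℝ) := by exact_mod_cast hN
  have key : s * (beta1 δ - β) / beta0 δ - 2 * d ≤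
      (1 - β) * ∑ g ∈ good, ((syndrome G (F g)).card : ℝ) := by
    have hTs : T ≤ s / beta0 δ := by rw [le_div_iff₀ hb0]; linarith
    -- This is the identity β₁ = 2β₀ - 1.
    have e1 : s * (beta1 δ - β) / beta0 δ = 2 * s - (1 + β) * (s / beta0 δ) := by
      field_simp
      simp only [beta0, beta1]; ring
    rw [e1]
    nlinarith
  have h1b : 0 < 1 - β := by linarith
  have e2 : c1 δ β * (s - c2 δ β * d) = (s * (beta1 δ - β) / beta0 δ - 2 * d) / (1 - β) := by
    have : beta1 δ - β ≠ 0 := by linarith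
    simp only [c1, c2]
    field_simp
  rw [e2, div_le_iff₀ h1b]
  refine key.trans ?_
  rw [mul_comm]
  refine mul_le_mul_of_nonneg_right (hS.trans ?_) h1b.le
  exact mul_le_mul_of_nonneg_left hNr (by positivity)

end Partition

end QExpander

namespace QExpander

/-! ### Components and the counting of rooted sets -/

section Clusters

variable {V : Type*} [Fintype V] [DecidableEq V] (adj : V → V → Prop)

/-- `K` is a union of connected components of `U`. -/
def Saturated (U K : Finset V) : Prop :=
  K ⊆ U ∧ ∀ v ∈ K, ∀ w ∈ U, adj v w → w ∈ K

/-- Every connected component of `W` meets `S`, and `S ⊆ W`. -/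
def Rooted (S W : Finset V) : Prop :=
  S ⊆ W ∧ ∀ T, Saturated adj W T → S ⊆ T → T = W

open Classical in
/-- The union of the connected components of `U` that meet `S`. -/
noncomputable def cluster (U S : Finset V) : Finset V :=
  U.filter fun w => ∀ T, Saturated adj U T → S ⊆ T → w ∈ T

variable {adj} {U S K K' : Finset V}

lemma Saturated.sdiff (hsymm : ∀ v w, adj v w → adj w v) (h : Saturated adj U K)
    (h' : Saturated adj U K') : Saturated adj U (K \ K') :=
  ⟨Finset.sdiff_subset.trans h.1, fun v hv w hw hvw => by
    rw [Finset.mem_sdiff] at hv ⊢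
    exact ⟨h.2 v hv.1 w hw hvw, fun hw' => hv.2 (h'.2 w hw' v (h.1 hv.1) (hsymm _ _ hvw))⟩⟩

lemma Saturated.inter_subset {U' : Finset V} (h : Saturated adj U K) (hU : U' ⊆ U) :
    Saturated adj U' (K ∩ U') :=
  ⟨Finset.inter_subset_right, fun v hv w hw hvw => by
    rw [Finset.mem_inter] at hv ⊢
    exact ⟨h.2 v hv.1 w (hU hw) hvw, hw⟩⟩

lemma cluster_subset : cluster adj U S ⊆ U := by
  classical exact Finset.filter_subset _ _

lemma subset_cluster (hS : S ⊆ U) : S ⊆ cluster adj U S := by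
  classical
  intro v hv
  exact Finset.mem_filter.2 ⟨hS hv, fun _ _ hT => hT hv⟩

lemma cluster_saturated : Saturated adj U (cluster adj U S) := by
  classical
  refine ⟨cluster_subset, fun v hv w hw hvw => Finset.mem_filter.2 ⟨hw, fun T hT hST => ?_⟩⟩
  exact hT.2 v ((Finset.mem_filter.1 hv).2 T hT hST) w hw hvw

lemma cluster_subset_of_saturated (hK : Saturated adj U K) (hS : S ⊆ K) :
    cluster adj U S ⊆ K := by
  classical
  intro v hv
  exact (Finset.mem_filter.1 hv).2 K hK hS

lemma cluster_rooted (hS : S ⊆ U) : Rooted adj S (cluster adj U S) := by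
  refine ⟨subset_cluster hS, fun T hT hST => ?_⟩
  refine Finset.Subset.antisymm hT.1 (cluster_subset_of_saturated
    ⟨hT.1.trans cluster_subset, fun v hv w hw hvw => ?_⟩ hST)
  exact hT.2 v hv w (cluster_saturated.2 v (hT.1 hv) w hw hvw) hvw

lemma cluster_eq_of_mem (hsymm : ∀ v w, adj v w → adj w v) {u v : V} (hv : v ∈ U)
    (hu : u ∈ cluster adj U {v}) : cluster adj U {u} = cluster adj U {v} := by
  have huU := cluster_subset hu
  refine Finset.Subset.antisymm (cluster_subset_of_saturated cluster_saturated (by simpa using hu))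
    (cluster_subset_of_saturated cluster_saturated ?_)
  rw [Finset.singleton_subset_iff]
  by_contra hn
  -- If `v` were not in the cluster of `u`, removing that cluster would leave a saturated set
  -- containing `v` but not `u`.
  have := cluster_subset_of_saturated (S := {v})
    ((cluster_saturated (adj := adj) (U := U) (S := {v})).sdiff hsymm
      (cluster_saturated (adj := adj) (U := U) (S := {u})))
    (by
      rw [Finset.singleton_subset_iff, Finset.mem_sdiff]
      exact ⟨subset_cluster (by simpa using hv) (by simp), hn⟩) hu
  rw [Finset.mem_sdiff] at this
  exact this.2 (subset_cluster (by simpa using huU) (by simp))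

/-- Induction over the connected components of `U`. -/
lemma Saturated.induction (hsymm : ∀ v w, adj v w → adj w v) {P : Finset V → Prop}
    (h0 : P ∅)
    (h1 : ∀ v ∈ U, ∀ K, Saturated adj U K → Disjoint (cluster adj U {v}) K → P K →
      P (cluster adj U {v} ∪ K)) (hK : Saturated adj U K) : P K := by
  induction hn : K.card using Nat.strong_induction_on generalizing K with
  | _ n ih =>
    rcases K.eq_empty_or_nonempty with rfl | ⟨v, hv⟩
    · exact h0
    · have hc : cluster adj U {v} ⊆ K := cluster_subset_of_saturated hK (by simpa using hv)
      have hvU := hK.1 hv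
      have hvc : v ∈ cluster adj U {v} := subset_cluster (by simpa using hvU) (by simp)
      have := h1 v hvU (K \ cluster adj U {v}) (hK.sdiff hsymm cluster_saturated)
        Finset.disjoint_sdiff (ih _ (by
          rw [← hn]
          exact Finset.card_lt_card (Finset.sdiff_ssubset hc ⟨v, hvc⟩))
          (hK.sdiff hsymm cluster_saturated) rfl)
      rwa [Finset.union_sdiff_of_subset hc] at this

open Classical in
/-- The sets all of whose components meet `S` are few: the events that a uniformly random set
coincides with `W` on the closed neighbourhood of `W` are disjoint. -/
lemma sum_rooted_le (hrefl : ∀ v, adj v v) {Δ : ℕ}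
    (hΔ : ∀ v, (Finset.univ.filter fun w => adj v w).card ≤ Δ) (S : Finset V) :
    ∑ W ∈ Finset.univ.filter (Rooted adj S), ((1 : ℝ) / 2) ^ (Δ * W.card) ≤ 1 := by
  set nb : Finset V → Finset V := fun W => W.biUnion fun v => Finset.univ.filter fun w => adj v w
    with hnb
  have hWnb : ∀ W, W ⊆ nb W := fun W v hv =>
    Finset.mem_biUnion.2 ⟨v, hv, Finset.mem_filter.2 ⟨Finset.mem_univ _, hrefl v⟩⟩
  set Om : Finset V → Finset (Finset V) := fun W => Finset.univ.filter fun ω => ω ∩ nb W = W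
    with hOm
  have hsub : ∀ W W', Rooted adj S W → Rooted adj S W' → ∀ ω ∈ Om W, ω ∈ Om W' → W' ⊆ W := by
    intro W W' hW hW' ω hω hω'
    have hω := (Finset.mem_filter.1 hω).2
    have hω' := (Finset.mem_filter.1 hω').2
    -- A neighbour `w ∈ W'` of a point of `W ∩ W'` lies in `ω` and in `nb W`, hence in `W`. The
    -- intersection is therefore saturated in `W'` and contains `S`.
    have : W ∩ W' = W' := hW'.2 _ ⟨Finset.inter_subset_right, fun v hv w hw hvw => by
      rw [Finset.mem_inter] at hv ⊢
      refine ⟨?_, hw⟩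
      rw [← hω, Finset.mem_inter]
      rw [← hω', Finset.mem_inter] at hw
      exact ⟨hw.1, Finset.mem_biUnion.2 ⟨v, hv.1, Finset.mem_filter.2 ⟨Finset.mem_univ _, hvw⟩⟩⟩⟩
      (Finset.subset_inter hW.1 hW'.1)
    rw [← this]; exact Finset.inter_subset_left
  have hdisj : Set.PairwiseDisjoint (Finset.univ.filter (Rooted adj S) : Set (Finset V)) Om := by
    intro W hW W' hW' hne
    have hW := (Finset.mem_filter.1 hW).2
    have hW' := (Finset.mem_filter.1 hW').2
    refine Finset.disjoint_left.2 fun ω hω hω' => hne ?_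
    exact Finset.Subset.antisymm (hsub _ _ hW' hW ω hω' hω) (hsub _ _ hW hW' ω hω hω')
  -- A member of `Om W` is prescribed on `nb W` and free elsewhere.
  have hcard : ∀ W, 2 ^ (Fintype.card V - (nb W).card) ≤ (Om W).card := by
    intro W
    rw [← Finset.card_compl, ← Finset.card_powerset]
    refine Finset.card_le_card_of_injOn (fun ρ => W ∪ ρ) ?_ ?_
    · intro ρ hρ
      have hρ := Finset.mem_powerset.1 hρ
      refine Finset.mem_coe.2 (Finset.mem_filter.2 ⟨Finset.mem_univ _, ?_⟩)
      ext v
      simp only [Finset.mem_inter, Finset.mem_union]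
      constructor
      · rintro ⟨h | h, h'⟩
        · exact h
        · exact absurd h' (Finset.mem_compl.1 (hρ h))
      · intro h; exact ⟨Or.inl h, hWnb W h⟩
    · intro ρ hρ ρ' hρ' h
      have hρ := Finset.mem_powerset.1 hρ
      have hρ' := Finset.mem_powerset.1 hρ'
      have key : ∀ ρ : Finset V, ρ ⊆ (nb W)ᶜ → (W ∪ ρ) \ W = ρ := by
        intro ρ hρ
        rw [Finset.union_sdiff_left, Finset.sdiff_eq_self_iff_disjoint, Finset.disjoint_left]
        exact fun v hv hw => Finset.mem_compl.1 (hρ hv) (hWnb W hw)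
      rw [← key ρ hρ, ← key ρ' hρ']
      simp only at h
      rw [h]
  have hnbcard : ∀ W, (nb W).card ≤ Δ * W.card := by
    intro W
    rw [mul_comm]
    exact Finset.card_biUnion_le_card_mul _ _ _ fun v _ => hΔ v
  have htot : ∑ W ∈ Finset.univ.filter (Rooted adj S), (Om W).card ≤ 2 ^ Fintype.card V := by
    rw [← Finset.card_biUnion (fun W hW W' hW' h => hdisj hW hW' h), ← Fintype.card_finset]
    exact Finset.card_le_univ _
  have hterm : ∀ W : Finset V, ((1 : ℝ) / 2) ^ (Δ * W.card) ≤
      (Om W).card / 2 ^ Fintype.card V := by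
    intro W
    rw [le_div_iff₀ (by positivity)]
    have h1 : ((1 : ℝ) / 2) ^ (Δ * W.card) ≤ (1 / 2) ^ (nb W).card :=
      pow_le_pow_of_le_one (by norm_num) (by norm_num) (hnbcard W)
    have h2 : ((1 : ℝ) / 2) ^ (nb W).card * 2 ^ Fintype.card V =
        2 ^ (Fintype.card V - (nb W).card) := by
      have hle : (nb W).card ≤ Fintype.card V := Finset.card_le_univ _
      conv_lhs => rw [← Nat.sub_add_cancel hle, pow_add]
      rw [mul_comm, mul_assoc, ← mul_pow]; norm_num
    calc _ ≤ ((1 : ℝ) / 2) ^ (nb W).card * 2 ^ Fintype.card V :=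
          mul_le_mul_of_nonneg_right h1 (by positivity)
      _ = _ := h2
      _ ≤ _ := by exact_mod_cast hcard W
  calc _ ≤ ∑ W ∈ Finset.univ.filter (Rooted adj S), ((Om W).card : ℝ) / 2 ^ Fintype.card V :=
        Finset.sum_le_sum fun W _ => hterm W
    _ ≤ 1 := by
      rw [← Finset.sum_div, div_le_one (by positivity)]
      exact_mod_cast htot

end Clusters

end QExpander

namespace QExpander

/-! ### Components do not interact -/

section Locality

variable {A B : Type*} [Fintype A] [DecidableEq A] [Fintype B] [DecidableEq B]
  (G : A → B → Prop) [DecidableRel G]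

/-- Two qubits touch if they share a check or a generator. -/
def Touch (v w : Qubit A B) : Prop :=
  (∃ x, x ∈ gammaX G v ∧ x ∈ gammaX G w) ∨ ∃ g, v ∈ gammaZ G g ∧ w ∈ gammaZ G g

/-- `U` contains the support of every generator of which it contains more than half. -/
def MajorityClosed (dA dB : ℕ) (U : Finset (Qubit A B)) : Prop :=
  ∀ g : CheckZ A B, dA + dB < 2 * (U ∩ gammaZ G g).card → gammaZ G g ⊆ U

variable {G} {dA dB : ℕ}

lemma Touch.symm {v w : Qubit A B} (h : Touch G v w) : Touch G w v := by
  rcases h with ⟨x, h1, h2⟩ | ⟨g, h1, h2⟩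
  · exact Or.inl ⟨x, h2, h1⟩
  · exact Or.inr ⟨g, h2, h1⟩

lemma Touch.refl (hG : IsBiregular G dA dB) (hdA : 1 ≤ dA) (hdB : 1 ≤ dB) (v : Qubit A B) :
    Touch G v v := by
  have : (gammaX G v).Nonempty := by
    rw [← Finset.card_pos]
    rcases v with ⟨α, a⟩ | ⟨b, β⟩
    · rw [card_gammaX_inl hG]; omega
    · rw [card_gammaX_inr hG]; omega
  obtain ⟨x, hx⟩ := this
  exact Or.inl ⟨x, hx, hx⟩

variable {U K F : Finset (Qubit A B)}

lemma Saturated.disjoint_nbrX (hK : Saturated (Touch G) U K) {E : Finset (Qubit A B)}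
    (hE : E ⊆ U) (hEK : Disjoint E K) : Disjoint (nbrX G E) (nbrX G K) := by
  rw [Finset.disjoint_left]
  intro x hx hx'
  obtain ⟨v, hv, hxv⟩ := (mem_nbrX G).1 hx
  obtain ⟨w, hw, hxw⟩ := (mem_nbrX G).1 hx'
  exact Finset.disjoint_left.1 hEK hv (hK.2 w hw v (hE hv) (Or.inl ⟨x, hxw, hxv⟩))

lemma Saturated.subset_of_mem (hK : Saturated (Touch G) U K) (hF : F ⊆ U) {g : CheckZ A B}
    (hFg : F ⊆ gammaZ G g) {v : Qubit A B} (hv : v ∈ K) (hvg : v ∈ gammaZ G g) : F ⊆ K :=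
  fun w hw => hK.2 v hv w (hF hw) (Or.inr ⟨g, hvg, hFg hw⟩)

lemma Saturated.subset_of_mem_syndrome (hK : Saturated (Touch G) U K) (hF : F ⊆ U)
    {g : CheckZ A B} (hFg : F ⊆ gammaZ G g) {x : CheckX A B} (hx : x ∈ syndrome G F)
    (hxK : x ∈ nbrX G K) : F ⊆ K := by
  obtain ⟨v, hv, hxv⟩ := (mem_nbrX G).1 (syndrome_subset_nbrX G F hx)
  obtain ⟨w, hw, hxw⟩ := (mem_nbrX G).1 hxK
  exact hK.subset_of_mem hF hFg (hK.2 w hw v (hF hv) (Or.inl ⟨x, hxw, hxv⟩)) (hFg hv)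

/-- No check is adjacent both to `K` and to a qubit of `U` outside `K`, so syndromes can be computed
component by component. -/
lemma Saturated.syndrome_inter (hK : Saturated (Touch G) U K) {E : Finset (Qubit A B)}
    (hE : E ⊆ U) : syndrome G (E ∩ K) = syndrome G E ∩ nbrX G K := by
  have hEe : symmDiff (E ∩ K) (E \ K) = E := by
    ext v; simp only [Finset.mem_symmDiff, Finset.mem_inter, Finset.mem_sdiff]; tauto
  have h1 : syndrome G (E ∩ K) ⊆ nbrX G K :=
    (syndrome_subset_nbrX G _).trans (nbrX_mono G Finset.inter_subset_right)
  have h2 : Disjoint (syndrome G (E \ K)) (nbrX G K) :=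
    (hK.disjoint_nbrX (Finset.sdiff_subset.trans hE) Finset.sdiff_disjoint).mono_left
      (syndrome_subset_nbrX G _)
  have h3 := syndrome_symmDiff G (E ∩ K) (E \ K)
  rw [hEe] at h3
  rw [h3]
  ext x
  have := @h1 x
  have h4 : x ∈ syndrome G (E \ K) → x ∉ nbrX G K := fun h => Finset.disjoint_left.1 h2 h
  simp only [Finset.mem_symmDiff, Finset.mem_inter]
  tauto

/-- Take a smallest representative inside `U`. Were it to contain more than half of a generator,
adding that generator would shrink it, and majority closedness keeps the result inside `U`. -/
lemma exists_locallyReduced (hU : MajorityClosed G dA dB U)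
    (hG : IsBiregular G dA dB) {R : Finset (Qubit A B)} (hR : R ⊆ U) :
    ∃ e, e ⊆ U ∧ LocallyReduced G dA dB e ∧ Equivalent G e R := by
  classical
  obtain ⟨e, he, hmin⟩ := Finset.exists_min_image
    (Finset.univ.filter fun e : Finset (Qubit A B) => e ⊆ U ∧ Equivalent G e R) Finset.card
    ⟨R, Finset.mem_filter.2 ⟨Finset.mem_univ _, hR, Equivalent.refl R⟩⟩
  obtain ⟨heU, heR⟩ := (Finset.mem_filter.1 he).2
  refine ⟨e, heU, fun g => ?_, heR⟩
  by_contra! hlt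
  have hgU : gammaZ G g ⊆ U := hU g (hlt.trans_le (Nat.mul_le_mul_left _
    (Finset.card_le_card (Finset.inter_subset_inter_right heU))))
  have h1 := hmin (symmDiff e (gammaZ G g)) (Finset.mem_filter.2 ⟨Finset.mem_univ _,
    fun v hv => by
      rcases Finset.mem_symmDiff.1 hv with h | h
      · exact heU h.1
      · exact hgU h.1, heR.flip g⟩)
  have h2 := card_symmDiff_int e (gammaZ G g)
  have h3 := card_gammaZ hG g
  omega

end Locality

/-! ### The dynamics of a run -/

section Run

variable {A B : Type*} [Fintype A] [DecidableEq A] [Fintype B] [DecidableEq B]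
  (G : A → B → Prop) [DecidableRel G]

/-- The syndrome seen by the decoder for the residual error `R` and the syndrome error `D`. -/
def noisySyndrome (D : Finset (CheckX A B)) (R : Finset (Qubit A B)) : Finset (CheckX A B) :=
  symmDiff (syndrome G R) D

/-- A run of `f` rounds of the parallel decoder: `R i` is the residual error before round `i`, and
`Fg i g` the flip of the generator `g` in round `i`. -/
structure IsRun (dA : ℕ) (β : ℝ) {χ : ℕ} (color : CheckZ A B → Fin χ) (f : ℕ)
    (E : Finset (Qubit A B)) (D : Finset (CheckX A B)) (R : ℕ → Finset (Qubit A B))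
    (Fg : ℕ → CheckZ A B → Finset (Qubit A B)) : Prop where
  zero : R 0 = E
  step : ∀ i < f, R (i + 1) = symmDiff (R i) (xorSum Finset.univ (Fg i))
  idle : ∀ i g, (color g : ℕ) ≠ i % χ → Fg i g = ∅
  flip : ∀ i < f, ∀ g, (color g : ℕ) = i % χ →
    Fg i g ∈ available G dA β (noisySyndrome G D (R i)) g ∨
      (available G dA β (noisySyndrome G D (R i)) g = ∅ ∧ Fg i g = ∅)

/-- The qubits that are in error or flipped during a run. -/
def runSupport (f : ℕ) (E : Finset (Qubit A B)) (Fg : ℕ → CheckZ A B → Finset (Qubit A B)) :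
    Finset (Qubit A B) :=
  E ∪ (Finset.range f).biUnion fun i => Finset.univ.biUnion fun g => Fg i g

variable {G} {dA dB : ℕ} {β : ℝ} {χ : ℕ} {color : CheckZ A B → Fin χ} {f : ℕ}
  {E : Finset (Qubit A B)} {D : Finset (CheckX A B)} {R : ℕ → Finset (Qubit A B)}
  {Fg : ℕ → CheckZ A B → Finset (Qubit A B)}

lemma xorSum_subset {ι α : Type*} [Fintype α] [DecidableEq α] {s : Finset ι}
    {F : ι → Finset α} {T : Finset α} (h : ∀ i ∈ s, F i ⊆ T) : xorSum s F ⊆ T := by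
  intro x hx
  by_contra hn
  rw [← bit_eq_one, bit_xorSum, Finset.sum_eq_zero fun i hi => bit_eq_zero.2 fun h' => hn (h i hi h')]
    at hx
  exact zero_ne_one hx

lemma exists_isRun {Ehat : Finset (Qubit A B)}
    (h : IsParallelOutput G dA β color f (noisySyndrome G D E) Ehat) :
    ∃ R Fg, IsRun G dA β color f E D R Fg ∧ R f = symmDiff E Ehat := by
  classical
  obtain ⟨Es, σs, F, hE0, hσ0, hstep, rfl⟩ := h
  have : ∀ i, ∃ Fg : CheckZ A B → Finset (Qubit A B), i < f →
      (∀ g, (color g : ℕ) = i % χ → (Fg g ∈ available G dA β (σs i) g ∨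
        (available G dA β (σs i) g = ∅ ∧ Fg g = ∅))) ∧
      F i = xorSum (Finset.univ.filter fun g : CheckZ A B => (color g : ℕ) = i % χ) Fg := by
    intro i
    by_cases hi : i < f
    · obtain ⟨Fg, h1, h2⟩ := (hstep i hi).1
      exact ⟨Fg, fun _ => ⟨h1, h2⟩⟩
    · exact ⟨fun _ => ∅, fun h => absurd h hi⟩
  choose Fg hFg using this
  set Fg' : ℕ → CheckZ A B → Finset (Qubit A B) := fun i g =>
    if (color g : ℕ) = i % χ then Fg i g else ∅ with hFg'
  have hsum : ∀ i < f, xorSum Finset.univ (Fg' i) = F i := by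
    intro i hi
    rw [(hFg i hi).2]
    apply ext_bit; intro x
    rw [bit_xorSum, bit_xorSum, Finset.sum_filter]
    refine Finset.sum_congr rfl fun g _ => ?_
    simp only [hFg']
    split_ifs <;> simp [bit_empty]
  -- The syndrome held by the decoder is always that of the residual error combined with the
  -- unchanged syndrome error `D`.
  have hσ : ∀ i ≤ f, σs i = noisySyndrome G D (symmDiff E (Es i)) := by
    intro i
    induction i with
    | zero => intro _; rw [hσ0, hE0]; congr 1; exact (symmDiff_bot _).symm
    | succ i ih =>
      intro hi
      obtain ⟨-, h2, h3⟩ := hstep i hi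
      rw [h3, ih (Nat.le_of_succ_le hi), h2, noisySyndrome, noisySyndrome, ← symmDiff_assoc,
        syndrome_symmDiff G _ (F i), symmDiff_right_comm]
  refine ⟨fun i => symmDiff E (Es i), Fg', ⟨?_, ?_, ?_, ?_⟩, rfl⟩
  · simp only [hE0]; exact symmDiff_bot _
  · intro i hi
    rw [hsum i hi, (hstep i hi).2.1, symmDiff_assoc]
  · intro i g h; simp [hFg', h]
  · intro i hi g hg
    simp only [hFg', hg, if_true]
    rw [← hσ i hi.le]
    exact (hFg i hi).1 g hg

lemma IsRun.flip_subset_gammaZ (h : IsRun G dA β color f E D R Fg) {i : ℕ} (hi : i < f)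
    (g : CheckZ A B) : Fg i g ⊆ gammaZ G g := by
  by_cases hc : (color g : ℕ) = i % χ
  · rcases h.flip i hi g hc with h1 | h1
    · exact h1.2.1
    · rw [h1.2]; simp
  · rw [h.idle i g hc]; simp

lemma IsRun.flip_subset_runSupport {i : ℕ} (hi : i < f) (g : CheckZ A B) :
    Fg i g ⊆ runSupport f E Fg := fun _ hv =>
  Finset.mem_union_right _ (Finset.mem_biUnion.2 ⟨i, Finset.mem_range.2 hi,
    Finset.mem_biUnion.2 ⟨g, Finset.mem_univ _, hv⟩⟩)

lemma IsRun.residual_subset (h : IsRun G dA β color f E D R Fg) {i : ℕ} (hi : i ≤ f) :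
    R i ⊆ runSupport f E Fg := by
  induction i with
  | zero => rw [h.zero]; exact Finset.subset_union_left
  | succ i ih =>
    rw [h.step i hi]
    intro v hv
    rcases Finset.mem_symmDiff.1 hv with h1 | h1
    · exact ih (Nat.le_of_succ_le hi) h1.1
    · exact xorSum_subset (fun g _ => IsRun.flip_subset_runSupport hi g) h1.1

/-- Every check of a grid is adjacent to a qubit of the support, so a good colouring makes the grids
of one colour disjoint. -/
lemma eq_of_mem_grid (hcol : IsGoodColoring G color) {g g' : CheckZ A B} {x : CheckX A B}
    (hx : x ∈ grid G g) (hx' : x ∈ grid G g') (hc : color g = color g') : g = g' := by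
  by_contra hne
  rw [mem_grid] at hx hx'
  refine hcol g g' hne ⟨Sum.inl (x.1, g.2), (inl_mem_gammaZ G).2 ⟨rfl, hx.1⟩,
    Sum.inl (x.1, g'.2), (inl_mem_gammaZ G).2 ⟨rfl, hx'.1⟩, x,
    (mem_gammaX_inl G).2 ⟨rfl, hx.2⟩, (mem_gammaX_inl G).2 ⟨rfl, hx'.2⟩⟩ hc

lemma IsRun.eq_of_mem_syndrome (h : IsRun G dA β color f E D R Fg)
    (hcol : IsGoodColoring G color) {i : ℕ} (hi : i < f) {g g' : CheckZ A B} {x : CheckX A B}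
    (hx : x ∈ syndrome G (Fg i g)) (hx' : x ∈ syndrome G (Fg i g')) : g = g' := by
  have hc : ∀ g, x ∈ syndrome G (Fg i g) → (color g : ℕ) = i % χ := by
    intro g hg
    by_contra hn
    rw [h.idle i g hn, syndrome_empty] at hg
    simp at hg
  exact eq_of_mem_grid hcol (syndrome_subset_grid G (h.flip_subset_gammaZ hi g) hx)
    (syndrome_subset_grid G (h.flip_subset_gammaZ hi g') hx')
    (Fin.ext ((hc g hx).trans (hc g' hx').symm))

lemma IsRun.syndrome_step (h : IsRun G dA β color f E D R Fg)
    (hcol : IsGoodColoring G color) {i : ℕ} (hi : i < f) :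
    noisySyndrome G D (R (i + 1)) = symmDiff (noisySyndrome G D (R i))
      (Finset.univ.biUnion fun g => syndrome G (Fg i g)) := by
  have hZ : syndrome G (xorSum Finset.univ (Fg i)) =
      Finset.univ.biUnion fun g => syndrome G (Fg i g) := by
    rw [syndrome_xorSum]
    ext x
    rw [Finset.mem_biUnion, ← bit_eq_one, bit_xorSum]
    constructor
    · intro hx
      by_contra! hn
      rw [Finset.sum_eq_zero fun g hg => bit_eq_zero.2 (hn g hg)] at hx
      exact zero_ne_one hx
    · rintro ⟨g, -, hg⟩
      rw [Fintype.sum_eq_single g fun g' hg' => bit_eq_zero.2 fun hx' =>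
        hg' (h.eq_of_mem_syndrome hcol hi hx' hg), bit_eq_one.2 hg]
  rw [noisySyndrome, h.step i hi, syndrome_symmDiff, hZ, symmDiff_right_comm]; rfl

/-- The total size of the syndromes of the flips of round `i` inside `K`. -/
def flipSize (G : A → B → Prop) [DecidableRel G] (Fg : CheckZ A B → Finset (Qubit A B))
    (K : Finset (Qubit A B)) : ℕ :=
  ∑ g ∈ Finset.univ.filter fun g => Fg g ⊆ K, (syndrome G (Fg g)).card

lemma IsRun.le_decrease (h : IsRun G dA β color f E D R Fg) {i : ℕ} (hi : i < f)
    (g : CheckZ A B) : β * ((syndrome G (Fg i g)).card : ℝ) ≤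
      (decrease G (noisySyndrome G D (R i)) (Fg i g) : ℝ) := by
  have h0 : β * ((syndrome G (∅ : Finset (Qubit A B))).card : ℝ) ≤
      (decrease G (noisySyndrome G D (R i)) (∅ : Finset (Qubit A B)) : ℝ) := by
    rw [decrease_eq, syndrome_empty]; simp
  by_cases hc : (color g : ℕ) = i % χ
  · rcases h.flip i hi g hc with h1 | h1
    · exact h1.2.2
    · rw [h1.2]; exact h0
  · rw [h.idle i g hc]; exact h0

variable {U K : Finset (Qubit A B)}

/-- The flips of one round have disjoint syndromes, so their decreases add up although all are
computed from the same syndrome. A flip whose syndrome meets the checks of `K` lies entirely in `K`,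
so nothing outside interferes. -/
lemma IsRun.card_step_add_le (h : IsRun G dA β color f E D R Fg)
    (hcol : IsGoodColoring G color) (hU : runSupport f E Fg ⊆ U)
    (hK : Saturated (Touch G) U K) {i : ℕ} (hi : i < f) :
    ((noisySyndrome G D (R (i + 1)) ∩ nbrX G K).card : ℝ) + β * flipSize G (Fg i) K ≤
      (noisySyndrome G D (R i) ∩ nbrX G K).card := by
  set σ := noisySyndrome G D (R i) with hσ
  set Z := (Finset.univ.filter fun g => Fg i g ⊆ K).biUnion fun g => syndrome G (Fg i g) with hZ
  have hFU : ∀ g, Fg i g ⊆ U := fun g => (IsRun.flip_subset_runSupport hi g).trans hU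
  have hdis : Set.PairwiseDisjoint (Finset.univ : Finset (CheckZ A B))
      fun g => syndrome G (Fg i g) := by
    intro g _ g' _ hne
    exact Finset.disjoint_left.2 fun x hx hx' => hne (h.eq_of_mem_syndrome hcol hi hx hx')
  have hZK : Z ⊆ nbrX G K := by
    refine Finset.biUnion_subset.2 fun g hg => (syndrome_subset_nbrX G _).trans (nbrX_mono G ?_)
    exact (Finset.mem_filter.1 hg).2
  have hZe : (Finset.univ.biUnion fun g => syndrome G (Fg i g)) ∩ nbrX G K = Z := by
    refine Finset.Subset.antisymm (fun x hx => ?_) (Finset.subset_inter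
      (Finset.biUnion_subset_biUnion_of_subset_left _ (Finset.filter_subset _ _)) hZK)
    obtain ⟨hx1, hx2⟩ := Finset.mem_inter.1 hx
    obtain ⟨g, -, hg⟩ := Finset.mem_biUnion.1 hx1
    exact Finset.mem_biUnion.2 ⟨g, Finset.mem_filter.2 ⟨Finset.mem_univ _,
      hK.subset_of_mem_syndrome (hFU g) (h.flip_subset_gammaZ hi g) hg hx2⟩, hg⟩
  have hnew : noisySyndrome G D (R (i + 1)) ∩ nbrX G K = symmDiff (σ ∩ nbrX G K) Z := by
    rw [h.syndrome_step hcol hi, ← hZe]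
    ext x; simp only [Finset.mem_symmDiff, Finset.mem_inter]; tauto
  have hc1 : Z.card = flipSize G (Fg i) K :=
    Finset.card_biUnion fun g hg g' hg' hne => hdis (Finset.mem_univ g) (Finset.mem_univ g') hne
  have hc2 : ((σ ∩ nbrX G K) ∩ Z).card =
      ∑ g ∈ Finset.univ.filter fun g => Fg i g ⊆ K, (σ ∩ syndrome G (Fg i g)).card := by
    rw [Finset.inter_assoc, Finset.inter_eq_right.2 hZK, hZ, Finset.inter_biUnion]
    refine Finset.card_biUnion fun g hg g' hg' hne => ?_
    exact (hdis (Finset.mem_univ g) (Finset.mem_univ g') hne).mono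
      Finset.inter_subset_right Finset.inter_subset_right
  have hcard := card_symmDiff_int (σ ∩ nbrX G K) Z
  rw [← hnew, hc2] at hcard
  have hdec : β * (flipSize G (Fg i) K : ℝ) ≤ 2 * ((∑ g ∈ Finset.univ.filter fun g => Fg i g ⊆ K,
      (σ ∩ syndrome G (Fg i g)).card : ℕ) : ℝ) - (Z.card : ℝ) := by
    rw [hc1, flipSize]
    push_cast
    rw [Finset.mul_sum, Finset.mul_sum, ← Finset.sum_sub_distrib]
    refine Finset.sum_le_sum fun g _ => ?_
    have := h.le_decrease hi g
    rw [decrease_eq] at this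
    push_cast at this
    exact this
  have hcard' : ((noisySyndrome G D (R (i + 1)) ∩ nbrX G K).card : ℝ) =
      (σ ∩ nbrX G K).card + Z.card - 2 * ((∑ g ∈ Finset.univ.filter fun g => Fg i g ⊆ K,
      (σ ∩ syndrome G (Fg i g)).card : ℕ) : ℝ) := by exact_mod_cast hcard
  linarith

lemma IsRun.card_add_sum_le (h : IsRun G dA β color f E D R Fg)
    (hcol : IsGoodColoring G color) (hU : runSupport f E Fg ⊆ U)
    (hK : Saturated (Touch G) U K) {k l : ℕ} (hl : k + l ≤ f) :
    ((noisySyndrome G D (R (k + l)) ∩ nbrX G K).card : ℝ) +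
      β * (∑ j ∈ Finset.range l, flipSize G (Fg (k + j)) K : ℕ) ≤
      (noisySyndrome G D (R k) ∩ nbrX G K).card := by
  induction l with
  | zero => simp
  | succ l ih =>
    have h1 := ih (by omega)
    have h2 := h.card_step_add_le hcol hU hK (i := k + l) (by omega)
    rw [Finset.sum_range_succ]
    push_cast at h1 h2 ⊢
    rw [← add_assoc k l 1]
    linarith

lemma IsRun.card_antitone (h : IsRun G dA β color f E D R Fg) (hβ : 0 < β)
    (hcol : IsGoodColoring G color) (hU : runSupport f E Fg ⊆ U)
    (hK : Saturated (Touch G) U K) {k l : ℕ} (hkl : k ≤ l) (hl : l ≤ f) :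
    (noisySyndrome G D (R l) ∩ nbrX G K).card ≤ (noisySyndrome G D (R k) ∩ nbrX G K).card := by
  obtain ⟨j, rfl⟩ := Nat.exists_eq_add_of_le hkl
  have := h.card_add_sum_le hcol hU hK hl
  have h0 : 0 ≤ β * (∑ j ∈ Finset.range j, flipSize G (Fg (k + j)) K : ℕ) := by positivity
  exact_mod_cast (by linarith : ((noisySyndrome G D (R (k + j)) ∩ nbrX G K).card : ℝ) ≤
    (noisySyndrome G D (R k) ∩ nbrX G K).card)

lemma mul_card_le_of_mem_candidates {F : Finset (Qubit A B)} (h : F ∈ candidates G dA) :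
    dA * F.card ≤ 2 * (syndrome G F).card := by
  have := h.2.2
  have h2 : ((dA * F.card : ℕ) : ℝ) ≤ ((2 * (syndrome G F).card : ℕ) : ℝ) := by
    push_cast; linarith
  exact_mod_cast h2

lemma card_syndrome_pos_of_mem_candidates (hdA : 1 ≤ dA) {F : Finset (Qubit A B)}
    (h : F ∈ candidates G dA) : 0 < (syndrome G F).card := by
  have h1 := mul_card_le_of_mem_candidates h
  have h2 : 0 < dA * F.card := Nat.mul_pos (by omega) (Finset.card_pos.2 h.1)
  omega

/-- The coordinates of a conflicting generator are equal to, or at distance two from, those of the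
given one; the two factors of χ count these choices. -/
lemma card_conflict_le (hG : IsBiregular G dA dB) (h : CheckZ A B) :
    (Finset.univ.filter fun g => ∃ x, x ∈ grid G h ∧ x ∈ grid G g).card ≤ chi dA dB := by
  have hsub : (Finset.univ.filter fun g => ∃ x, x ∈ grid G h ∧ x ∈ grid G g) ⊆
      (insert h.1 ((nbrB G h.1).biUnion fun α => (nbrA G α).erase h.1)) ×ˢ
      (insert h.2 ((nbrA G h.2).biUnion fun β => (nbrB G β).erase h.2)) := by
    intro g hg
    obtain ⟨x, hx, hx'⟩ := (Finset.mem_filter.1 hg).2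
    rw [mem_grid] at hx hx'
    rw [Finset.mem_product]
    constructor
    · rw [Finset.mem_insert]
      by_cases he : g.1 = h.1
      · exact Or.inl he
      · exact Or.inr (Finset.mem_biUnion.2 ⟨x.1, (mem_nbrB G).2 hx.1,
          Finset.mem_erase.2 ⟨he, (mem_nbrA G).2 hx'.1⟩⟩)
    · rw [Finset.mem_insert]
      by_cases he : g.2 = h.2
      · exact Or.inl he
      · exact Or.inr (Finset.mem_biUnion.2 ⟨x.2, (mem_nbrA G).2 hx.2,
          Finset.mem_erase.2 ⟨he, (mem_nbrB G).2 hx'.2⟩⟩)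
  refine (Finset.card_le_card hsub).trans ?_
  rw [Finset.card_product, chi]
  refine Nat.mul_le_mul ((Finset.card_insert_le _ _).trans (Nat.add_le_add_right ?_ _))
    ((Finset.card_insert_le _ _).trans (Nat.add_le_add_right ?_ _))
  · rw [← hG.2 h.1]
    refine Finset.card_biUnion_le_card_mul _ _ _ fun α hα => ?_
    rw [Finset.card_erase_of_mem ((mem_nbrA G).2 ((mem_nbrB G).1 hα)), hG.1]
  · rw [← hG.1 h.2]
    refine Finset.card_biUnion_le_card_mul _ _ _ fun α hα => ?_
    rw [Finset.card_erase_of_mem ((mem_nbrB G).2 ((mem_nbrA G).1 hα)), hG.2]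

/-- In a block of `χ` rounds, at least a fraction `1 / χ` of the generators that were flippable at
the start flips. -/
lemma IsRun.ncard_flippable_le (h : IsRun G dA β color f E D R Fg)
    (hG : IsBiregular G dA dB) (hdA : 1 ≤ dA) (hdB : 1 ≤ dB)
    (hcol : IsGoodColoring G color) (hU : runSupport f E Fg ⊆ U)
    (hK : Saturated (Touch G) U K) {k : ℕ} (hk : χ ∣ k) (hl : k + χ ≤ f)
    {e : Finset (Qubit A B)} (he : e ⊆ K) :
    (flippable G dA β (noisySyndrome G D (R k)) e).ncard ≤
      chi dA dB * ∑ j ∈ Finset.range χ, flipSize G (Fg (k + j)) K := by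
  classical
  -- The generators that make a nonempty flip inside `K` during the block. Since χ divides `k`, the
  -- generator `g` has its turn in round `k + color g`.
  set H : Finset (CheckZ A B) := Finset.univ.filter fun g =>
    (Fg (k + color g) g).Nonempty ∧ Fg (k + color g) g ⊆ K with hH
  have hmod : ∀ j < χ, (k + j) % χ = j := by
    intro j hj
    obtain ⟨q, rfl⟩ := hk
    rw [Nat.mul_add_mod, Nat.mod_eq_of_lt hj]
  have hlt : ∀ g, k + (color g : ℕ) < f := fun g => by have := (color g).2; omega
  -- A nonempty candidate has a nonempty syndrome, so each flip contributes at least one to the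
  -- total.
  have hHle : H.card ≤ ∑ j ∈ Finset.range χ, flipSize G (Fg (k + j)) K := by
    rw [Finset.card_eq_sum_card_fiberwise (f := fun g => (color g : ℕ)) (t := Finset.range χ)
      fun g _ => by simp]
    refine Finset.sum_le_sum fun j hj => ?_
    rw [Finset.card_eq_sum_ones, flipSize]
    refine le_trans (Finset.sum_le_sum (g := fun g => (syndrome G (Fg (k + j) g)).card)
      fun g hg => ?_) (Finset.sum_le_sum_of_subset fun g hg => ?_)
    · obtain ⟨hg1, hg2⟩ := Finset.mem_filter.1 hg
      have hg3 := (Finset.mem_filter.1 hg1).2.1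
      rw [← hg2]
      rcases h.flip _ (hlt g) g (hmod _ (color g).2).symm with h1 | h1
      · exact card_syndrome_pos_of_mem_candidates hdA h1.1
      · rw [h1.2] at hg3; simp at hg3
    · obtain ⟨hg1, hg2⟩ := Finset.mem_filter.1 hg
      have hg3 := (Finset.mem_filter.1 hg1).2.2
      rw [hg2] at hg3
      exact Finset.mem_filter.2 ⟨Finset.mem_univ _, hg3⟩
  have hcover : flippable G dA β (noisySyndrome G D (R k)) e ⊆
      (H.biUnion fun h => Finset.univ.filter fun g => ∃ x, x ∈ grid G h ∧ x ∈ grid G g :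
        Finset (CheckZ A B)) := by
    rintro g ⟨F, hFe, hF⟩
    have hFK : F ⊆ K := hFe.trans he
    obtain ⟨v, hv⟩ := hF.1.1
    rw [Finset.mem_coe, Finset.mem_biUnion]
    rcases h.flip _ (hlt g) g (hmod _ (color g).2).symm with h1 | h1
    · have hne : (grid G g).Nonempty := by
        rw [← Finset.card_pos, card_grid hG]; exact Nat.mul_pos hdB hdA
      obtain ⟨x, hx⟩ := hne
      refine ⟨g, Finset.mem_filter.2 ⟨Finset.mem_univ _, h1.1.1, ?_⟩,
        Finset.mem_filter.2 ⟨Finset.mem_univ _, x, hx, hx⟩⟩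
      exact hK.subset_of_mem ((IsRun.flip_subset_runSupport (hlt g) g).trans hU) h1.2.1
        (hFK hv) (hF.2.1 hv)
    -- If `g` had no flip at its turn, the syndrome on the checks of `F` changed earlier in the
    -- block. The flip that changed it shares a check with the grid of `g` and, by saturation, lies
    -- in `K`.
    · have hchange : noisySyndrome G D (R (k + color g)) ∩ syndrome G F ≠
          noisySyndrome G D (R k) ∩ syndrome G F := by
        intro heq
        have : F ∈ available G dA β (noisySyndrome G D (R (k + color g))) g := by
          refine ⟨hF.1, hF.2.1, ?_⟩
          have := hF.2.2
          rw [decrease_eq] at this ⊢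
          rwa [heq]
        rw [h1.1] at this
        exact this
      have hex : ∃ j < (color g : ℕ), noisySyndrome G D (R (k + j + 1)) ∩ syndrome G F ≠
          noisySyndrome G D (R (k + j)) ∩ syndrome G F := by
        by_contra! hall
        apply hchange
        have : ∀ j ≤ (color g : ℕ), noisySyndrome G D (R (k + j)) ∩ syndrome G F =
            noisySyndrome G D (R k) ∩ syndrome G F := by
          intro j
          induction j with
          | zero => intro _; rfl
          | succ j ih => intro hj; rw [← add_assoc, hall j hj, ih (by omega)]
        exact this _ le_rfl
      obtain ⟨j, hj, hne⟩ := hex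
      have hjχ : j < χ := hj.trans (color g).2
      have hjf : k + j < f := by omega
      rw [h.syndrome_step hcol hjf] at hne
      have : ∃ x ∈ syndrome G F, x ∈ Finset.univ.biUnion fun g => syndrome G (Fg (k + j) g) := by
        by_contra! hall
        apply hne
        ext x
        have := hall x
        simp only [Finset.mem_inter, Finset.mem_symmDiff]
        tauto
      obtain ⟨x, hxF, hx⟩ := this
      obtain ⟨h', -, hx'⟩ := Finset.mem_biUnion.1 hx
      have hcj : (color h' : ℕ) = j := by
        by_contra hn
        rw [h.idle (k + j) h' (by rw [hmod j hjχ]; exact hn), syndrome_empty] at hx'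
        simp at hx'
      have hsub : Fg (k + j) h' ⊆ K :=
        hK.subset_of_mem_syndrome ((IsRun.flip_subset_runSupport hjf h').trans hU)
          (h.flip_subset_gammaZ hjf h') hx' (nbrX_mono G hFK (syndrome_subset_nbrX G F hxF))
      refine ⟨h', Finset.mem_filter.2 ⟨Finset.mem_univ _, ?_, ?_⟩, Finset.mem_filter.2
        ⟨Finset.mem_univ _, x, syndrome_subset_grid G (h.flip_subset_gammaZ hjf h') hx',
          syndrome_subset_grid G hF.2.1 hxF⟩⟩
      · rw [hcj, Finset.nonempty_iff_ne_empty]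
        intro h0
        rw [h0, syndrome_empty] at hx'
        simp at hx'
      · rw [hcj]; exact hsub
  calc (flippable G dA β (noisySyndrome G D (R k)) e).ncard ≤ _ :=
        Set.ncard_le_ncard hcover (Finset.finite_toSet _)
    _ ≤ H.card * chi dA dB := by
        rw [Set.ncard_coe_finset]
        exact Finset.card_biUnion_le_card_mul _ _ _ fun h _ => card_conflict_le hG h
    _ ≤ _ := by rw [mul_comm]; exact Nat.mul_le_mul_left _ hHle

/-- In a run, the qubits flipped in a component are controlled by the errors in it. -/
lemma IsRun.card_le_of_saturated (h : IsRun G dA β color f E D R Fg)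
    (hG : IsBiregular G dA dB) (hdA : 1 ≤ dA) (hdAB : dA ≤ dB) (hβ : 0 < β)
    (hcol : IsGoodColoring G color) (hK : Saturated (Touch G) (runSupport f E Fg) K) :
    (K.card : ℝ) ≤ (1 + 2 * dB / (dA * β)) * ((E ∩ K).card + (D ∩ nbrX G K).card) := by
  have hsub : K ⊆ (E ∩ K) ∪ (Finset.range f).biUnion fun i =>
      (Finset.univ.filter fun g => Fg i g ⊆ K).biUnion fun g => Fg i g := by
    intro v hv
    rcases Finset.mem_union.1 (hK.1 hv) with h1 | h1
    · exact Finset.mem_union_left _ (Finset.mem_inter.2 ⟨h1, hv⟩)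
    · refine Finset.mem_union_right _ ?_
      obtain ⟨i, hi, h2⟩ := Finset.mem_biUnion.1 h1
      obtain ⟨g, -, hg⟩ := Finset.mem_biUnion.1 h2
      have hif := Finset.mem_range.1 hi
      exact Finset.mem_biUnion.2 ⟨i, hi, Finset.mem_biUnion.2 ⟨g, Finset.mem_filter.2
        ⟨Finset.mem_univ _, hK.subset_of_mem (IsRun.flip_subset_runSupport hif g)
          (h.flip_subset_gammaZ hif g) hv (h.flip_subset_gammaZ hif g hg)⟩, hg⟩⟩
  -- Every qubit of `K` is an initial error or lies in a flip contained in `K`, and d_A|F| ≤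
  -- 2|σ_X(F)| for each flip.
  have h1 : dA * K.card ≤ dA * (E ∩ K).card +
      2 * ∑ i ∈ Finset.range f, flipSize G (Fg (0 + i)) K := by
    have := (Finset.card_le_card hsub).trans (Finset.card_union_le _ _)
    refine (Nat.mul_le_mul_left dA this).trans ?_
    rw [mul_add]
    refine Nat.add_le_add_left ?_ _
    refine (Nat.mul_le_mul_left dA Finset.card_biUnion_le).trans ?_
    rw [Finset.mul_sum, Finset.mul_sum]
    refine Finset.sum_le_sum fun i hi => ?_
    refine (Nat.mul_le_mul_left dA Finset.card_biUnion_le).trans ?_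
    rw [flipSize, Finset.mul_sum, Finset.mul_sum, zero_add]
    refine Finset.sum_le_sum fun g _ => ?_
    have hif := Finset.mem_range.1 hi
    by_cases hc : (color g : ℕ) = i % χ
    · rcases h.flip i hif g hc with h2 | h2
      · exact mul_card_le_of_mem_candidates h2.1
      · rw [h2.2]; simp
    · rw [h.idle i g hc]; simp
  have h2 := h.card_add_sum_le hcol (Finset.Subset.refl _) hK (k := 0) (l := f) (by omega)
  have h3 : (noisySyndrome G D (R 0) ∩ nbrX G K).card ≤
      dB * (E ∩ K).card + (D ∩ nbrX G K).card := by
    have hs : noisySyndrome G D (R 0) ∩ nbrX G K ⊆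
        syndrome G (E ∩ K) ∪ (D ∩ nbrX G K) := by
      rw [hK.syndrome_inter (E := E) Finset.subset_union_left, h.zero]
      intro x
      simp only [noisySyndrome, Finset.mem_inter, Finset.mem_union, Finset.mem_symmDiff]
      tauto
    refine (Finset.card_le_card hs).trans ((Finset.card_union_le _ _).trans
      (Nat.add_le_add_right ?_ _))
    refine (Finset.card_le_card (syndrome_subset_nbrX G _)).trans ?_
    rw [mul_comm]
    refine Finset.card_biUnion_le_card_mul _ _ _ fun v _ => ?_
    rcases v with ⟨α, a⟩ | ⟨b, β⟩
    · rw [card_gammaX_inl hG]; exact hdAB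
    · rw [card_gammaX_inr hG]
  have h1' := (Nat.cast_le (α := ℝ)).2 h1
  have h3' := (Nat.cast_le (α := ℝ)).2 h3
  push_cast at h1' h2 h3'
  set tot := ∑ i ∈ Finset.range f, (flipSize G (Fg (0 + i)) K : ℝ)
  set eK := ((E ∩ K).card : ℝ)
  set d := ((D ∩ nbrX G K).card : ℝ)
  have hdA' : (1 : ℝ) ≤ dA := by exact_mod_cast hdA
  have hdB' : (1 : ℝ) ≤ dB := by exact_mod_cast hdA.trans hdAB
  have he0 : 0 ≤ eK := Nat.cast_nonneg _
  have hd0 : 0 ≤ d := Nat.cast_nonneg _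
  -- The flips are paid for by the initial syndrome in `K`, as the final one is nonnegative.
  have hf : β * tot ≤ dB * eK + d := by
    have : (0 : ℝ) ≤ (noisySyndrome G D (R (0 + f)) ∩ nbrX G K).card := Nat.cast_nonneg _
    linarith
  have hfin : (dA * β) * K.card ≤ (dA * β + 2 * dB) * (eK + d) := by
    nlinarith [mul_le_mul_of_nonneg_left h1' hβ.le, mul_nonneg (mul_nonneg
      (by linarith : (0 : ℝ) ≤ dA) hβ.le) hd0, mul_nonneg (by linarith : (0 : ℝ) ≤ dB - 1) hd0]
  have hpos : 0 < dA * β := by positivity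
  have e1 : (1 + 2 * dB / (dA * β)) * (eK + d) = (dA * β + 2 * dB) * (eK + d) / (dA * β) := by
    field_simp
  rw [e1, le_div_iff₀ hpos]
  linarith

end Run

end QExpander

namespace QExpander

/-! ### The constants and the decay rate -/

section Constants

variable {dA dB : ℕ} {δ β c : ℝ}

lemma c1_pos (hβ0 : 0 < β) (hδ0 : 0 < δ) (hβ : β < beta1 δ) : 0 < c1 δ β := by
  rw [c1]; rw [beta1] at *
  exact div_pos (by linarith) (mul_pos (by rw [beta0]; linarith) (by linarith))

lemma c1_lt_one (hβ0 : 0 < β) (hδ0 : 0 < δ) (hβ : β < beta1 δ) :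
    c1 δ β < 1 := by
  rw [c1]; rw [beta1] at *
  rw [div_lt_one (mul_pos (by rw [beta0]; linarith) (by linarith)), beta0]
  nlinarith [mul_pos hδ0 hβ0]

lemma c2_pos (hδ : δ < 1 / 16) (hβ : β < beta1 δ) : 0 < c2 δ β := by
  rw [c2]; rw [beta1] at *
  exact div_pos (by rw [beta0]; linarith) (by linarith)

lemma two_le_chi (hdA : 1 ≤ dA) (hdB : 2 ≤ dB) : 2 ≤ chi dA dB := by
  rw [chi]
  have h1 : 1 ≤ dB * (dA - 1) + 1 := by omega
  have h2 : 2 ≤ dA * (dB - 1) + 1 := by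
    have : 1 ≤ dA * (dB - 1) := Nat.mul_pos (by omega) (by omega)
    omega
  nlinarith

lemma eta_lt_one (hdA : 1 ≤ dA) (hdB : 2 ≤ dB) (hδ : δ < 1 / 16) (hβ0 : 0 < β) (hδ0 : 0 < δ)
    (hβ : β < beta1 δ) (hc : c2 δ β + 1 < c) : eta dA dB δ β c < 1 := by
  have h1 := c1_pos hβ0 hδ0 hβ
  have h2 := c2_pos hδ hβ
  have h3 := two_le_chi hdA hdB
  rw [eta]
  have : 0 < β * c1 δ β * (c - 1 - c2 δ β) / (dA * dB * chi dA dB * c) := by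
    refine div_pos (mul_pos (mul_pos hβ0 h1) (by linarith)) ?_
    have : (0 : ℝ) < dA := by exact_mod_cast hdA
    have : (0 : ℝ) < dB := by exact_mod_cast (by omega : 0 < dB)
    have : (0 : ℝ) < chi dA dB := by exact_mod_cast (by omega : 0 < chi dA dB)
    have : 0 < c := by linarith
    positivity
  linarith

/-- The subtracted fraction is at most 1/(d_A d_B χ), and d_A d_B χ ≥ 4. The lower bound is what
lets the rounded-down number of sweeps in `exists_le_of_decay` suffice. -/
lemma lt_eta (hdA : 1 ≤ dA) (hdB : 2 ≤ dB) (hδ : δ < 1 / 16) (hβ0 : 0 < β) (hδ0 : 0 < δ)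
    (hβ : β < beta1 δ) (hc : c2 δ β + 1 < c) : 3 / 4 ≤ eta dA dB δ β c := by
  have h1 := c1_pos hβ0 hδ0 hβ
  have h1' := c1_lt_one hβ0 hδ0 hβ
  have h2 := c2_pos hδ hβ
  have h3 : (2 : ℝ) ≤ chi dA dB := by exact_mod_cast two_le_chi hdA hdB
  have hA : (1 : ℝ) ≤ dA := by exact_mod_cast hdA
  have hB : (2 : ℝ) ≤ dB := by exact_mod_cast hdB
  have hβ1 : β < 1 := by rw [beta1] at hβ; linarith
  have hc0 : 0 < c := by linarith
  rw [eta]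
  have h4 : (4 : ℝ) ≤ dA * dB * chi dA dB := by
    have : (2 : ℝ) ≤ dA * dB := by nlinarith
    nlinarith
  have : β * c1 δ β * (c - 1 - c2 δ β) / (dA * dB * chi dA dB * c) ≤ 1 / 4 := by
    rw [div_le_iff₀ (by positivity)]
    have h5 : β * c1 δ β ≤ 1 := by nlinarith
    have h6 : β * c1 δ β * (c - 1 - c2 δ β) ≤ 1 * c := by
      apply mul_le_mul h5 (by linarith) (by linarith) (by norm_num)
    nlinarith
  linarith

/-- One block of rounds decreases the syndrome by the factor `η`. -/
lemma le_eta_mul (hdA : 1 ≤ dA) (hdB : 2 ≤ dB) (hδ : δ < 1 / 16) (hβ0 : 0 < β) (hδ0 : 0 < δ)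
    (hβ : β < beta1 δ) (hc : c2 δ β + 1 < c) {τ τ' s d d' N H : ℝ} (hτ : τ ≤ s + d)
    (hd : c * d < τ) (hdd : d' ≤ d)
    (hN : c1 δ β * (s - c2 δ β * d') ≤ dA * dB * N) (hNH : N ≤ chi dA dB * H)
    (hτ' : τ' + β * H ≤ τ) : τ' ≤ eta dA dB δ β c * τ := by
  have h1 := c1_pos hβ0 hδ0 hβ
  have h2 := c2_pos hδ hβ
  have hA : (0 : ℝ) < dA := by exact_mod_cast hdA
  have hB : (0 : ℝ) < dB := by exact_mod_cast (by omega : 0 < dB)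
  have hX : (0 : ℝ) < chi dA dB := by
    exact_mod_cast (lt_of_lt_of_le (by norm_num) (two_le_chi hdA hdB) : 0 < chi dA dB)
  have hc0 : 0 < c := by linarith
  -- Since c d < τ, the s ≥ τ - d true violations satisfy c(s - c₂d) ≥ cτ - (1 + c₂)τ.
  have h3 : τ * (c - 1 - c2 δ β) ≤ c * (s - c2 δ β * d') := by
    have e1 : c * (c2 δ β * d') ≤ c * (c2 δ β * d) :=
      mul_le_mul_of_nonneg_left (mul_le_mul_of_nonneg_left hdd h2.le) hc0.le
    nlinarith [mul_le_mul_of_nonneg_left hd.le (by linarith : 0 ≤ 1 + c2 δ β),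
      mul_le_mul_of_nonneg_left hτ hc0.le]
  have h4 : c1 δ β * (s - c2 δ β * d') ≤ dA * dB * chi dA dB * H := by
    refine hN.trans ?_
    rw [mul_assoc (dA * dB : ℝ)]
    exact mul_le_mul_of_nonneg_left hNH (by positivity)
  have h5 : c1 δ β * (τ * (c - 1 - c2 δ β)) ≤ dA * dB * chi dA dB * c * H := by
    nlinarith [mul_le_mul_of_nonneg_left h3 h1.le, mul_le_mul_of_nonneg_left h4 hc0.le]
  have h6 : β * c1 δ β * (c - 1 - c2 δ β) / (dA * dB * chi dA dB * c) * τ ≤ β * H := by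
    rw [div_mul_eq_mul_div, div_le_iff₀ (by positivity)]
    nlinarith [mul_le_mul_of_nonneg_left h5 hβ0.le]
  rw [eta]
  linarith

/-- A sequence of integers that decreases by the factor `η` as long as it exceeds `t` falls below
`t` within `⌊log_{1/η} s⌋` steps. -/
lemma exists_le_of_decay {η t : ℝ} (hη : 3 / 4 ≤ η) (hη1 : η < 1) (ht : 0 ≤ t) {s : ℕ} (hs : 2 ≤ s)
    (a : ℕ → ℕ) (ha0 : a 0 ≤ s)
    (hstep : ∀ j < ⌊Real.logb (1 / η) s⌋₊, t < a j → (a (j + 1) : ℝ) ≤ η * a j) :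
    ∃ j ≤ ⌊Real.logb (1 / η) s⌋₊, (a j : ℝ) ≤ t := by
  by_contra! hall
  set m := ⌊Real.logb (1 / η) s⌋₊ with hm
  have hη0 : 0 < η := by linarith
  have hb : 1 < 1 / η := by rw [lt_div_iff₀ hη0]; linarith
  have hs0 : (0 : ℝ) < s := by exact_mod_cast (by omega : 0 < s)
  have hm1 : 1 ≤ m := by
    rw [hm, Nat.one_le_floor_iff, Real.le_logb_iff_rpow_le hb hs0, Real.rpow_one,
      div_le_iff₀ hη0]
    have : (2 : ℝ) ≤ s := by exact_mod_cast hs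
    nlinarith
  have hdec : ∀ j ≤ m, (a j : ℝ) ≤ η ^ j * a 0 := by
    intro j
    induction j with
    | zero => intro _; simp
    | succ j ih =>
      intro hj
      have h1 := hstep j (by omega) (hall j (by omega))
      have h2 := ih (by omega)
      rw [pow_succ']
      nlinarith
  have hpos : 1 ≤ a m := by
    have := ht.trans_lt (hall m le_rfl)
    exact_mod_cast this
  obtain ⟨k, hk⟩ := Nat.exists_eq_add_of_le' hm1
  -- Integrality gives the last step: a value at least 1 after a strict decrease comes from a value
  -- at least 2.
  have h2 : 2 ≤ a k := by
    have h1 := hstep k (by omega) (hall k (by omega))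
    rw [← hk] at h1
    have h3 : (1 : ℝ) ≤ a m := by exact_mod_cast hpos
    have h4 : (1 : ℝ) < a k := by
      have : (0 : ℝ) ≤ a k := Nat.cast_nonneg _
      nlinarith
    exact_mod_cast h4
  have h5 := hdec k (by omega)
  have h6 : (s : ℝ) < (1 / η) ^ (m + 1) := by
    have := Nat.lt_floor_add_one (Real.logb (1 / η) s)
    rw [← hm, Real.logb_lt_iff_lt_rpow hb hs0] at this
    exact_mod_cast this
  have h7 : η ^ (m + 1) * s < 1 := by
    have : η ^ (m + 1) * (1 / η) ^ (m + 1) = 1 := by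
      rw [← mul_pow, mul_one_div_cancel hη0.ne', one_pow]
    calc η ^ (m + 1) * s < η ^ (m + 1) * (1 / η) ^ (m + 1) :=
          mul_lt_mul_of_pos_left h6 (by positivity)
      _ = 1 := this
  have h8 : (2 : ℝ) ≤ η ^ k * s := by
    have e1 : (2 : ℝ) ≤ a k := by exact_mod_cast h2
    have e2 : (a 0 : ℝ) ≤ s := by exact_mod_cast ha0
    have := mul_le_mul_of_nonneg_left e2 (by positivity : 0 ≤ η ^ k)
    linarith
  -- As `m = k + 1`, this product is at least 2η² ≥ 9/8, although it was shown to be less than 1.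
  have h9 : η ^ (m + 1) * s = η ^ 2 * (η ^ k * s) := by rw [hk]; ring
  rw [h9] at h7
  nlinarith

end Constants

/-! ### Decay of the syndrome of a small component -/

section Decay

variable {A B : Type*} [Fintype A] [DecidableEq A] [Fintype B] [DecidableEq B]
  {G : A → B → Prop} [DecidableRel G] {dA dB : ℕ} {γ δ β c : ℝ}
  {color : CheckZ A B → Fin (chi dA dB)} {f : ℕ}
  {E : Finset (Qubit A B)} {D : Finset (CheckX A B)} {R : ℕ → Finset (Qubit A B)}
  {Fg : ℕ → CheckZ A B → Finset (Qubit A B)} {U K : Finset (Qubit A B)}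

lemma card_mul_eq (hG : IsBiregular G dA dB) :
    dA * Fintype.card A = dB * Fintype.card B := by
  have := Finset.sum_card_bipartiteAbove_eq_sum_card_bipartiteBelow (s := Finset.univ)
    (t := Finset.univ) G
  have e1 : ∀ a, (Finset.bipartiteAbove G Finset.univ a).card = dA := hG.1
  have e2 : ∀ b, (Finset.bipartiteBelow G Finset.univ b).card = dB := hG.2
  simp only [e1, e2, Finset.sum_const, smul_eq_mul, Finset.card_univ] at this
  linarith

lemma card_B_le_card_A (hG : IsBiregular G dA dB) (hdA : 1 ≤ dA) (hdAB : dA ≤ dB) :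
    Fintype.card B ≤ Fintype.card A := by
  have h := card_mul_eq hG
  have h2 : dA * Fintype.card B ≤ dA * Fintype.card A := by
    rw [h]; exact Nat.mul_le_mul_right _ hdAB
  exact Nat.le_of_mul_le_mul_left h2 hdA

lemma le_gamma_card_A (hG : IsBiregular G dA dB) (hdA : 1 ≤ dA) (hdAB : dA ≤ dB) (hγ : 0 < γ)
    {x : ℝ} (hx : x ≤ γ * Fintype.card B) : x ≤ γ * Fintype.card A :=
  hx.trans (mul_le_mul_of_nonneg_left (by exact_mod_cast card_B_le_card_A hG hdA hdAB) hγ.le)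

/-- The residual error of a component can be replaced by a locally reduced one. -/
lemma IsRun.exists_reduced (h : IsRun G dA β color f E D R Fg) (hG : IsBiregular G dA dB)
    (hU : runSupport f E Fg ⊆ U) (hmaj : MajorityClosed G dA dB U)
    (hK : Saturated (Touch G) U K) {k : ℕ} (hk : k ≤ f) :
    ∃ e, e ⊆ K ∧ LocallyReduced G dA dB e ∧
      syndrome G e \ noisySyndrome G D (R k) ⊆ D ∩ nbrX G K ∧
      noisySyndrome G D (R k) ∩ nbrX G K ⊆ syndrome G e ∪ (D ∩ nbrX G K) := by
  have hRU := (h.residual_subset hk).trans hU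
  obtain ⟨e, heU, hred, heq⟩ := exists_locallyReduced hmaj hG hRU
  have hs : syndrome G (e ∩ K) = syndrome G (R k) ∩ nbrX G K := by
    rw [hK.syndrome_inter heU, heq.syndrome_eq]
  refine ⟨e ∩ K, Finset.inter_subset_right, hred.mono Finset.inter_subset_left, ?_, ?_⟩
  · rw [hs]
    intro x
    simp only [noisySyndrome, Finset.mem_inter, Finset.mem_sdiff, Finset.mem_symmDiff]
    tauto
  · rw [hs]
    intro x
    simp only [noisySyndrome, Finset.mem_inter, Finset.mem_union, Finset.mem_symmDiff]
    tauto

/-- The number of flippable generators is bounded below by `card_flippable`, applied to a reduced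
residual error of the component, and above by χ times the flips of the sweep. Comparing these with
the decrease paid for by the flips gives the factor η. -/
lemma IsRun.block_decay (h : IsRun G dA β color f E D R Fg) (hG : IsBiregular G dA dB)
    (hX : IsExpanding G dA dB γ δ) (hγ : 0 < γ)
    (hdA : 1 ≤ dA) (hdAB : dA ≤ dB) (hdB : 2 ≤ dB) (hδ0 : 0 < δ) (hδ : δ < 1 / 16)
    (hβ0 : 0 < β) (hβ : β < beta1 δ) (hc : c2 δ β + 1 < c) (hcol : IsGoodColoring G color)
    (hU : runSupport f E Fg ⊆ U) (hmaj : MajorityClosed G dA dB U)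
    (hK : Saturated (Touch G) U K) (hsmall : (K.card : ℝ) ≤ γ * Fintype.card B)
    {k : ℕ} (hk : chi dA dB ∣ k) (hl : k + chi dA dB ≤ f)
    (hlarge : c * (D ∩ nbrX G K).card < (noisySyndrome G D (R k) ∩ nbrX G K).card) :
    ((noisySyndrome G D (R (k + chi dA dB)) ∩ nbrX G K).card : ℝ) ≤
      eta dA dB δ β c * (noisySyndrome G D (R k) ∩ nbrX G K).card := by
  obtain ⟨e, heK, hred, h1, h2⟩ := h.exists_reduced hG hU hmaj hK (k := k) (by omega)
  have heB : (e.card : ℝ) ≤ γ * Fintype.card B :=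
    le_trans (by exact_mod_cast Finset.card_le_card heK) hsmall
  have hN := card_flippable hG hX hdA hdAB hδ0 hδ hβ0 hβ (le_gamma_card_A hG hdA hdAB hγ heB) heB
    hred (noisySyndrome G D (R k))
  have hNH := h.ncard_flippable_le hG hdA (hdA.trans hdAB) hcol hU hK hk hl heK
  have hτ := h.card_add_sum_le hcol hU hK hl
  have hs := (Finset.card_le_card h2).trans (Finset.card_union_le _ _)
  have hd := Finset.card_le_card h1
  refine le_eta_mul hdA hdB hδ hβ0 hδ0 hβ hc (by exact_mod_cast hs) hlarge
    (by exact_mod_cast hd) hN (by exact_mod_cast hNH) hτ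

/-- There are no nonempty small sets if the graph is a union of stars. -/
lemma two_le_of_small (hG : IsBiregular G dA dB) (hX : IsExpanding G dA dB γ δ)
    (hγ : 0 < γ) (hδ : δ < 1 / 16) (hdA : 1 ≤ dA) (hdB : 2 ≤ dB)
    (hB : 1 ≤ γ * Fintype.card B) : 2 ≤ dA := by
  by_contra! hlt
  obtain rfl : dA = 1 := by omega
  have hBpos : 0 < Fintype.card B := by
    by_contra! h0
    have : Fintype.card B = 0 := by omega
    rw [this] at hB; norm_num at hB
  obtain ⟨b⟩ := Fintype.card_pos_iff.1 hBpos
  obtain ⟨S, hS, hcard⟩ := Finset.exists_subset_card_eq (s := nbrB G b) (n := 2)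
    (by rw [hG.2]; exact hdB)
  have hA : 2 * Fintype.card B ≤ Fintype.card A := by
    have := card_mul_eq hG
    rw [one_mul] at this
    rw [this]; exact Nat.mul_le_mul_right _ hdB
  have hA' : (2 : ℝ) * Fintype.card B ≤ Fintype.card A := by exact_mod_cast hA
  -- Two leaves of one star have a single common neighbour, less than the 2(1 - δ) required by
  -- expansion.
  have h1 := hX.1 S (by rw [hcard]; push_cast; nlinarith)
  have h2 : S.biUnion (nbrA G) ⊆ {b} := by
    refine Finset.biUnion_subset.2 fun a ha => ?_
    have hab : b ∈ nbrA G a := (mem_nbrA G).2 ((mem_nbrB G).1 (hS ha))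
    obtain ⟨b', hb'⟩ := Finset.card_eq_one.1 (hG.1 a)
    rw [hb'] at hab ⊢
    rw [Finset.mem_singleton] at hab
    rw [hab]
  have h3 : ((S.biUnion (nbrA G)).card : ℝ) ≤ 1 := by
    have := Finset.card_le_card h2
    rw [Finset.card_singleton] at this
    exact_mod_cast this
  rw [hcard] at h1
  push_cast at h1
  linarith

/-- After all the rounds the syndrome of a small component is at most `c` times the number of
syndrome errors in it. -/
lemma IsRun.card_final_le (hG : IsBiregular G dA dB)
    (hX : IsExpanding G dA dB γ δ) (hγ : 0 < γ)
    (hdA : 1 ≤ dA) (hdAB : dA ≤ dB) (hdB : 2 ≤ dB) (hδ0 : 0 < δ) (hδ : δ < 1 / 16)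
    (hβ0 : 0 < β) (hβ : β < beta1 δ) (hc : c2 δ β + 1 < c) (hcol : IsGoodColoring G color)
    (hf : f = f0 dA dB δ β c (noisySyndrome G D E).card)
    (h : IsRun G dA β color f E D R Fg)
    (hU : runSupport f E Fg ⊆ U) (hmaj : MajorityClosed G dA dB U)
    (hK : Saturated (Touch G) U K) (hsmall : (K.card : ℝ) ≤ γ * Fintype.card B) :
    ((noisySyndrome G D (R f) ∩ nbrX G K).card : ℝ) ≤ c * (D ∩ nbrX G K).card := by
  have hc2 := c2_pos hδ hβ
  have hanti := fun k l => h.card_antitone hβ0 hcol hU hK (k := k) (l := l)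
  have hs0 : (noisySyndrome G D (R 0) ∩ nbrX G K).card ≤ (noisySyndrome G D E).card := by
    rw [h.zero]; exact Finset.card_le_card Finset.inter_subset_left
  set s := (noisySyndrome G D E).card with hs
  by_cases hs2 : 2 ≤ s
  · have hrounds : ∀ j ≤ ⌊Real.logb (1 / eta dA dB δ β c) s⌋₊, chi dA dB * j ≤ f := by
      intro j hj
      rw [hf, f0]
      have h0 : 0 ≤ Real.logb (1 / eta dA dB δ β c) s := by
        refine Real.logb_nonneg ?_ (by exact_mod_cast (by omega : 1 ≤ s))
        have h1 := lt_eta hdA hdB hδ hβ0 hδ0 hβ hc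
        have h2 := eta_lt_one hdA hdB hδ hβ0 hδ0 hβ hc
        rw [lt_div_iff₀ (by linarith)]; linarith
      have h3 : ((chi dA dB * j : ℕ) : ℝ) ≤
          (chi dA dB : ℝ) * Real.logb (1 / eta dA dB δ β c) s := by
        push_cast
        exact mul_le_mul_of_nonneg_left ((Nat.cast_le.2 hj).trans (Nat.floor_le h0))
          (Nat.cast_nonneg _)
      exact_mod_cast h3.trans (Nat.le_ceil _)
    have hstep : ∀ j < ⌊Real.logb (1 / eta dA dB δ β c) s⌋₊,
        c * ((D ∩ nbrX G K).card : ℝ) <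
          ((noisySyndrome G D (R (chi dA dB * j)) ∩ nbrX G K).card : ℕ) →
        (((noisySyndrome G D (R (chi dA dB * (j + 1))) ∩ nbrX G K).card : ℕ) : ℝ) ≤
          eta dA dB δ β c * ((noisySyndrome G D (R (chi dA dB * j)) ∩ nbrX G K).card : ℕ) :=
      fun j hj hlt => h.block_decay hG hX hγ hdA hdAB hdB hδ0 hδ hβ0 hβ hc hcol hU hmaj hK hsmall
        (Dvd.intro _ rfl) (hrounds (j + 1) hj) hlt
    obtain ⟨j, hj, hle⟩ := exists_le_of_decay (lt_eta hdA hdB hδ hβ0 hδ0 hβ hc)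
      (eta_lt_one hdA hdB hδ hβ0 hδ0 hβ hc)
      (t := c * (D ∩ nbrX G K).card) (mul_nonneg (by linarith) (Nat.cast_nonneg _)) hs2
      (fun j => (noisySyndrome G D (R (chi dA dB * j)) ∩ nbrX G K).card) (by simpa using hs0) hstep
    exact le_trans (by exact_mod_cast hanti _ _ (hrounds j hj) le_rfl) hle
  -- For s ≤ 1 there is no sweep to use, but at most one check is violated. One syndrome error in
  -- the component suffices because c > 1, so the case without any remains.
  · have h1 : (noisySyndrome G D (R f) ∩ nbrX G K).card ≤ 1 := by
      have := hanti 0 f (Nat.zero_le _) le_rfl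
      omega
    by_cases hd : (D ∩ nbrX G K).card = 0
    · rw [hd]
      by_contra! hlt
      have hone : (noisySyndrome G D (R f) ∩ nbrX G K).card = 1 := by
        have : 0 < (noisySyndrome G D (R f) ∩ nbrX G K).card := by
          have e : c * ((0 : ℕ) : ℝ) = 0 := by simp
          rw [e] at hlt; exact_mod_cast hlt
        omega
      obtain ⟨e, heK, hred, h2, h3⟩ := h.exists_reduced hG hU hmaj hK (k := f) le_rfl
      rw [Finset.card_eq_zero] at hd
      rw [hd] at h2 h3
      rw [Finset.union_empty] at h3
      have heB : (e.card : ℝ) ≤ γ * Fintype.card B :=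
        le_trans (by exact_mod_cast Finset.card_le_card heK) hsmall
      have hN := card_flippable hG hX hdA hdAB hδ0 hδ hβ0 hβ
        (le_gamma_card_A hG hdA hdAB hγ heB) heB hred (noisySyndrome G D (R f))
      rw [Finset.subset_empty.1 h2, Finset.card_empty, Nat.cast_zero, mul_zero, sub_zero] at hN
      have hse : (1 : ℝ) ≤ (syndrome G e).card := by
        have := Finset.card_le_card h3
        rw [hone] at this; exact_mod_cast this
      have hc1 := c1_pos hβ0 hδ0 hβ
      -- Without syndrome errors in the component the true syndrome is nonempty and fully visible,
      -- so a flip must exist. It decreases a one-check syndrome, which forces its own syndrome to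
      -- be a single check.
      have hne : (flippable G dA β (noisySyndrome G D (R f)) e).Nonempty := by
        by_contra hn
        rw [Set.not_nonempty_iff_eq_empty] at hn
        rw [hn, Set.ncard_empty] at hN
        norm_num at hN
        nlinarith
      obtain ⟨g, F, hFe, hF⟩ := hne
      have hpos := card_syndrome_pos_of_mem_candidates hdA hF.1
      have hdec := hF.2.2
      have hdec0 : 0 < decrease G (noisySyndrome G D (R f)) F := by
        have : (0 : ℝ) < decrease G (noisySyndrome G D (R f)) F :=
          lt_of_lt_of_le (mul_pos hβ0 (by exact_mod_cast hpos)) hdec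
        exact_mod_cast this
      rw [decrease_eq] at hdec0
      have hle : (noisySyndrome G D (R f) ∩ syndrome G F).card ≤ 1 := by
        rw [← hone]
        exact Finset.card_le_card (Finset.inter_subset_inter_left
          ((syndrome_subset_nbrX G F).trans (nbrX_mono G (hFe.trans heK))))
      have hKne : 1 ≤ K.card := by
        obtain ⟨v, hv⟩ := hF.1.1
        exact Finset.card_pos.2 ⟨v, heK (hFe hv)⟩
      have hdA2 := two_le_of_small hG hX hγ hδ hdA hdB
        (le_trans (by exact_mod_cast hKne) hsmall)
      exact card_syndrome_ne_one hG hdA2 hdB hF.2.1 (by omega)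
    · have hd1 : (1 : ℝ) ≤ (D ∩ nbrX G K).card := by
        exact_mod_cast Nat.one_le_iff_ne_zero.2 hd
      have h1' : ((noisySyndrome G D (R f) ∩ nbrX G K).card : ℝ) ≤ 1 := by exact_mod_cast h1
      nlinarith

end Decay

end QExpander

namespace QExpander

/-! ### Closing the run under majorities -/

section Closure

variable {A B : Type*} [Fintype A] [DecidableEq A] [Fintype B] [DecidableEq B]
  {G : A → B → Prop} [DecidableRel G] {dA dB : ℕ} {γ δ β c : ℝ}

/-- A bound on the number of qubits that touch a given qubit. -/
def touchDegree (dA dB : ℕ) : ℕ := 2 * (dB * (dA + dB))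

lemma card_gammaX_le (hG : IsBiregular G dA dB) (hdAB : dA ≤ dB) (v : Qubit A B) :
    (gammaX G v).card ≤ dB := by
  rcases v with ⟨α, a⟩ | ⟨b, β⟩
  · rw [card_gammaX_inl hG]; exact hdAB
  · rw [card_gammaX_inr hG]

lemma one_le_card_gammaX (hG : IsBiregular G dA dB) (hdA : 1 ≤ dA) (hdAB : dA ≤ dB)
    (v : Qubit A B) : 1 ≤ (gammaX G v).card := by
  rcases v with ⟨α, a⟩ | ⟨b, β⟩
  · rw [card_gammaX_inl hG]; exact hdA
  · rw [card_gammaX_inr hG]; omega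

lemma card_generators_le (hG : IsBiregular G dA dB) (hdAB : dA ≤ dB) (v : Qubit A B) :
    (Finset.univ.filter fun g : CheckZ A B => v ∈ gammaZ G g).card ≤ dB := by
  rcases v with ⟨α, a⟩ | ⟨b, β⟩
  · refine le_trans (Finset.card_le_card (t := (nbrA G α).image fun b => (b, a)) ?_)
      (Finset.card_image_le.trans (by rw [hG.1]; exact hdAB))
    intro g hg
    have := (inl_mem_gammaZ G).1 (Finset.mem_filter.1 hg).2
    exact Finset.mem_image.2 ⟨g.1, (mem_nbrA G).2 this.2, by rw [this.1]⟩
  · refine le_trans (Finset.card_le_card (t := (nbrB G β).image fun a => (b, a)) ?_)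
      (Finset.card_image_le.trans (by rw [hG.2]))
    intro g hg
    have := (inr_mem_gammaZ G).1 (Finset.mem_filter.1 hg).2
    exact Finset.mem_image.2 ⟨g.2, (mem_nbrB G).2 this.2, by rw [this.1]⟩

open Classical in
lemma card_touch_le (hG : IsBiregular G dA dB) (hdAB : dA ≤ dB) (v : Qubit A B) :
    (Finset.univ.filter fun w => Touch G v w).card ≤ touchDegree dA dB := by
  have hsub : (Finset.univ.filter fun w => Touch G v w) ⊆
      ((gammaX G v).biUnion fun x => Finset.univ.filter fun w => x ∈ gammaX G w) ∪
      ((Finset.univ.filter fun g => v ∈ gammaZ G g).biUnion fun g => gammaZ G g) := by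
    intro w hw
    rcases (Finset.mem_filter.1 hw).2 with ⟨x, h1, h2⟩ | ⟨g, h1, h2⟩
    · exact Finset.mem_union_left _ (Finset.mem_biUnion.2 ⟨x, h1,
        Finset.mem_filter.2 ⟨Finset.mem_univ _, h2⟩⟩)
    · exact Finset.mem_union_right _ (Finset.mem_biUnion.2 ⟨g,
        Finset.mem_filter.2 ⟨Finset.mem_univ _, h1⟩, h2⟩)
  have hcol : ∀ x : CheckX A B,
      (Finset.univ.filter fun w : Qubit A B => x ∈ gammaX G w).card ≤ dA + dB := by
    intro x
    have hs : (Finset.univ.filter fun w : Qubit A B => x ∈ gammaX G w) ⊆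
        ((nbrB G x.2).image fun a => (Sum.inl (x.1, a) : Qubit A B)) ∪
        ((nbrA G x.1).image fun b => (Sum.inr (b, x.2) : Qubit A B)) := by
      intro w hw
      have hw := (Finset.mem_filter.1 hw).2
      rcases w with ⟨α, a⟩ | ⟨b, β⟩
      · rw [mem_gammaX_inl] at hw
        exact Finset.mem_union_left _ (Finset.mem_image.2 ⟨a, (mem_nbrB G).2 hw.2, by rw [hw.1]⟩)
      · rw [mem_gammaX_inr] at hw
        exact Finset.mem_union_right _ (Finset.mem_image.2 ⟨b, (mem_nbrA G).2 hw.2, by rw [hw.1]⟩)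
    refine (Finset.card_le_card hs).trans ((Finset.card_union_le _ _).trans ?_)
    rw [add_comm dA]
    refine Nat.add_le_add (Finset.card_image_le.trans ?_) (Finset.card_image_le.trans ?_)
    · rw [hG.2]
    · rw [hG.1]
  refine (Finset.card_le_card hsub).trans ((Finset.card_union_le _ _).trans ?_)
  rw [touchDegree, two_mul]
  refine Nat.add_le_add ?_ ?_
  · exact (Finset.card_biUnion_le_card_mul _ _ _ fun x _ => hcol x).trans
      (Nat.mul_le_mul_right _ (card_gammaX_le hG hdAB v))
  · exact (Finset.card_biUnion_le_card_mul _ _ _ fun g _ => (card_gammaZ hG g).le).trans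
      (Nat.mul_le_mul_right _ (card_generators_le hG hdAB v))

/-- Small sets of qubits have many neighbours among the checks. -/
lemma mul_incidences_le (hG : IsBiregular G dA dB) (hX : IsExpanding G dA dB γ δ)
    {K : Finset (Qubit A B)} (hKA : (K.card : ℝ) ≤ γ * Fintype.card A)
    (hKB : (K.card : ℝ) ≤ γ * Fintype.card B) :
    (1 - δ) * incidences G K ≤ 2 * (nbrX G K).card := by
  set CA : A → Finset A := fun α => Finset.univ.filter fun a => Sum.inl (α, a) ∈ K with hCA
  set CB : B → Finset B := fun β => Finset.univ.filter fun b => Sum.inr (b, β) ∈ K with hCB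
  have hsA : ∑ α, (CA α).card = ∑ a, (rows K a).card := by
    simp only [hCA, rows, Finset.card_filter]; exact Finset.sum_comm
  have hsB : ∑ β, (CB β).card = ∑ b, (cols K b).card := by
    simp only [hCB, cols, Finset.card_filter]; exact Finset.sum_comm
  have hcard := card_qubits K
  -- Expansion is applied for each first coordinate `α` separately; the resulting checks have
  -- different first coordinates and do not overlap. The B² qubits are treated symmetrically, and
  -- adding the two bounds costs the factor 2.
  have hA : (1 - δ) * (dA * (∑ a, (rows K a).card : ℕ)) ≤ (nbrX G K).card := by
    have h1 : ∑ α, ((CA α).biUnion (nbrA G)).card ≤ (nbrX G K).card := by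
      rw [Finset.card_eq_sum_card_fiberwise (f := Prod.fst) (s := nbrX G K) (t := Finset.univ)
        fun _ _ => by simp]
      refine Finset.sum_le_sum fun α _ => ?_
      refine Finset.card_le_card_of_injOn (fun β => (α, β)) ?_ fun _ _ _ _ h => (Prod.ext_iff.1 h).2
      intro β hβ
      obtain ⟨a, ha, hab⟩ := Finset.mem_biUnion.1 hβ
      exact Finset.mem_coe.2 (Finset.mem_filter.2 ⟨(mem_nbrX G).2 ⟨_, (Finset.mem_filter.1 ha).2,
        (mem_gammaX_inl G).2 ⟨rfl, (mem_nbrA G).1 hab⟩⟩, rfl⟩)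
    have h2 : ∑ α, (1 - δ) * dA * ((CA α).card : ℝ) ≤
        ∑ α, (((CA α).biUnion (nbrA G)).card : ℝ) := by
      refine Finset.sum_le_sum fun α _ => hX.1 _ (le_trans ?_ hKA)
      have : (CA α).card ≤ ∑ α, (CA α).card :=
        Finset.single_le_sum (f := fun α => (CA α).card) (fun _ _ => Nat.zero_le _)
          (Finset.mem_univ α)
      exact_mod_cast (by omega : (CA α).card ≤ K.card)
    rw [← Finset.mul_sum] at h2
    rw [← hsA]
    push_cast
    have h1' := (Nat.cast_le (α := ℝ)).2 h1
    push_cast at h1'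
    linarith
  have hB : (1 - δ) * (dB * (∑ b, (cols K b).card : ℕ)) ≤ (nbrX G K).card := by
    have h1 : ∑ β, ((CB β).biUnion (nbrB G)).card ≤ (nbrX G K).card := by
      rw [Finset.card_eq_sum_card_fiberwise (f := Prod.snd) (s := nbrX G K) (t := Finset.univ)
        fun _ _ => by simp]
      refine Finset.sum_le_sum fun β _ => ?_
      refine Finset.card_le_card_of_injOn (fun α => (α, β)) ?_ fun _ _ _ _ h => (Prod.ext_iff.1 h).1
      intro α hα
      obtain ⟨b, hb, hab⟩ := Finset.mem_biUnion.1 hα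
      exact Finset.mem_coe.2 (Finset.mem_filter.2 ⟨(mem_nbrX G).2 ⟨_, (Finset.mem_filter.1 hb).2,
        (mem_gammaX_inr G).2 ⟨rfl, (mem_nbrB G).1 hab⟩⟩, rfl⟩)
    have h2 : ∑ β, (1 - δ) * dB * ((CB β).card : ℝ) ≤
        ∑ β, (((CB β).biUnion (nbrB G)).card : ℝ) := by
      refine Finset.sum_le_sum fun β _ => hX.2 _ (le_trans ?_ hKB)
      have : (CB β).card ≤ ∑ β, (CB β).card :=
        Finset.single_le_sum (f := fun β => (CB β).card) (fun _ _ => Nat.zero_le _)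
          (Finset.mem_univ β)
      exact_mod_cast (by omega : (CB β).card ≤ K.card)
    rw [← Finset.mul_sum] at h2
    rw [← hsB]
    push_cast
    have h1' := (Nat.cast_le (α := ℝ)).2 h1
    push_cast at h1'
    linarith
  rw [incidences_eq hG]
  push_cast at hA hB ⊢
  linarith

/-- The growth condition kept while `U₀` is closed under majorities. -/
def GrowthBound (G : A → B → Prop) [DecidableRel G] (U₀ U : Finset (Qubit A B)) : Prop :=
  ∀ K, Saturated (Touch G) U K → 3 * (nbrX G K).card ≤ incidences G K + 2 * incidences G (K ∩ U₀)

lemma card_nbrX_le_incidences (K : Finset (Qubit A B)) : (nbrX G K).card ≤ incidences G K :=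
  Finset.card_biUnion_le

lemma GrowthBound.refl (U₀ : Finset (Qubit A B)) : GrowthBound G U₀ U₀ := by
  intro K hK
  rw [Finset.inter_eq_left.2 hK.1]
  have := card_nbrX_le_incidences (G := G) K
  omega

/-- A new check must have both its row qubit and its column qubit among the added ones, so x added
row qubits and y added column qubits give at most xy new checks. The addition is less than half of
the generator, whence 3xy ≤ d_A x + d_B y, exactly the increase allowed. -/
lemma GrowthBound.union_gammaZ (hG : IsBiregular G dA dB) {U₀ U : Finset (Qubit A B)}
    (hU₀ : U₀ ⊆ U) (h : GrowthBound G U₀ U) {g : CheckZ A B}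
    (hg : dA + dB < 2 * (U ∩ gammaZ G g).card) : GrowthBound G U₀ (U ∪ gammaZ G g) := by
  intro K' hK'
  by_cases hdisj : ∃ v ∈ gammaZ G g, v ∈ K'
  · obtain ⟨v, hvg, hv⟩ := hdisj
    have hgK : gammaZ G g ⊆ K' := hK'.subset_of_mem Finset.subset_union_right
      (Finset.Subset.refl _) hv hvg
    set K := K' ∩ U with hKdef
    have hK : Saturated (Touch G) U K := hK'.inter_subset Finset.subset_union_left
    set M := gammaZ G g \ U with hM
    have hMg : M ⊆ gammaZ G g := Finset.sdiff_subset
    have hK'eq : K' = K ∪ M := by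
      ext w
      have h1 := @hgK w
      have h2 := @hK'.1 w
      simp only [hKdef, hM, Finset.mem_union, Finset.mem_inter, Finset.mem_sdiff] at *
      tauto
    have hdis : Disjoint K M := by
      rw [Finset.disjoint_left]
      intro w hw hw'
      exact (Finset.mem_sdiff.1 hw').2 (Finset.mem_inter.1 hw).2
    have hU₀K : K' ∩ U₀ = K ∩ U₀ := by
      rw [hKdef, Finset.inter_assoc, Finset.inter_eq_right.2 hU₀]
    have hinc : incidences G K' = incidences G K + incidences G M := by
      rw [hK'eq, incidences, Finset.sum_union hdis]; rfl
    have hnbr : (nbrX G K').card ≤ (nbrX G K).card + (rows M g.2).card * (cols M g.1).card := by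
      rw [← Finset.card_product]
      refine le_trans (Finset.card_le_card ?_) (Finset.card_union_le _ _)
      intro x hx
      rw [Finset.mem_union]
      by_contra! hn
      obtain ⟨w, hw, hxw⟩ := (mem_nbrX G).1 hx
      rw [hK'eq, Finset.mem_union] at hw
      rcases hw with hw | hw
      · exact hn.1 ((mem_nbrX G).2 ⟨w, hw, hxw⟩)
      · have hxg := (mem_grid G).1 (gammaX_subset_grid G (hMg hw) hxw)
        apply hn.2
        rw [Finset.mem_product, mem_rows, mem_cols]
        have hr : Sum.inl (x.1, g.2) ∈ gammaZ G g := (inl_mem_gammaZ G).2 ⟨rfl, hxg.1⟩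
        have hc : Sum.inr (g.1, x.2) ∈ gammaZ G g := (inr_mem_gammaZ G).2 ⟨rfl, hxg.2⟩
        refine ⟨Finset.mem_sdiff.2 ⟨hr, fun hU => hn.1 ?_⟩,
          Finset.mem_sdiff.2 ⟨hc, fun hU => hn.1 ?_⟩⟩
        · exact (mem_nbrX G).2 ⟨_, Finset.mem_inter.2 ⟨hgK hr, hU⟩,
            (mem_gammaX_inl G).2 ⟨rfl, hxg.2⟩⟩
        · exact (mem_nbrX G).2 ⟨_, Finset.mem_inter.2 ⟨hgK hc, hU⟩,
            (mem_gammaX_inr G).2 ⟨rfl, hxg.1⟩⟩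
    have hMcard : 2 * M.card < dA + dB := by
      have h1 := Finset.card_sdiff_add_card_inter (gammaZ G g) U
      rw [card_gammaZ hG, Finset.inter_comm, ← hM] at h1
      omega
    rw [card_of_subset_gammaZ hMg] at hMcard
    have hMinc := incidences_of_subset_gammaZ hG hMg
    have h1 := card_rows_le hG hMg
    have h2 := card_cols_le hG hMg
    have h3 := h K hK
    rw [hU₀K, hinc, hMinc]
    have h4 : 3 * ((rows M g.2).card * (cols M g.1).card) ≤
        dA * (rows M g.2).card + dB * (cols M g.1).card := by
      rcases (by omega : 2 * (rows M g.2).card ≤ dB ∨ 2 * (cols M g.1).card ≤ dA) with h5 | h5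
      · nlinarith [Nat.mul_le_mul_right (cols M g.1).card h5,
          Nat.mul_le_mul_right (rows M g.2).card h2]
      · nlinarith [Nat.mul_le_mul_right (rows M g.2).card h5,
          Nat.mul_le_mul_right (cols M g.1).card h1]
    omega
  · push Not at hdisj
    have hKU : K' ⊆ U := by
      intro w hw
      rcases Finset.mem_union.1 (hK'.1 hw) with h1 | h1
      · exact h1
      · exact absurd hw (hdisj w h1)
    refine h K' ⟨hKU, fun v hv w hw hvw => ?_⟩
    exact hK'.2 v hv w (Finset.mem_union_left _ hw) hvw

/-- Expansion makes |Γ_X(K)| at least (1 - δ)/2 times the number I of edges at `K`; with the growth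
bound, (1 - 3δ)I/2 is at most twice the number of edges at `K ∩ U₀`. As δ < 1/16, the factor 5 is
enough. -/
lemma card_le_of_growth (hG : IsBiregular G dA dB) (hX : IsExpanding G dA dB γ δ) (hγ : 0 < γ)
    (hdA : 1 ≤ dA) (hdAB : dA ≤ dB) (hδ : δ < 1 / 16) {U₀ K : Finset (Qubit A B)}
    (h : 3 * (nbrX G K).card ≤ incidences G K + 2 * incidences G (K ∩ U₀))
    (hsmall : (K.card : ℝ) ≤ γ * Fintype.card B) : (K.card : ℝ) ≤ 5 * dB * (K ∩ U₀).card := by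
  have h1 := mul_incidences_le hG hX (le_gamma_card_A hG hdA hdAB hγ hsmall) hsmall
  have h2 : K.card ≤ incidences G K := by
    rw [Finset.card_eq_sum_ones]
    exact Finset.sum_le_sum fun v _ => one_le_card_gammaX hG hdA hdAB v
  have h3 : incidences G (K ∩ U₀) ≤ dB * (K ∩ U₀).card := by
    rw [mul_comm, ← smul_eq_mul]
    exact Finset.sum_le_card_nsmul _ _ _ fun v _ => card_gammaX_le hG hdAB v
  have h' := (Nat.cast_le (α := ℝ)).2 h
  have h2' := (Nat.cast_le (α := ℝ)).2 h2
  have h3' := (Nat.cast_le (α := ℝ)).2 h3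
  push_cast at h' h2' h3'
  have : (0 : ℝ) ≤ incidences G K := Nat.cast_nonneg _
  nlinarith

/-- The errors `E`, `D` are dense enough in `W` to possibly form a component of a run. -/
def Dense (G : A → B → Prop) [DecidableRel G] (C : ℝ) (E : Finset (Qubit A B))
    (D : Finset (CheckX A B)) (W : Finset (Qubit A B)) : Prop :=
  (W.card : ℝ) ≤ C * ((E ∩ W).card + (D ∩ nbrX G W).card)

/-- All the connected sets in which the errors are dense have at most `m` elements. -/
def NoLargeCluster (G : A → B → Prop) [DecidableRel G] (C m : ℝ) (E : Finset (Qubit A B))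
    (D : Finset (CheckX A B)) : Prop :=
  ∀ v W, Rooted (Touch G) {v} W → Dense G C E D W → (W.card : ℝ) ≤ m

lemma dense_of_growth (hG : IsBiregular G dA dB) (hX : IsExpanding G dA dB γ δ) (hγ : 0 < γ)
    (hdA : 1 ≤ dA) (hdAB : dA ≤ dB) (hδ : δ < 1 / 16) {U₀ U K E : Finset (Qubit A B)}
    {D : Finset (CheckX A B)} {C : ℝ} (hC : 0 ≤ C) (hU₀U : U₀ ⊆ U)
    (h0 : ∀ K, Saturated (Touch G) U₀ K → Dense G C E D K)
    (hU : GrowthBound G U₀ U) (hK : Saturated (Touch G) U K)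
    (hsmall : (K.card : ℝ) ≤ γ * Fintype.card B) : Dense G (5 * dB * C) E D K := by
  have h1 := card_le_of_growth hG hX hγ hdA hdAB hδ (hU K hK) hsmall
  have h2 := h0 _ (hK.inter_subset hU₀U)
  have h3 : ((E ∩ (K ∩ U₀)).card : ℝ) ≤ (E ∩ K).card := by
    exact_mod_cast Finset.card_le_card (Finset.inter_subset_inter_left Finset.inter_subset_left)
  have h4 : ((D ∩ nbrX G (K ∩ U₀)).card : ℝ) ≤ (D ∩ nbrX G K).card := by
    exact_mod_cast Finset.card_le_card
      (Finset.inter_subset_inter_left (nbrX_mono G Finset.inter_subset_left))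
  have hB : (0 : ℝ) ≤ 5 * dB := by positivity
  rw [Dense] at *
  calc (K.card : ℝ) ≤ 5 * dB * (K ∩ U₀).card := h1
    _ ≤ 5 * dB * (C * ((E ∩ K).card + (D ∩ nbrX G K).card)) :=
      mul_le_mul_of_nonneg_left (h2.trans (mul_le_mul_of_nonneg_left (add_le_add h3 h4) hC)) hB
    _ = _ := by ring

/-- If the errors form no large cluster, then the closure of `U₀` under majorities has small
components. -/
lemma exists_majorityClosed (hG : IsBiregular G dA dB) (hX : IsExpanding G dA dB γ δ)
    (hγ : 0 < γ) (hdA : 1 ≤ dA) (hdAB : dA ≤ dB) (hδ : δ < 1 / 16)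
    {U₀ E : Finset (Qubit A B)} {D : Finset (CheckX A B)} {C m : ℝ} (hC : 0 ≤ C)
    (h0 : ∀ K, Saturated (Touch G) U₀ K → Dense G C E D K)
    (hm : (dA + dB) * (1 + touchDegree dA dB) * m ≤ γ * Fintype.card B)
    (hno : NoLargeCluster G (5 * dB * C) m E D) :
    ∃ U, U₀ ⊆ U ∧ MajorityClosed G dA dB U ∧ GrowthBound G U₀ U ∧
      ∀ v ∈ U, ((cluster (Touch G) U {v}).card : ℝ) ≤ m := by
  classical
  have hB1 : (1 : ℝ) ≤ dB := by exact_mod_cast hdA.trans hdAB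
  have hA1 : (1 : ℝ) ≤ dA := by exact_mod_cast hdA
  set Good : Finset (Finset (Qubit A B)) := Finset.univ.filter fun U =>
    U₀ ⊆ U ∧ GrowthBound G U₀ U ∧ ∀ v ∈ U, ((cluster (Touch G) U {v}).card : ℝ) ≤ m with hGood
  have hU₀Good : U₀ ∈ Good := by
    refine Finset.mem_filter.2 ⟨Finset.mem_univ _, Finset.Subset.refl _, GrowthBound.refl _,
      fun v hv => hno v _ (cluster_rooted (by simpa using hv)) ?_⟩
    have h1 := h0 _ (cluster_saturated (adj := Touch G) (U := U₀) (S := {v}))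
    refine h1.trans (mul_le_mul_of_nonneg_right ?_ (by positivity))
    nlinarith
  -- Maximality replaces an iterative closure: if `U` missed part of a majority generator, adding it
  -- would give a larger good set.
  obtain ⟨U, hU, hmax⟩ := Finset.exists_max_image Good Finset.card ⟨U₀, hU₀Good⟩
  obtain ⟨-, hU₀U, hgr, hcl⟩ := Finset.mem_filter.1 hU
  refine ⟨U, hU₀U, fun g hg => ?_, hgr, hcl⟩
  by_contra hgU
  set U' := U ∪ gammaZ G g with hU'
  have hlt : U.card < U'.card := Finset.card_lt_card
    ⟨Finset.subset_union_left, fun h => hgU (Finset.subset_union_right.trans h)⟩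
  refine absurd (hmax U' (Finset.mem_filter.2 ⟨Finset.mem_univ _,
    hU₀U.trans Finset.subset_union_left, hgr.union_gammaZ hG hU₀U hg, fun v hv => ?_⟩))
    (not_le.2 hlt)
  have hsymm : ∀ v w, Touch G v w → Touch G w v := fun _ _ h => h.symm
  obtain ⟨u, hu⟩ : (U ∩ gammaZ G g).Nonempty := by
    rw [← Finset.card_pos]; omega
  obtain ⟨huU, hug⟩ := Finset.mem_inter.1 hu
  have hm1 : 1 ≤ m := by
    refine le_trans ?_ (hcl u huU)
    exact_mod_cast Finset.card_pos.2 ⟨u, subset_cluster (by simpa using huU) (by simp)⟩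
  set K' := cluster (Touch G) U' {v} with hK'
  have hK'sat : Saturated (Touch G) U' K' := cluster_saturated
  by_cases hex : ∃ w ∈ gammaZ G g, w ∈ K'
  · obtain ⟨w, hwg, hwK⟩ := hex
    have hwU' : w ∈ U' := Finset.mem_union_right _ hwg
    refine hno v _ (cluster_rooted (by simpa using hv)) (dense_of_growth hG hX hγ hdA hdAB hδ hC
      (hU₀U.trans Finset.subset_union_left) h0 (hgr.union_gammaZ hG hU₀U hg) hK'sat (le_trans ?_ hm))
    -- The new component lies in the added generator together with the old components touching it.
    -- This rough bound only serves to make expansion applicable; density and the absence of large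
    -- clusters then bring the size back to at most `m`.
    set T := gammaZ G g ∪ (((gammaZ G g).biUnion fun z => Finset.univ.filter fun y =>
      Touch G z y).filter fun y => y ∈ U).biUnion fun y => cluster (Touch G) U {y} with hT
    have hTsub : T ⊆ U' := by
      refine Finset.union_subset Finset.subset_union_right (Finset.biUnion_subset.2 fun y _ => ?_)
      exact cluster_subset.trans Finset.subset_union_left
    have hTsat : Saturated (Touch G) U' T := by
      refine ⟨hTsub, fun y hy z hz hyz => ?_⟩
      by_cases hzg : z ∈ gammaZ G g
      · exact Finset.mem_union_left _ hzg
      · have hzU : z ∈ U := (Finset.mem_union.1 hz).resolve_right hzg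
        refine Finset.mem_union_right _ ?_
        rcases Finset.mem_union.1 hy with h1 | h1
        · exact Finset.mem_biUnion.2 ⟨z, Finset.mem_filter.2 ⟨Finset.mem_biUnion.2 ⟨y, h1,
            Finset.mem_filter.2 ⟨Finset.mem_univ _, hyz⟩⟩, hzU⟩,
            subset_cluster (by simpa using hzU) (by simp)⟩
        · obtain ⟨t, ht, hyt⟩ := Finset.mem_biUnion.1 h1
          exact Finset.mem_biUnion.2 ⟨t, ht, cluster_saturated.2 y hyt z hzU hyz⟩
    have hKT : K' ⊆ T := by
      rw [hK', ← cluster_eq_of_mem hsymm hv hwK]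
      exact cluster_subset_of_saturated hTsat 
        (Finset.singleton_subset_iff.2 (Finset.mem_union_left _ hwg))
    have hcardT : (T.card : ℝ) ≤ (dA + dB) + (dA + dB) * touchDegree dA dB * m := by
      refine (Nat.cast_le.2 (Finset.card_union_le _ _)).trans ?_
      rw [Nat.cast_add]
      refine add_le_add (by rw [card_gammaZ hG]; push_cast; rfl) ?_
      refine le_trans (Nat.cast_le.2 Finset.card_biUnion_le) ?_
      push_cast
      refine le_trans (Finset.sum_le_card_nsmul _ _ m fun y hy => hcl y (Finset.mem_filter.1 hy).2) ?_
      rw [nsmul_eq_mul]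
      refine mul_le_mul_of_nonneg_right ?_ (by linarith)
      have : ((gammaZ G g).biUnion fun z => Finset.univ.filter fun y => Touch G z y).card ≤
          (dA + dB) * touchDegree dA dB := by
        rw [← card_gammaZ hG g]
        exact Finset.card_biUnion_le_card_mul _ _ _ fun z _ => card_touch_le hG hdAB z
      exact_mod_cast (Finset.card_filter_le _ _).trans this
    have hKT' : (K'.card : ℝ) ≤ T.card := by exact_mod_cast Finset.card_le_card hKT
    have : (0 : ℝ) ≤ touchDegree dA dB := Nat.cast_nonneg _
    nlinarith
  · push Not at hex
    have hvU : v ∈ U := by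
      refine (Finset.mem_union.1 hv).resolve_right fun h => hex v h ?_
      exact subset_cluster (by simpa using hv) (by simp)
    have hsub : K' ⊆ cluster (Touch G) U {v} := by
      have hKU : K' ⊆ U := fun w hw =>
        (Finset.mem_union.1 (hK'sat.1 hw)).resolve_right fun h => hex w h hw
      have := (cluster_rooted (adj := Touch G) (U := U') (S := {v}) (by simpa using hv)).2
        (K' ∩ cluster (Touch G) U {v}) ⟨Finset.inter_subset_left, fun y hy z hz hyz => by
          rw [Finset.mem_inter] at hy ⊢
          exact ⟨hz, cluster_saturated.2 y hy.2 z (hKU hz) hyz⟩⟩ (by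
          rw [Finset.singleton_subset_iff, Finset.mem_inter]
          exact ⟨subset_cluster (by simpa using hv) (by simp),
            subset_cluster (by simpa using hvU) (by simp)⟩)
      rw [← hK'] at this
      rw [← this]; exact Finset.inter_subset_right
    exact le_trans (by exact_mod_cast Finset.card_le_card hsub) (hcl v hvU)

/-- The density constant of the components of a run. -/
noncomputable def clusterDensity (dA dB : ℕ) (β : ℝ) : ℝ := 5 * dB * (1 + 2 * dB / (dA * β))

/-- `(E, D)` explains that the residual error contains `S`. -/
def Witness (G : A → B → Prop) [DecidableRel G] (dA dB : ℕ) (β c : ℝ) (E : Finset (Qubit A B))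
    (D : Finset (CheckX A B)) (S W : Finset (Qubit A B)) : Prop :=
  Rooted (Touch G) S W ∧ Dense G (clusterDensity dA dB β) E D W ∧
    (S.card : ℝ) ≤ c3 dA β c * (D ∩ nbrX G W).card

/-- The deterministic heart of the first claim. Components of the majority closure of the run are
small, so the decay and the expansion bounds hold in each; the witness is the union of those that
meet `S`. -/
theorem exists_residual (hG : IsBiregular G dA dB) (hX : IsExpanding G dA dB γ δ)
    (hγ : 0 < γ) (hdA : 1 ≤ dA) (hdAB : dA ≤ dB) (hdB : 2 ≤ dB) (hδ0 : 0 < δ) (hδ : δ < 1 / 16)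
    (hβ0 : 0 < β) (hβ : β < beta1 δ) (hc : c2 δ β + 1 < c) {color : CheckZ A B → Fin (chi dA dB)}
    (hcol : IsGoodColoring G color) {m : ℝ}
    (hm : (dA + dB) * (1 + touchDegree dA dB) * m ≤ γ * Fintype.card B)
    {E Ehat : Finset (Qubit A B)} {D : Finset (CheckX A B)}
    (hno : NoLargeCluster G (clusterDensity dA dB β) m E D)
    (hout : IsParallelOutput G dA β color (f0 dA dB δ β c (noisySyndrome G D E).card)
      (noisySyndrome G D E) Ehat) :
    ∃ Els, Equivalent G Els (symmDiff E Ehat) ∧ ∀ S ⊆ Els, ∃ W, Witness G dA dB β c E D S W := by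
  obtain ⟨R, Fg, hrun, hRf⟩ := exists_isRun hout
  set f := f0 dA dB δ β c (noisySyndrome G D E).card with hf
  have hC0 : (0 : ℝ) ≤ 1 + 2 * dB / (dA * β) := by positivity
  obtain ⟨U, hU, hmaj, hgr, hcl⟩ := exists_majorityClosed hG hX hγ hdA hdAB hδ hC0
    (fun K hK => hrun.card_le_of_saturated hG hdA hdAB hβ0 hcol hK) hm hno
  have hRU := (hrun.residual_subset (le_refl f)).trans hU
  obtain ⟨Els, hElsU, hred, heq⟩ := exists_locallyReduced hmaj hG hRU
  refine ⟨Els, by rw [← hRf]; exact heq, fun S hS => ?_⟩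
  have hA1 : (1 : ℝ) ≤ dA := by exact_mod_cast hdA
  have hB1 : (1 : ℝ) ≤ dB := by exact_mod_cast hdA.trans hdAB
  have hc2 := c2_pos hδ hβ
  have hb1 : beta1 δ < beta0 δ := by rw [beta0, beta1]; linarith
  have hsymm : ∀ v w, Touch G v w → Touch G w v := fun _ _ h => h.symm
  -- Only single components are known to be small, so the two inequalities are proved for them and
  -- added up over disjoint unions.
  have hall : ∀ K, Saturated (Touch G) U K → Dense G (clusterDensity dA dB β) E D K ∧
      ((Els ∩ K).card : ℝ) ≤ c3 dA β c * (D ∩ nbrX G K).card := by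
    intro K hK
    have := hK
    revert this
    refine Saturated.induction (P := fun K => Saturated (Touch G) U K →
      Dense G (clusterDensity dA dB β) E D K ∧
      ((Els ∩ K).card : ℝ) ≤ c3 dA β c * (D ∩ nbrX G K).card) hsymm ?_ ?_ hK
    · intro _
      simp [Dense, nbrX]
    · intro v hv K hK hdis ih _
      obtain ⟨ih1, ih2⟩ := ih hK
      set Q := cluster (Touch G) U {v} with hQ
      have hQsat : Saturated (Touch G) U Q := cluster_saturated
      have hQm := hcl v hv
      have hQsmall : (Q.card : ℝ) ≤ γ * Fintype.card B := by
        have hm1 : (1 : ℝ) ≤ m := by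
          refine le_trans ?_ (hcl v hv)
          exact_mod_cast Finset.card_pos.2 ⟨v, subset_cluster (by simpa using hv) (by simp)⟩
        refine hQm.trans (le_trans ?_ hm)
        have h1 : (1 : ℝ) ≤ (dA + dB) * (1 + touchDegree dA dB) := by
          have : (0 : ℝ) ≤ touchDegree dA dB := Nat.cast_nonneg _
          nlinarith
        nlinarith
      have hQ1 : Dense G (clusterDensity dA dB β) E D Q :=
        dense_of_growth hG hX hγ hdA hdAB hδ hC0 hU
          (fun K hK => hrun.card_le_of_saturated hG hdA hdAB hβ0 hcol hK) hgr hQsat hQsmall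
      have hQ2 : ((Els ∩ Q).card : ℝ) ≤ c3 dA β c * (D ∩ nbrX G Q).card := by
        have h1 := IsRun.card_final_le hG hX hγ hdA hdAB hdB hδ0 hδ hβ0 hβ hc hcol hf hrun hU hmaj
          hQsat hQsmall
        have hs : syndrome G (Els ∩ Q) = syndrome G (R f) ∩ nbrX G Q := by
          rw [hQsat.syndrome_inter hElsU, heq.syndrome_eq]
        have heB : ((Els ∩ Q).card : ℝ) ≤ γ * Fintype.card B :=
          le_trans (by exact_mod_cast Finset.card_le_card Finset.inter_subset_right) hQsmall
        have h2 := card_le_card_syndrome hG hX hdA hdAB hδ0 hδ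
          (le_gamma_card_A hG hdA hdAB hγ heB) heB (hred.mono Finset.inter_subset_left)
        have h3 : (syndrome G (Els ∩ Q)).card ≤
            (noisySyndrome G D (R f) ∩ nbrX G Q).card + (D ∩ nbrX G Q).card := by
          refine le_trans (Finset.card_le_card ?_) (Finset.card_union_le _ _)
          rw [hs]
          intro x
          simp only [noisySyndrome, Finset.mem_inter, Finset.mem_union, Finset.mem_symmDiff]
          tauto
        have h3' := (Nat.cast_le (α := ℝ)).2 h3
        push_cast at h3'
        -- From β₀d_A|e| ≤ 2|σ_X(e)| ≤ 2(1 + c)|D| in the component, together with β < β₀, comes the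
        -- constant c₃.
        rw [c3, div_mul_eq_mul_div, le_div_iff₀ (by positivity)]
        have h4 : β * dA * ((Els ∩ Q).card : ℝ) ≤ beta0 δ * dA * (Els ∩ Q).card := by
          refine mul_le_mul_of_nonneg_right (mul_le_mul_of_nonneg_right ?_ (by linarith))
            (Nat.cast_nonneg _)
          linarith
        nlinarith
      have hd1 : Disjoint (nbrX G Q) (nbrX G K) := hK.disjoint_nbrX hQsat.1 hdis
      have e1 : (D ∩ nbrX G (Q ∪ K)).card = (D ∩ nbrX G Q).card + (D ∩ nbrX G K).card := by
        have : nbrX G (Q ∪ K) = nbrX G Q ∪ nbrX G K := Finset.union_biUnion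
        rw [this, Finset.inter_union_distrib_left]
        exact Finset.card_union_of_disjoint
          (hd1.mono Finset.inter_subset_right Finset.inter_subset_right)
      have e2 : ∀ X : Finset (Qubit A B), (X ∩ (Q ∪ K)).card = (X ∩ Q).card + (X ∩ K).card := by
        intro X
        rw [Finset.inter_union_distrib_left]
        exact Finset.card_union_of_disjoint
          (hdis.mono Finset.inter_subset_right Finset.inter_subset_right)
      have e3 : (Q ∪ K).card = Q.card + K.card := Finset.card_union_of_disjoint hdis
      rw [Dense] at *
      rw [e1, e2, e2, e3]
      push_cast
      constructor <;> linarith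
  have hSU := hS.trans hElsU
  obtain ⟨h1, h2⟩ := hall _ (cluster_saturated (adj := Touch G) (U := U) (S := S))
  refine ⟨cluster (Touch G) U S, cluster_rooted hSU, h1, le_trans ?_ h2⟩
  exact_mod_cast Finset.card_le_card (Finset.subset_inter hS (subset_cluster hSU))

end Closure

end QExpander

namespace QExpander

open MeasureTheory

/-! ### Percolation estimates and the choice of thresholds -/

section Probability

lemma measurableSet_preimage_of_finite {Ω T : Type*} [MeasurableSpace Ω] [Finite T] (X : Ω → T)
    (hX : ∀ t, MeasurableSet {ω | X ω = t}) (P : T → Prop) : MeasurableSet {ω | P (X ω)} := by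
  have : {ω | P (X ω)} = ⋃ t ∈ {t | P t}, {ω | X ω = t} := by
    ext ω; simp
  rw [this]
  exact MeasurableSet.biUnion (Set.to_countable _) fun t _ => hX t

lemma measurableSet_eq_prod {Ω T T' : Type*} [MeasurableSpace Ω] {X : Ω → T} {Y : Ω → T'}
    (hX : ∀ t, MeasurableSet {ω | X ω = t}) (hY : ∀ t, MeasurableSet {ω | Y ω = t}) (t : T × T') :
    MeasurableSet {ω | (X ω, Y ω) = t} := by
  have : {ω | (X ω, Y ω) = t} = {ω | X ω = t.1} ∩ {ω | Y ω = t.2} := by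
    ext ω; simp [Prod.ext_iff]
  rw [this]
  exact (hX _).inter (hY _)

/-- The weight of one pattern of errors that is dense in a set of size `w` and has at least
`n₀ / k` syndrome errors. -/
lemma pattern_weight_le {p q ρ C k : ℝ} (hp : 0 ≤ p) (hpρ : p ≤ ρ) (hq : 0 ≤ q) (hqρ : q ≤ ρ)
    (hρ0 : 0 < ρ) (hρ1 : ρ ≤ 1) (hC : 0 < C) (hk : 0 < k) {w i j n₀ : ℕ}
    (hw : (w : ℝ) ≤ C * (i + j)) (hn : (n₀ : ℝ) ≤ k * j) :
    p ^ i * q ^ j ≤ q ^ ((n₀ : ℝ) / k) * ρ ^ (-((n₀ : ℝ) / k)) * (ρ ^ (1 / C)) ^ w := by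
  set x := (n₀ : ℝ) / k with hx
  have hx0 : 0 ≤ x := by positivity
  have hxj : x ≤ j := by rw [hx, div_le_iff₀ hk]; linarith
  -- Only n₀/k factors `q` are kept; all the others, and every `p`, are replaced by `ρ`.
  have h1 : q ^ j = q ^ x * q ^ ((j : ℝ) - x) := by
    rw [← Real.rpow_add_of_nonneg hq hx0 (by linarith), ← Real.rpow_natCast]
    congr 1; ring
  have h2 : q ^ ((j : ℝ) - x) ≤ ρ ^ ((j : ℝ) - x) :=
    Real.rpow_le_rpow hq hqρ (by linarith)
  have h3 : p ^ i ≤ ρ ^ (i : ℝ) := by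
    rw [Real.rpow_natCast]; exact pow_le_pow_left₀ hp hpρ i
  have h4 : (ρ ^ (1 / C)) ^ w = ρ ^ ((w : ℝ) / C) := by
    rw [← Real.rpow_natCast, ← Real.rpow_mul hρ0.le]
    congr 1; ring
  have h5 : ρ ^ ((i : ℝ) + j) ≤ ρ ^ ((w : ℝ) / C) := by
    apply Real.rpow_le_rpow_of_exponent_ge hρ0 hρ1
    rw [div_le_iff₀ hC]; linarith
  have hqx : 0 ≤ q ^ x := Real.rpow_nonneg hq _
  calc p ^ i * q ^ j ≤ ρ ^ (i : ℝ) * (q ^ x * ρ ^ ((j : ℝ) - x)) := by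
        rw [h1]
        exact mul_le_mul h3 (mul_le_mul_of_nonneg_left h2 hqx)
          (mul_nonneg hqx (Real.rpow_nonneg hq _)) (Real.rpow_nonneg hρ0.le _)
    _ = q ^ x * ρ ^ (-x) * ρ ^ ((i : ℝ) + j) := by
        have : ρ ^ (i : ℝ) * ρ ^ ((j : ℝ) - x) = ρ ^ (-x) * ρ ^ ((i : ℝ) + j) := by
          rw [← Real.rpow_add hρ0, ← Real.rpow_add hρ0]; congr 1; ring
        linear_combination q ^ x * this
    _ ≤ _ := by
        rw [h4]
        exact mul_le_mul_of_nonneg_left h5 (mul_nonneg hqx (Real.rpow_nonneg hρ0.le _))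

variable {A B : Type*} [Fintype A] [DecidableEq A] [Fintype B] [DecidableEq B]
  {G : A → B → Prop} [DecidableRel G] {dA dB : ℕ}
  {Ω : Type*} [MeasurableSpace Ω] {μ : Measure Ω} [IsProbabilityMeasure μ]
  {E : Ω → Finset (Qubit A B)} {D : Ω → Finset (CheckX A B)}

/-- Union bound over the traces of `E` on `W` and of `D` on its checks, of which there are at most
2^((1 + d_B)|W|). -/
lemma measureReal_dense_le (hG : IsBiregular G dA dB) (hdAB : dA ≤ dB)
    {p q ρ C k : ℝ} (hp : 0 ≤ p) (hpρ : p ≤ ρ) (hq : 0 ≤ q) (hqρ : q ≤ ρ)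
    (hρ0 : 0 < ρ) (hρ1 : ρ ≤ 1) (hC : 0 < C) (hk : 0 < k)
    (hloc : IsLocalStochasticPair μ E D p q) (W : Finset (Qubit A B)) (n₀ : ℕ) :
    μ.real {ω | Dense G C (E ω) (D ω) W ∧ (n₀ : ℝ) ≤ k * (D ω ∩ nbrX G W).card} ≤
      q ^ ((n₀ : ℝ) / k) * ρ ^ (-((n₀ : ℝ) / k)) * (2 ^ (1 + dB) * ρ ^ (1 / C)) ^ W.card := by
  classical
  set I := (W.powerset ×ˢ (nbrX G W).powerset).filter fun P =>
    (W.card : ℝ) ≤ C * (P.1.card + P.2.card) ∧ (n₀ : ℝ) ≤ k * P.2.card with hI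
  set bound := q ^ ((n₀ : ℝ) / k) * ρ ^ (-((n₀ : ℝ) / k)) * (ρ ^ (1 / C)) ^ W.card with hb
  have hb0 : 0 ≤ bound := by positivity
  have hsub : {ω | Dense G C (E ω) (D ω) W ∧ (n₀ : ℝ) ≤ k * (D ω ∩ nbrX G W).card} ⊆
      ⋃ P ∈ I, {ω | P.1 ⊆ E ω ∧ P.2 ⊆ D ω} := by
    rintro ω ⟨h1, h2⟩
    refine Set.mem_biUnion (x := (E ω ∩ W, D ω ∩ nbrX G W)) ?_
      ⟨Finset.inter_subset_left, Finset.inter_subset_left⟩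
    exact Finset.mem_filter.2 ⟨Finset.mem_product.2
      ⟨Finset.mem_powerset.2 Finset.inter_subset_right,
        Finset.mem_powerset.2 Finset.inter_subset_right⟩, h1, h2⟩
  have hcard : (I.card : ℝ) ≤ (2 ^ (1 + dB)) ^ W.card := by
    have h1 : I.card ≤ 2 ^ W.card * 2 ^ (nbrX G W).card := by
      refine (Finset.card_filter_le _ _).trans ?_
      rw [Finset.card_product, Finset.card_powerset, Finset.card_powerset]
    have h2 : (nbrX G W).card ≤ W.card * dB :=
      Finset.card_biUnion_le_card_mul _ _ _ fun v _ => card_gammaX_le hG hdAB v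
    have h3 : I.card ≤ (2 ^ (1 + dB)) ^ W.card := by
      refine h1.trans ?_
      rw [← pow_add, ← pow_mul]
      exact Nat.pow_le_pow_right (by norm_num) (by nlinarith)
    exact_mod_cast h3
  calc μ.real _ ≤ μ.real (⋃ P ∈ I, {ω | P.1 ⊆ E ω ∧ P.2 ⊆ D ω}) := measureReal_mono hsub (measure_ne_top _ _)
    _ ≤ ∑ P ∈ I, μ.real {ω | P.1 ⊆ E ω ∧ P.2 ⊆ D ω} := measureReal_biUnion_finset_le _ _
    _ ≤ I.card • bound := Finset.sum_le_card_nsmul _ _ _ fun P hP => by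
        obtain ⟨-, h1, h2⟩ := Finset.mem_filter.1 hP
        exact (hloc P.1 P.2).trans (pattern_weight_le hp hpρ hq hqρ hρ0 hρ1 hC hk h1 h2)
    _ ≤ (2 ^ (1 + dB)) ^ W.card * bound := by
        rw [nsmul_eq_mul]; exact mul_le_mul_of_nonneg_right hcard hb0
    _ = _ := by rw [hb, mul_pow]; ring

/-- The union bound over all the sets rooted at `S`. -/
lemma measureReal_exists_rooted_le (hG : IsBiregular G dA dB) (hdA : 1 ≤ dA) (hdAB : dA ≤ dB)
    {p q C k ε : ℝ} (hε0 : 0 < ε) (hε1 : ε ≤ 1) (hC : 0 < C) (hk : 0 < k)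
    {ρ : ℝ} (hρ : ρ = (ε / 2 ^ (1 + dB + touchDegree dA dB)) ^ C)
    (hp : 0 ≤ p) (hpρ : p ≤ ρ) (hq : 0 ≤ q) (hqρ : q ≤ ρ)
    (hloc : IsLocalStochasticPair μ E D p q) (S : Finset (Qubit A B)) (n₀ : ℕ) {z : ℝ} :
    μ.real {ω | ∃ W, Rooted (Touch G) S W ∧ z ≤ W.card ∧ Dense G C (E ω) (D ω) W ∧
      (n₀ : ℝ) ≤ k * (D ω ∩ nbrX G W).card} ≤
      q ^ ((n₀ : ℝ) / k) * ρ ^ (-((n₀ : ℝ) / k)) * ε ^ z := by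
  classical
  set θ := ε / 2 ^ (1 + dB + touchDegree dA dB) with hθ
  have hθ0 : 0 < θ := by positivity
  have hθ1 : θ ≤ 1 := by
    rw [hθ, div_le_one (by positivity)]
    exact hε1.trans (one_le_pow₀ (by norm_num))
  have hρ0 : 0 < ρ := by rw [hρ]; positivity
  have hρ1 : ρ ≤ 1 := by rw [hρ]; exact Real.rpow_le_one hθ0.le hθ1 hC.le
  have hρθ : ρ ^ (1 / C) = θ := by
    rw [hρ, ← Real.rpow_mul hθ0.le, mul_one_div_cancel hC.ne', Real.rpow_one]
  set I := (Finset.univ.filter (Rooted (Touch G) S)).filter fun W => z ≤ (W.card : ℝ) with hI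
  set pre := q ^ ((n₀ : ℝ) / k) * ρ ^ (-((n₀ : ℝ) / k)) with hpre
  have hpre0 : 0 ≤ pre := by positivity
  have hsub : {ω | ∃ W, Rooted (Touch G) S W ∧ z ≤ W.card ∧ Dense G C (E ω) (D ω) W ∧
      (n₀ : ℝ) ≤ k * (D ω ∩ nbrX G W).card} ⊆ ⋃ W ∈ I, {ω | Dense G C (E ω) (D ω) W ∧
        (n₀ : ℝ) ≤ k * (D ω ∩ nbrX G W).card} := by
    rintro ω ⟨W, h1, h2, h3⟩
    exact Set.mem_biUnion (x := W) (Finset.mem_filter.2 ⟨Finset.mem_filter.2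
      ⟨Finset.mem_univ _, h1⟩, h2⟩) h3
  have hterm : ∀ W ∈ I, μ.real {ω | Dense G C (E ω) (D ω) W ∧
      (n₀ : ℝ) ≤ k * (D ω ∩ nbrX G W).card} ≤
      pre * ε ^ z * ((1 : ℝ) / 2) ^ (touchDegree dA dB * W.card) := by
    intro W hW
    refine (measureReal_dense_le hG hdAB hp hpρ hq hqρ hρ0 hρ1 hC hk hloc W n₀).trans ?_
    rw [← hpre, mul_assoc pre]
    refine mul_le_mul_of_nonneg_left ?_ hpre0
    -- The threshold is chosen for this identity: it leaves 2^(-Δ) per qubit, Δ being `touchDegree`,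
    -- which `sum_rooted_le` can sum.
    have e1 : (2 : ℝ) ^ (1 + dB) * ρ ^ (1 / C) = ε * (1 / 2) ^ touchDegree dA dB := by
      rw [hρθ, hθ, pow_add 2 (1 + dB)]
      field_simp
      rw [← mul_pow]; norm_num
    rw [e1, mul_pow, ← pow_mul]
    refine mul_le_mul_of_nonneg_right ?_ (by positivity)
    rw [← Real.rpow_natCast]
    exact Real.rpow_le_rpow_of_exponent_ge hε0 hε1 (Finset.mem_filter.1 hW).2
  have hsum := sum_rooted_le (adj := Touch G) (Touch.refl hG hdA (hdA.trans hdAB))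
    (Δ := touchDegree dA dB) (fun v => card_touch_le hG hdAB v) S
  calc μ.real _ ≤ μ.real (⋃ W ∈ I, {ω | Dense G C (E ω) (D ω) W ∧
        (n₀ : ℝ) ≤ k * (D ω ∩ nbrX G W).card}) := measureReal_mono hsub (measure_ne_top _ _)
    _ ≤ ∑ W ∈ I, μ.real {ω | Dense G C (E ω) (D ω) W ∧
        (n₀ : ℝ) ≤ k * (D ω ∩ nbrX G W).card} := measureReal_biUnion_finset_le _ _
    _ ≤ ∑ W ∈ I, pre * ε ^ z * ((1 : ℝ) / 2) ^ (touchDegree dA dB * W.card) :=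
        Finset.sum_le_sum hterm
    _ ≤ pre * ε ^ z * 1 := by
        rw [← Finset.mul_sum]
        refine mul_le_mul_of_nonneg_left (le_trans ?_ hsum) (by positivity)
        exact Finset.sum_le_sum_of_subset_of_nonneg (Finset.filter_subset _ _)
          fun _ _ _ => by positivity
    _ = _ := mul_one _

/-- The ratio between `γ |B|` and the size of the clusters that are allowed. -/
noncomputable def clusterScale (dA dB : ℕ) (γ : ℝ) : ℝ :=
  (dA + dB) * (1 + touchDegree dA dB) / γ

/-- The number of qubits is at most this constant times the square of the cluster size. -/
noncomputable def sizeRatio (dA dB : ℕ) (γ : ℝ) : ℝ :=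
  max ((dB ^ 2 + 1) * clusterScale dA dB γ ^ 2) 1

/-- The weight per qubit in the union bound. -/
noncomputable def decayBase (dA dB : ℕ) (γ : ℝ) : ℝ := Real.exp (-3) / sizeRatio dA dB γ

/-- The threshold of the noise rates. -/
noncomputable def noiseThreshold (dA dB : ℕ) (γ β : ℝ) : ℝ :=
  (decayBase dA dB γ / 2 ^ (1 + dB + touchDegree dA dB)) ^ clusterDensity dA dB β

lemma one_le_sizeRatio (γ : ℝ) : 1 ≤ sizeRatio dA dB γ := le_max_right _ _

lemma decayBase_pos (γ : ℝ) : 0 < decayBase dA dB γ :=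
  div_pos (Real.exp_pos _) (lt_of_lt_of_le one_pos (one_le_sizeRatio γ))

lemma decayBase_le_one (γ : ℝ) : decayBase dA dB γ ≤ 1 := by
  rw [decayBase, div_le_one (lt_of_lt_of_le one_pos (one_le_sizeRatio γ))]
  exact (Real.exp_le_one_iff.2 (by norm_num)).trans (one_le_sizeRatio γ)

lemma noiseThreshold_pos (γ β : ℝ) : 0 < noiseThreshold dA dB γ β :=
  Real.rpow_pos_of_pos (div_pos (decayBase_pos γ) (by positivity)) _

lemma card_qubit_le (hG : IsBiregular G dA dB) (hdA : 1 ≤ dA) {γ : ℝ}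
    {z : ℝ} (hz : (Fintype.card B : ℝ) ≤ clusterScale dA dB γ * z) :
    (Fintype.card (Qubit A B) : ℝ) ≤ sizeRatio dA dB γ * z ^ 2 := by
  have h1 : Fintype.card A ≤ dB * Fintype.card B := by
    rw [← card_mul_eq hG]; exact Nat.le_mul_of_pos_left _ hdA
  have h2 : Fintype.card (Qubit A B) = Fintype.card A ^ 2 + Fintype.card B ^ 2 := by
    simp [Qubit, sq]
  have h3 : (Fintype.card (Qubit A B) : ℝ) ≤ (dB ^ 2 + 1) * (Fintype.card B : ℝ) ^ 2 := by
    rw [h2]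
    push_cast
    have h1' : (Fintype.card A : ℝ) ≤ dB * Fintype.card B := by exact_mod_cast h1
    have := pow_le_pow_left₀ (Nat.cast_nonneg (Fintype.card A)) h1' 2
    nlinarith
  have h4 := pow_le_pow_left₀ (Nat.cast_nonneg (Fintype.card B)) hz 2
  calc (Fintype.card (Qubit A B) : ℝ) ≤ (dB ^ 2 + 1) * (clusterScale dA dB γ * z) ^ 2 :=
        h3.trans (mul_le_mul_of_nonneg_left h4 (by positivity))
    _ = (dB ^ 2 + 1) * clusterScale dA dB γ ^ 2 * z ^ 2 := by ring
    _ ≤ _ := mul_le_mul_of_nonneg_right (le_max_left _ _) (sq_nonneg _)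

/-- The decay base e^(-3)/H is made for this: H ≤ H^z absorbs the constant, z² ≤ e^(2z) the
polynomial, and e^(-z) remains. -/
lemma mul_decayBase_rpow_le {γ n z : ℝ} (hz : 1 ≤ z) (hn : n ≤ sizeRatio dA dB γ * z ^ 2) :
    n * decayBase dA dB γ ^ z ≤ Real.exp (-z) := by
  set H := sizeRatio dA dB γ with hH
  have hH1 : 1 ≤ H := one_le_sizeRatio γ
  have hH0 : 0 < H := by linarith
  have h1 : decayBase dA dB γ ^ z = Real.exp (-3 * z) / H ^ z := by
    rw [decayBase, Real.div_rpow (Real.exp_pos _).le hH0.le, ← Real.exp_mul]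
  have h2 : H ≤ H ^ z := by
    conv_lhs => rw [← Real.rpow_one H]
    exact Real.rpow_le_rpow_of_exponent_le hH1 hz
  have h3 : z ^ 2 ≤ Real.exp (2 * z) := by
    have h4 : z ≤ Real.exp z := by linarith [Real.add_one_le_exp z]
    have h5 := pow_le_pow_left₀ (by linarith) h4 2
    rwa [← Real.exp_nat_mul] at h5
  have hHz : 0 < H ^ z := Real.rpow_pos_of_pos hH0 _
  have h6 : n ≤ H ^ z * Real.exp (2 * z) :=
    hn.trans (mul_le_mul h2 h3 (sq_nonneg _) hHz.le)
  calc n * decayBase dA dB γ ^ z ≤ H ^ z * Real.exp (2 * z) * (Real.exp (-3 * z) / H ^ z) := by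
        rw [h1]; exact mul_le_mul_of_nonneg_right h6 (by positivity)
    _ = Real.exp (2 * z) * Real.exp (-3 * z) := by field_simp
    _ = Real.exp (-z) := by rw [← Real.exp_add]; congr 1; ring

/-- The residual error of the parallel decoder is local stochastic. -/
theorem exists_localStochastic_residual {γ δ β c : ℝ} (hG : IsBiregular G dA dB)
    (hX : IsExpanding G dA dB γ δ) (hγ : 0 < γ) (hdA : 1 ≤ dA) (hdAB : dA ≤ dB) (hdB : 2 ≤ dB)
    (hδ0 : 0 < δ) (hδ : δ < 1 / 16) (hβ0 : 0 < β) (hβ : β < beta1 δ) (hc : c2 δ β + 1 < c)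
    {color : CheckZ A B → Fin (chi dA dB)} (hcol : IsGoodColoring G color)
    {Ehat : Ω → Finset (Qubit A B)} {p q : ℝ}
    (hE : IsRandomSet E) (hD : IsRandomSet D) (hEhat : IsRandomSet Ehat)
    (hp : 0 ≤ p) (hpρ : p < noiseThreshold dA dB γ β) (hq : 0 ≤ q)
    (hqρ : q < noiseThreshold dA dB γ β) (hloc : IsLocalStochasticPair μ E D p q)
    (hout : ∀ ω, IsParallelOutput G dA β color
      (f0 dA dB δ β c (noisySyndrome G (D ω) (E ω)).card) (noisySyndrome G (D ω) (E ω)) (Ehat ω)) :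
    ∃ succ : Set Ω, MeasurableSet succ ∧
      1 - Real.exp (-(1 / Real.sqrt (sizeRatio dA dB γ)) *
        Real.sqrt (Fintype.card (Qubit A B))) ≤ μ.real succ ∧
      ∃ Els : Ω → Finset (Qubit A B), IsRandomSet Els ∧
        (∀ ω, Equivalent G (Els ω) (symmDiff (E ω) (Ehat ω))) ∧
        IsLocalStochastic (ProbabilityTheory.cond μ succ) Els
          (2 * noiseThreshold dA dB γ β ^ (-(1 / c3 dA β c)) * q ^ (1 / c3 dA β c)) := by
  classical
  set ρ := noiseThreshold dA dB γ β with hρ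
  set ε := decayBase dA dB γ with hε
  set C := clusterDensity dA dB β with hC
  set H := sizeRatio dA dB γ with hH
  have hA1 : (1 : ℝ) ≤ dA := by exact_mod_cast hdA
  have hB1 : (1 : ℝ) ≤ dB := by exact_mod_cast hdA.trans hdAB
  have hc2 := c2_pos hδ hβ
  have hC0 : 0 < C := by rw [hC, clusterDensity]; positivity
  have hk : 0 < c3 dA β c := by
    rw [c3]; exact div_pos (by linarith) (by positivity)
  have hscale : 0 < clusterScale dA dB γ := by rw [clusterScale]; positivity
  set m := (Fintype.card B : ℝ) / clusterScale dA dB γ with hm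
  set z := max m 1 with hz
  have hz1 : 1 ≤ z := le_max_right _ _
  have hmγ : (dA + dB) * (1 + touchDegree dA dB) * m ≤ γ * Fintype.card B := by
    have : ((dA : ℝ) + dB) * (1 + touchDegree dA dB) = clusterScale dA dB γ * γ := by
      rw [clusterScale]; field_simp
    rw [this, hm]
    apply le_of_eq; field_simp
  have hBz : (Fintype.card B : ℝ) ≤ clusterScale dA dB γ * z := by
    calc (Fintype.card B : ℝ) = clusterScale dA dB γ * m := by rw [hm]; field_simp
      _ ≤ _ := mul_le_mul_of_nonneg_left (le_max_left _ _) hscale.le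
  have hn := card_qubit_le hG hdA hBz
  have hbase := mul_decayBase_rpow_le hz1 hn
  set succ : Set Ω := {ω | NoLargeCluster G C m (E ω) (D ω)} with hsucc
  have hmeas : MeasurableSet succ :=
    measurableSet_preimage_of_finite (fun ω => (E ω, D ω)) (measurableSet_eq_prod hE hD)
      fun P => NoLargeCluster G C m P.1 P.2
  have hfail : μ.real succᶜ ≤ Real.exp (-z) := by
    have hsub : succᶜ ⊆ ⋃ v ∈ (Finset.univ : Finset (Qubit A B)), {ω | ∃ W,
        Rooted (Touch G) {v} W ∧ z ≤ W.card ∧ Dense G C (E ω) (D ω) W ∧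
          ((0 : ℕ) : ℝ) ≤ c3 dA β c * (D ω ∩ nbrX G W).card} := by
      intro ω hω
      have hω : ¬ NoLargeCluster G C m (E ω) (D ω) := hω
      rw [NoLargeCluster] at hω
      push Not at hω
      obtain ⟨v, W, h1, h2, h3⟩ := hω
      refine Set.mem_biUnion (x := v) (Finset.mem_univ v) ⟨W, h1, ?_, h2, by
        rw [Nat.cast_zero]; positivity⟩
      refine max_le h3.le ?_
      exact_mod_cast Finset.card_pos.2 ⟨v, h1.1 (by simp)⟩
    calc μ.real succᶜ ≤ _ := measureReal_mono hsub (measure_ne_top _ _)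
      _ ≤ ∑ v : Qubit A B, _ := measureReal_biUnion_finset_le _ _
      _ ≤ ∑ _v : Qubit A B, ε ^ z := by
          refine Finset.sum_le_sum fun v _ => ?_
          have := measureReal_exists_rooted_le hG hdA hdAB (decayBase_pos γ) (decayBase_le_one γ)
            hC0 hk hρ hp hpρ.le hq hqρ.le hloc {v} 0 (z := z)
          simpa using this
      _ ≤ Real.exp (-z) := by
          rw [Finset.sum_const, nsmul_eq_mul, Finset.card_univ]; exact hbase
  have hprob : μ.real succ = 1 - μ.real succᶜ := by
    rw [probReal_compl_eq_one_sub hmeas]; ring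
  -- Conditioning on success costs at most a factor 2, which is at most 2^|S| and goes into the
  -- constant K.
  have hhalf : 1 / 2 ≤ μ.real succ := by
    have h1 : Real.exp (-z) ≤ Real.exp (-1) := Real.exp_le_exp.2 (by linarith)
    have h2 : Real.exp (-1) ≤ 1 / 2 := by
      rw [Real.exp_neg, inv_eq_one_div]
      apply one_div_le_one_div_of_le (by norm_num)
      have := Real.add_one_le_exp (1 : ℝ); linarith
    linarith
  set good : Finset (Qubit A B) × Finset (CheckX A B) × Finset (Qubit A B) →
      Finset (Qubit A B) → Prop := fun P els => Equivalent G els (symmDiff P.1 P.2.2) ∧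
        ∀ S ⊆ els, ∃ W, Witness G dA dB β c P.1 P.2.1 S W with hgood
  -- A fixed function of the triple `(E, D, Ehat)`, whose values are finitely many, so that the
  -- result is a random set. The default value off the good cases keeps the equivalence valid on
  -- every outcome.
  set choice : Finset (Qubit A B) × Finset (CheckX A B) × Finset (Qubit A B) →
      Finset (Qubit A B) := fun P =>
        if h : ∃ els, good P els then h.choose else symmDiff P.1 P.2.2 with hchoice
  refine ⟨succ, hmeas, ?_, fun ω => choice (E ω, D ω, Ehat ω), ?_, ?_, ?_⟩
  · have hHpos : 0 < H := lt_of_lt_of_le one_pos (one_le_sizeRatio γ)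
    have h1 : Real.sqrt (Fintype.card (Qubit A B)) ≤ Real.sqrt H * z := by
      rw [← Real.sqrt_sq (by linarith : 0 ≤ z), ← Real.sqrt_mul hHpos.le]
      exact Real.sqrt_le_sqrt hn
    have h2 : Real.exp (-z) ≤ Real.exp (-(1 / Real.sqrt H) *
        Real.sqrt (Fintype.card (Qubit A B))) := by
      apply Real.exp_le_exp.2
      have hs : 0 < Real.sqrt H := Real.sqrt_pos.2 hHpos
      have : 1 / Real.sqrt H * Real.sqrt (Fintype.card (Qubit A B)) ≤ z := by
        rw [one_div_mul_eq_div, div_le_iff₀ hs]; linarith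
      linarith
    linarith
  · intro S
    exact measurableSet_preimage_of_finite (fun ω => (E ω, D ω, Ehat ω))
      (measurableSet_eq_prod hE (measurableSet_eq_prod hD hEhat)) fun P => choice P = S
  · intro ω
    simp only [hchoice]
    split_ifs with h
    · exact h.choose_spec.1
    · exact Equivalent.refl _
  · intro S
    have hq0 : 0 ≤ q ^ (1 / c3 dA β c) := Real.rpow_nonneg hq _
    have hρ0 : 0 < ρ := noiseThreshold_pos γ β
    rcases S.eq_empty_or_nonempty with rfl | hS
    · simp
    · rw [measureReal_def, ProbabilityTheory.cond_apply hmeas, ENNReal.toReal_mul,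
        ENNReal.toReal_inv, ← measureReal_def, ← measureReal_def]
      have hev : μ.real (succ ∩ {ω | S ⊆ choice (E ω, D ω, Ehat ω)}) ≤
          q ^ ((S.card : ℝ) / c3 dA β c) * ρ ^ (-((S.card : ℝ) / c3 dA β c)) := by
        -- The same union bound, now rooted at `S` and without a size constraint, asks for at least
        -- |S|/c₃ syndrome errors.
        have h1 := measureReal_exists_rooted_le hG hdA hdAB (decayBase_pos γ) (decayBase_le_one γ)
            hC0 hk hρ hp hpρ.le hq hqρ.le hloc S S.card (z := 0)
        rw [Real.rpow_zero, mul_one] at h1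
        refine le_trans (measureReal_mono ?_) h1
        rintro ω ⟨hω, hSω⟩
        have hex : ∃ els, good (E ω, D ω, Ehat ω) els :=
          exists_residual hG hX hγ hdA hdAB hdB hδ0 hδ hβ0 hβ hc hcol hmγ hω (hout ω)
        have hSω : S ⊆ choice (E ω, D ω, Ehat ω) := hSω
        simp only [hchoice, dif_pos hex] at hSω
        obtain ⟨W, h2, h3, h4⟩ := hex.choose_spec.2 S hSω
        exact ⟨W, h2, Nat.cast_nonneg _, h3, h4⟩
      have hinv : (μ.real succ)⁻¹ ≤ 2 := by
        rw [inv_le_comm₀ (by linarith) (by norm_num)]; linarith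
      have e1 : ∀ x : ℝ, 0 ≤ x → ∀ y : ℝ, x ^ ((S.card : ℝ) * y) = (x ^ y) ^ S.card := by
        intro x hx y
        rw [mul_comm, Real.rpow_mul hx, Real.rpow_natCast]
      have hS1 : (2 : ℝ) ≤ 2 ^ S.card := by
        conv_lhs => rw [← pow_one (2 : ℝ)]
        exact pow_le_pow_right₀ (by norm_num) hS.card_pos
      have e2 : q ^ ((S.card : ℝ) / c3 dA β c) * ρ ^ (-((S.card : ℝ) / c3 dA β c)) =
          (q ^ (1 / c3 dA β c)) ^ S.card * (ρ ^ (-(1 / c3 dA β c))) ^ S.card := by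
        rw [← e1 q hq, ← e1 ρ hρ0.le]
        congr 2 <;> ring
      rw [e2] at hev
      calc (μ.real succ)⁻¹ * μ.real (succ ∩ {ω | S ⊆ choice (E ω, D ω, Ehat ω)})
          ≤ 2 ^ S.card * ((q ^ (1 / c3 dA β c)) ^ S.card * (ρ ^ (-(1 / c3 dA β c))) ^ S.card) :=
            mul_le_mul (hinv.trans hS1) hev measureReal_nonneg (by positivity)
        _ = _ := by rw [mul_pow, mul_pow]; ring

end Probability

end QExpander

namespace QExpander

/-! ### Circuits for functions of few inputs -/

namespace Circuit

variable {ι κ : Type*}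

/-- Substitution of circuits for the inputs of a circuit. -/
def bind (s : ι → Circuit κ) : Circuit ι → Circuit κ
  | const b => const b
  | input i => s i
  | not c => not (c.bind s)
  | and c d => and (c.bind s) (d.bind s)
  | or c d => or (c.bind s) (d.bind s)

lemma eval_bind (s : ι → Circuit κ) (x : κ → Bool) (c : Circuit ι) :
    (c.bind s).eval x = c.eval fun i => (s i).eval x := by
  induction c with
  | const b => rfl
  | input i => rfl
  | not c ih => simp [bind, eval, ih]
  | and c d ih1 ih2 => simp [bind, eval, ih1, ih2]
  | or c d ih1 ih2 => simp [bind, eval, ih1, ih2]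

lemma depth_bind_le {s : ι → Circuit κ} {n : ℕ} (hs : ∀ i, (s i).depth ≤ n) (c : Circuit ι) :
    (c.bind s).depth ≤ c.depth + n := by
  induction c with
  | const b => simp [bind, depth]
  | input i => simpa [bind, depth] using hs i
  | not c ih => simp only [bind, depth]; omega
  | and c d ih1 ih2 => simp only [bind, depth]; omega
  | or c d ih1 ih2 => simp only [bind, depth]; omega

/-- The exclusive or of two circuits. -/
def xor (c d : Circuit ι) : Circuit ι := or (and c (not d)) (and (not c) d)

lemma eval_xor (x : ι → Bool) (c d : Circuit ι) :
    (xor c d).eval x = Bool.xor (c.eval x) (d.eval x) := by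
  simp only [xor, eval]; cases c.eval x <;> cases d.eval x <;> rfl

lemma depth_xor_le {n : ℕ} {c d : Circuit ι} (hc : c.depth ≤ n) (hd : d.depth ≤ n) :
    (xor c d).depth ≤ n + 3 := by
  simp only [xor, depth]; omega

/-- A Boolean function of `k` of its inputs has a circuit of depth at most `3 k`. -/
lemma exists_eval_eq [DecidableEq ι] (S : Finset ι) (φ : (ι → Bool) → Bool)
    (hφ : ∀ x y : ι → Bool, (∀ i ∈ S, x i = y i) → φ x = φ y) :
    ∃ c : Circuit ι, c.depth ≤ 3 * S.card ∧ ∀ x, c.eval x = φ x := by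
  induction S using Finset.induction_on generalizing φ with
  | empty =>
    exact ⟨const (φ fun _ => false), by simp [depth], fun x => hφ _ _ (by simp)⟩
  | insert i S hi ih =>
    have hupd : ∀ b : Bool, ∀ x y : ι → Bool, (∀ j ∈ S, x j = y j) →
        φ (Function.update x i b) = φ (Function.update y i b) := by
      intro b x y h
      refine hφ _ _ fun j hj => ?_
      by_cases hji : j = i
      · subst hji; simp
      · rw [Function.update_of_ne hji, Function.update_of_ne hji]
        exact h j ((Finset.mem_insert.1 hj).resolve_left hji)
    obtain ⟨c1, hd1, he1⟩ := ih (fun x => φ (Function.update x i true)) (hupd true)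
    obtain ⟨c0, hd0, he0⟩ := ih (fun x => φ (Function.update x i false)) (hupd false)
    -- Shannon expansion on the input `i`: the selection adds at most three levels.
    refine ⟨or (and (input i) c1) (and (not (input i)) c0), ?_, fun x => ?_⟩
    · rw [Finset.card_insert_of_notMem hi]
      simp only [depth]; omega
    · simp only [eval, he1, he0]
      cases hx : x i
      · have : Function.update x i false = x := by rw [← hx]; exact Function.update_eq_self i x
        simp [this]
      · have : Function.update x i true = x := by rw [← hx]; exact Function.update_eq_self i x
        simp [this]

end Circuit

/-! ### A deterministic decoder of constant depth per round -/

section DecoderCircuit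

variable {A B : Type*} [Fintype A] [DecidableEq A] [Fintype B] [DecidableEq B]
  {G : A → B → Prop} [DecidableRel G] {dA dB : ℕ} {β : ℝ}

/-- The decrease sees `σ` only through the syndrome of the flip, which lies in the grid of the
generator. -/
lemma available_inter_grid (σ : Finset (CheckX A B)) (g : CheckZ A B) :
    available G dA β (σ ∩ grid G g) g = available G dA β σ g := by
  ext F
  simp only [available, Set.mem_ofPred_eq]
  refine and_congr_right fun _ => and_congr_right fun hF => ?_
  rw [decrease_eq, decrease_eq, Finset.inter_assoc,
    Finset.inter_eq_right.2 (syndrome_subset_grid G hF)]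

open Classical in
/-- A choice of an available flip that depends on the syndrome near the generator only. -/
noncomputable def pickFlip (G : A → B → Prop) [DecidableRel G] (dA : ℕ) (β : ℝ)
    (σ : Finset (CheckX A B)) (g : CheckZ A B) : Finset (Qubit A B) :=
  if h : (available G dA β (σ ∩ grid G g) g).Nonempty then h.some else ∅

lemma pickFlip_spec (σ : Finset (CheckX A B)) (g : CheckZ A B) :
    pickFlip G dA β σ g ∈ available G dA β σ g ∨
      (available G dA β σ g = ∅ ∧ pickFlip G dA β σ g = ∅) := by
  rw [pickFlip]
  split_ifs with h
  · left; rw [← available_inter_grid]; exact h.some_mem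
  · right; rw [← available_inter_grid]; exact ⟨Set.not_nonempty_iff_eq_empty.1 h, rfl⟩

lemma pickFlip_subset (σ : Finset (CheckX A B)) (g : CheckZ A B) :
    pickFlip G dA β σ g ⊆ gammaZ G g := by
  rcases pickFlip_spec (G := G) (dA := dA) (β := β) σ g with h | h
  · exact h.2.1
  · rw [h.2]; simp

lemma pickFlip_congr {σ σ' : Finset (CheckX A B)} {g : CheckZ A B}
    (h : ∀ x ∈ grid G g, x ∈ σ ↔ x ∈ σ') : pickFlip G dA β σ g = pickFlip G dA β σ' g := by
  have : σ ∩ grid G g = σ' ∩ grid G g := by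
    ext x; simp only [Finset.mem_inter]
    exact and_congr_left fun hx => h x hx
  unfold pickFlip
  generalize σ ∩ grid G g = τ at this ⊢
  subst this
  rfl

variable {χ : ℕ} (color : CheckZ A B → Fin χ)

/-- The total flip of a round with the choice `pickFlip`. -/
noncomputable def roundFlip (G : A → B → Prop) [DecidableRel G] (dA : ℕ) (β : ℝ) {χ : ℕ}
    (color : CheckZ A B → Fin χ) (k : ℕ) (σ : Finset (CheckX A B)) : Finset (Qubit A B) :=
  xorSum (Finset.univ.filter fun g : CheckZ A B => (color g : ℕ) = k) (pickFlip G dA β σ)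

lemma roundFlip_isRound (k : ℕ) (σ : Finset (CheckX A B)) :
    IsRound G dA β color k σ (roundFlip G dA β color k σ) :=
  ⟨pickFlip G dA β σ, fun g _ => pickFlip_spec σ g, rfl⟩

/-- The depth of a circuit for one round. -/
def roundDepth (dA dB : ℕ) : ℕ := 3 * (1 + (dB * dA + dB) * (dB * dA))

lemma card_generators_of_check (hG : IsBiregular G dA dB) (x : CheckX A B) :
    (Finset.univ.filter fun g => x ∈ grid G g).card = dA * dB := by
  have : (Finset.univ.filter fun g => x ∈ grid G g) = nbrA G x.1 ×ˢ nbrB G x.2 := by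
    ext g
    simp [mem_grid, mem_nbrA, mem_nbrB]
  rw [this, Finset.card_product, hG.1, hG.2]

/-- The set of the inputs that are on. -/
def onSet {ι : Type*} [Fintype ι] (x : ι → Bool) : Finset ι := Finset.univ.filter fun i => x i = true

lemma mem_onSet {ι : Type*} [Fintype ι] {x : ι → Bool} {i : ι} : i ∈ onSet x ↔ x i = true := by
  simp [onSet]

lemma onSet_decide {ι : Type*} [Fintype ι] [DecidableEq ι] (σ : Finset ι) :
    onSet (fun i => decide (i ∈ σ)) = σ := by
  ext i; simp [mem_onSet]

/-- Only the at most d_B generators containing `v` can flip it, and each reads only its own grid. -/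
lemma exists_flip_circuit (hG : IsBiregular G dA dB) (hdAB : dA ≤ dB) (k : ℕ) (v : Qubit A B) :
    ∃ c : Circuit (CheckX A B), c.depth ≤ roundDepth dA dB ∧
      ∀ x, c.eval x = decide (v ∈ roundFlip G dA β color k (onSet x)) := by
  set S := (Finset.univ.filter fun g => v ∈ gammaZ G g).biUnion fun g => grid G g with hS
  obtain ⟨c, hd, he⟩ := Circuit.exists_eval_eq S
    (fun x => decide (v ∈ roundFlip G dA β color k (onSet x))) (by
      intro x y hxy
      have : bit (roundFlip G dA β color k (onSet x)) v =
          bit (roundFlip G dA β color k (onSet y)) v := by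
        rw [roundFlip, roundFlip, bit_xorSum, bit_xorSum]
        refine Finset.sum_congr rfl fun g _ => ?_
        by_cases hv : v ∈ gammaZ G g
        · rw [pickFlip_congr fun z hz => ?_]
          rw [mem_onSet, mem_onSet, hxy z (Finset.mem_biUnion.2 ⟨g, Finset.mem_filter.2
            ⟨Finset.mem_univ _, hv⟩, hz⟩)]
        · rw [bit_eq_zero.2 fun h => hv (pickFlip_subset _ g h),
            bit_eq_zero.2 fun h => hv (pickFlip_subset _ g h)]
      rw [decide_eq_decide, ← bit_eq_one, ← bit_eq_one, this])
  refine ⟨c, hd.trans ?_, he⟩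
  rw [roundDepth]
  refine Nat.mul_le_mul_left _ ?_
  have h1 : S.card ≤ dB * (dB * dA) :=
    (Finset.card_biUnion_le_card_mul _ _ _ fun g _ => (card_grid hG g).le).trans
      (Nat.mul_le_mul_right _ (card_generators_le hG hdAB v))
  nlinarith

/-- Besides its old value, the bit at `z` is affected only by the d_A d_B generators whose grid
contains `z`. -/
lemma exists_syndrome_circuit (hG : IsBiregular G dA dB) (k : ℕ) (z : CheckX A B) :
    ∃ c : Circuit (CheckX A B), c.depth ≤ roundDepth dA dB ∧ ∀ x, c.eval x =
      decide (z ∈ symmDiff (onSet x) (syndrome G (roundFlip G dA β color k (onSet x)))) := by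
  set S := insert z ((Finset.univ.filter fun g => z ∈ grid G g).biUnion fun g => grid G g) with hS
  obtain ⟨c, hd, he⟩ := Circuit.exists_eval_eq S (fun x =>
    decide (z ∈ symmDiff (onSet x) (syndrome G (roundFlip G dA β color k (onSet x))))) (by
      intro x y hxy
      have h1 : bit (syndrome G (roundFlip G dA β color k (onSet x))) z =
          bit (syndrome G (roundFlip G dA β color k (onSet y))) z := by
        rw [roundFlip, roundFlip, syndrome_xorSum, syndrome_xorSum, bit_xorSum, bit_xorSum]
        refine Finset.sum_congr rfl fun g _ => ?_
        by_cases hv : z ∈ grid G g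
        · rw [pickFlip_congr fun w hw => ?_]
          rw [mem_onSet, mem_onSet, hxy w (Finset.mem_insert_of_mem (Finset.mem_biUnion.2
            ⟨g, Finset.mem_filter.2 ⟨Finset.mem_univ _, hv⟩, hw⟩))]
        · rw [bit_eq_zero.2 fun h => hv (syndrome_subset_grid G (pickFlip_subset _ g) h),
            bit_eq_zero.2 fun h => hv (syndrome_subset_grid G (pickFlip_subset _ g) h)]
      have h2 : bit (onSet x) z = bit (onSet y) z := by
        have := hxy z (Finset.mem_insert_self _ _)
        simp only [bit, mem_onSet, this]
      rw [decide_eq_decide, ← bit_eq_one, ← bit_eq_one, bit_symmDiff, bit_symmDiff, h1, h2])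
  refine ⟨c, hd.trans ?_, he⟩
  rw [roundDepth]
  refine Nat.mul_le_mul_left _ ?_
  have h1 : S.card ≤ dA * dB * (dB * dA) + 1 := by
    refine (Finset.card_insert_le _ _).trans (Nat.add_le_add_right ?_ _)
    rw [← card_generators_of_check hG z]
    exact Finset.card_biUnion_le_card_mul _ _ _ fun g _ => (card_grid hG g).le
  have h2 : (dB * dA + dB) * (dB * dA) = dA * dB * (dB * dA) + dB * (dB * dA) := by ring
  omega

/-- The syndrome and the estimated error after `i` rounds of the decoder with the choice
`pickFlip`. -/
noncomputable def decoderState (G : A → B → Prop) [DecidableRel G] (dA : ℕ) (β : ℝ) {χ : ℕ}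
    (color : CheckZ A B → Fin χ) (σ : Finset (CheckX A B)) :
    ℕ → Finset (CheckX A B) × Finset (Qubit A B)
  | 0 => (σ, ∅)
  | i + 1 =>
    let s := decoderState G dA β color σ i
    let F := roundFlip G dA β color (i % χ) s.1
    (symmDiff s.1 (syndrome G F), symmDiff s.2 F)

/-- Rounds are composed by substituting the syndrome circuits into those of the next round, so
depths add; recording the flip costs one further exclusive or, of depth three. -/
lemma exists_decoder_circuits (hG : IsBiregular G dA dB) (hdAB : dA ≤ dB) (i : ℕ) :
    ∃ (cs : CheckX A B → Circuit (CheckX A B)) (ce : Qubit A B → Circuit (CheckX A B)),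
      (∀ z, (cs z).depth ≤ roundDepth dA dB * i) ∧
      (∀ v, (ce v).depth ≤ (roundDepth dA dB + 3) * i) ∧
      ∀ σ : Finset (CheckX A B),
        (∀ z, (cs z).eval (fun x => decide (x ∈ σ)) =
          decide (z ∈ (decoderState G dA β color σ i).1)) ∧
        (∀ v, (ce v).eval (fun x => decide (x ∈ σ)) =
          decide (v ∈ (decoderState G dA β color σ i).2)) := by
  induction i with
  | zero =>
    exact ⟨Circuit.input, fun _ => Circuit.const false, fun _ => by simp [Circuit.depth],
      fun _ => by simp [Circuit.depth], fun σ => ⟨fun z => rfl, fun v => by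
        simp [Circuit.eval, decoderState]⟩⟩
  | succ i ih =>
    obtain ⟨cs, ce, hds, hde, hev⟩ := ih
    choose fl hfld hfl using fun v => exists_flip_circuit (β := β) color hG hdAB (i % χ) v
    choose sy hsyd hsy using fun z => exists_syndrome_circuit (β := β) color hG (i % χ) z
    refine ⟨fun z => (sy z).bind cs, fun v => Circuit.xor (ce v) ((fl v).bind cs),
      fun z => ?_, fun v => ?_, fun σ => ⟨fun z => ?_, fun v => ?_⟩⟩
    · have := Circuit.depth_bind_le hds (sy z)
      have := hsyd z
      change ((sy z).bind cs).depth ≤ _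
      rw [mul_add, mul_one]; omega
    · have h1 := Circuit.depth_bind_le hds (fl v)
      have h2 := hfld v
      have h3 := hde v
      have e : (roundDepth dA dB + 3) * (i + 1) =
          (roundDepth dA dB * i + 3 * i + roundDepth dA dB) + 3 := by ring
      rw [add_mul] at h3
      rw [e]
      exact Circuit.depth_xor_le (by omega) (by omega)
    · rw [Circuit.eval_bind, hsy]
      have : onSet (fun z => (cs z).eval fun x => decide (x ∈ σ)) =
          (decoderState G dA β color σ i).1 := by
        simp only [(hev σ).1]; exact onSet_decide _
      rw [this]; rfl
    · rw [Circuit.eval_xor, Circuit.eval_bind, hfl, (hev σ).2]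
      have : onSet (fun z => (cs z).eval fun x => decide (x ∈ σ)) =
          (decoderState G dA β color σ i).1 := by
        simp only [(hev σ).1]; exact onSet_decide _
      rw [this]
      simp only [decoderState, Finset.mem_symmDiff]
      by_cases h1 : v ∈ (decoderState G dA β color σ i).2 <;>
        by_cases h2 : v ∈ roundFlip G dA β color (i % χ) (decoderState G dA β color σ i).1 <;>
        simp [h1, h2]

theorem exists_circuit_output (hG : IsBiregular G dA dB) (hdAB : dA ≤ dB) (f : ℕ) :
    ∃ circ : Qubit A B → Circuit (CheckX A B),
      (∀ v, (circ v).depth ≤ (roundDepth dA dB + 3) * f) ∧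
      ∀ σ, IsParallelOutput G dA β color f σ (circuitOutput circ σ) := by
  obtain ⟨cs, ce, -, hde, hev⟩ := exists_decoder_circuits (β := β) color hG hdAB f
  refine ⟨ce, hde, fun σ => ⟨fun i => (decoderState G dA β color σ i).2,
    fun i => (decoderState G dA β color σ i).1,
    fun i => roundFlip G dA β color (i % χ) (decoderState G dA β color σ i).1, rfl, rfl,
    fun i _ => ⟨roundFlip_isRound color _ _, rfl, rfl⟩, ?_⟩⟩
  ext v
  simp [circuitOutput, (hev σ).2]

end DecoderCircuit

/-! ### The number of rounds -/

section Rounds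

variable {dA dB : ℕ} {δ β c : ℝ}

/-- The number of rounds is logarithmic. -/
lemma exists_f0_le (hdA : 1 ≤ dA) (hdB : 2 ≤ dB) (hδ : δ < 1 / 16) (hβ0 : 0 < β) (hδ0 : 0 < δ)
    (hβ : β < beta1 δ) (hc : c2 δ β + 1 < c) :
    ∃ C > (0 : ℝ), ∀ s : ℕ, (f0 dA dB δ β c s : ℝ) ≤ C * Real.log s := by
  have h1 := lt_eta hdA hdB hδ hβ0 hδ0 hβ hc
  have h2 := eta_lt_one hdA hdB hδ hβ0 hδ0 hβ hc
  set η := eta dA dB δ β c with hη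
  have hl : 0 < Real.log (1 / η) := Real.log_pos (by rw [lt_div_iff₀ (by linarith)]; linarith)
  have hl2 : 0 < Real.log 2 := Real.log_pos (by norm_num)
  -- The ceiling adds at most 1, which is at most log s / log 2 for s ≥ 2; for s = 0 and s = 1 both
  -- sides vanish.
  refine ⟨chi dA dB / Real.log (1 / η) + 1 / Real.log 2, by positivity, fun s => ?_⟩
  rcases Nat.lt_or_ge s 2 with hs | hs
  · have : s = 0 ∨ s = 1 := by omega
    rcases this with rfl | rfl <;> simp [f0]
  · have hlog : Real.log 2 ≤ Real.log s :=
      Real.log_le_log (by norm_num) (by exact_mod_cast hs)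
    have h0 : 0 ≤ (chi dA dB : ℝ) * Real.logb (1 / η) s := by
      rw [Real.logb]
      have : 0 ≤ Real.log s := hl2.le.trans hlog
      positivity
    have h3 := (Nat.ceil_lt_add_one h0).le
    have h4 : 1 ≤ 1 / Real.log 2 * Real.log s := by
      rw [one_div_mul_eq_div, le_div_iff₀ hl2]; linarith
    have h5 : (chi dA dB : ℝ) * Real.logb (1 / η) s =
        chi dA dB / Real.log (1 / η) * Real.log s := by rw [Real.logb]; ring
    rw [f0, ← hη]
    rw [add_mul]
    linarith

end Rounds

end QExpander

/-! ### Assembly of the two claims -/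

theorem mainTheorem3 (dA dB : ℕ) (γ δ β c : ℝ)
    (hdA : 1 ≤ dA) (hdAB : dA ≤ dB) (hdB : 2 ≤ dB)
    (hγ : 0 < γ) (hδ0 : 0 < δ) (hδ : δ < 1 / 16)
    (hβ0 : 0 < β) (hβ : β < beta1 δ) (hc : c2 δ β + 1 < c) :
    -- the residual error is local stochastic, with constants uniform over all codes and noises
    (∃ p₀ > (0 : ℝ), ∃ p₁ > (0 : ℝ), ∃ K > (0 : ℝ), ∃ κ > (0 : ℝ),
      ∀ (A B : Type*) [Fintype A] [DecidableEq A] [Fintype B] [DecidableEq B]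
        (G : A → B → Prop) [DecidableRel G],
        IsBiregular G dA dB → IsExpanding G dA dB γ δ →
      ∀ color : CheckZ A B → Fin (chi dA dB), IsGoodColoring G color →
      ∀ (Ω : Type*) [MeasurableSpace Ω] (μ : Measure Ω) [IsProbabilityMeasure μ]
        (E : Ω → Finset (Qubit A B)) (D : Ω → Finset (CheckX A B))
        (Ehat : Ω → Finset (Qubit A B)) (pPhys pSynd : ℝ),
        IsRandomSet E → IsRandomSet D → IsRandomSet Ehat →
        0 ≤ pPhys → pPhys < p₀ → 0 ≤ pSynd → pSynd < p₁ →
        IsLocalStochasticPair μ E D pPhys pSynd →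
        (∀ ω, IsParallelOutput G dA β color
          (f0 dA dB δ β c (symmDiff (syndrome G (E ω)) (D ω)).card)
          (symmDiff (syndrome G (E ω)) (D ω)) (Ehat ω)) →
        ∃ succ : Set Ω, MeasurableSet succ ∧
          1 - Real.exp (-κ * Real.sqrt (Fintype.card (Qubit A B))) ≤ μ.real succ ∧
          ∃ Els : Ω → Finset (Qubit A B), IsRandomSet Els ∧
            (∀ ω, Equivalent G (Els ω) (symmDiff (E ω) (Ehat ω))) ∧
            IsLocalStochastic (μ[|succ]) Els (K * pSynd ^ (1 / c3 dA β c))) ∧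
    -- the number of rounds is logarithmic, and so is the depth of the decoder
    (∃ C > (0 : ℝ),
      (∀ s : ℕ, (f0 dA dB δ β c s : ℝ) ≤ C * Real.log s) ∧
      ∀ (A B : Type*) [Fintype A] [DecidableEq A] [Fintype B] [DecidableEq B]
        (G : A → B → Prop) [DecidableRel G],
        IsBiregular G dA dB →
      ∀ color : CheckZ A B → Fin (chi dA dB), IsGoodColoring G color →
      ∀ s : ℕ, ∃ circ : Qubit A B → Circuit (CheckX A B),
        (∀ v, ((circ v).depth : ℝ) ≤ C * Real.log s) ∧
        ∀ σ : Finset (CheckX A B),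
          IsParallelOutput G dA β color (f0 dA dB δ β c s) σ (circuitOutput circ σ)) := by
  refine ⟨⟨noiseThreshold dA dB γ β, noiseThreshold_pos _ _, noiseThreshold dA dB γ β,
    noiseThreshold_pos _ _, 2 * noiseThreshold dA dB γ β ^ (-(1 / c3 dA β c)),
    mul_pos two_pos (Real.rpow_pos_of_pos (noiseThreshold_pos _ _) _),
    1 / Real.sqrt (sizeRatio dA dB γ),
    one_div_pos.2 (Real.sqrt_pos.2 (one_pos.trans_le (one_le_sizeRatio γ))), ?_⟩, ?_⟩
  · intro A B _ _ _ _ G _ hG hX color hcol Ω _ μ _ E D Ehat p q hE hD hEhat hp hpρ hq hqρ hloc hout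
    exact exists_localStochastic_residual hG hX hγ hdA hdAB hdB hδ0 hδ hβ0 hβ hc hcol hE hD hEhat
      hp hpρ hq hqρ hloc hout
  · obtain ⟨C, hC, hf⟩ := exists_f0_le (dA := dA) (dB := dB) (δ := δ) (β := β) (c := c)
      hdA hdB hδ hβ0 hδ0 hβ hc
    -- The depth per round times the constant for the number of rounds; since the first factor is at
    -- least 1, this bounds the number of rounds as well.
    refine ⟨(roundDepth dA dB + 3) * C, by positivity, fun s => (hf s).trans ?_, ?_⟩
    · refine mul_le_mul_of_nonneg_right (le_mul_of_one_le_left hC.le ?_) (Real.log_natCast_nonneg s)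
      have : (0 : ℝ) ≤ roundDepth dA dB := Nat.cast_nonneg _
      linarith
    · intro A B _ _ _ _ G _ hG color _ s
      obtain ⟨circ, hd, hout⟩ :=
        exists_circuit_output (β := β) color hG hdAB (f0 dA dB δ β c s)
      refine ⟨circ, fun v => ?_, hout⟩
      calc ((circ v).depth : ℝ) ≤ (roundDepth dA dB + 3) * (f0 dA dB δ β c s : ℝ) := by
            exact_mod_cast hd v
        _ ≤ (roundDepth dA dB + 3) * (C * Real.log s) :=
            mul_le_mul_of_nonneg_left (hf s) (by positivity)
        _ = _ := by ring
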